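/- Notation. Phase space is $\mathbb R^4\ni X=(x,y,\xi,\zeta)$, $k=(\xi,\zeta)$, $\langle k\rangle=\sqrt{1+|k|^2}$. For $m>0$, $S^m$ is the set of smooth $\mathbb M_n(\mathbb C)$-valued symbols $\sigma$ with $|\partial_k^\alpha\partial_{(x,y)}^\beta\sigma|\le C_{\alpha,\beta}\langle k\rangle^{m-|\alpha|}$; a Hermitian-valued $\sigma\in S^m$ is elliptic if its smallest singular value is at least $C\langle k\rangle^m-1$ for some $C>0$. Hypotheses. Let $H_1={\rm Op}^w\sigma$ with $\sigma\in S^m$ Hermitian-valued and elliptic, and let $\sigma_N(k),\sigma_S(k)$ be Hermitian-valued elliptic symbols in $S^m$ independent of $(x,y)$ such that, for some $L>0$, $\sigma=\sigma_N$ when $y>L$ and $\sigma=\sigma_S$ when $y<-L$. Let $E_1<0<E_2$ be such that $E-\sigma_{N/S}(k)$ is invertible for all $k\in\mathbb R^2$ and $E\in[E_1,E_2]$. Assume moreover that one of the following holds: (a) the variation across the interface is of lower order: $\langle k\rangle^{-m}\,\partial_y\sigma(x,y,k)\to0$ as $|k|\to\infty$, uniformly in $(x,y)$ (for instance $\partial_y\sigma=O(\langle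 k\rangle^{m-1})$); or (b) $H_1$ is a partial differential operator of odd order $m$ (for instance, $m=1$). Let $\Pi^{N/S}_-(k)$ be the spectral projector of $\sigma_{N/S}(k)$ onto its negative eigenvalues, and assume that for every $\theta\in\mathbb S^1$ the limits $\lim_{r\to\infty}\Pi^N_-(r\theta)=\lim_{r\to\infty}\Pi^S_-(r\theta)$ exist and coincide, the common limit being continuous in $\theta$. Let $\Pi_-^{\rm BD}$ be the function on $\mathbb S^2$ that equals $\Pi^{N}_-(k)$ at $(k,1)/\langle k\rangle$, $\Pi^S_-(k)$ at $(k,-1)/\langle k\rangle$, and this common limit at the point $(\theta,0)$ of the equator. Let $a(X)=\sigma(X)-ix$ be the symbol of $F=H_1-ix$. Conclusion. $\Pi_-^{\rm BD}$ is a continuous family of orthogonal projectors on $\mathbb S^2$. There is $R>0$ such that $a(X)$ is invertible for $|X|\ge R$, and for every such $R$ $$ {\rm F}_2[a]:=\frac1{24\pi^2}\int_{\mathbb S^3_R}{\rm tr}\,(a^{-1}da)^{\wedge3}= c[\Pi_-^{\rm BD}], $$ where $\mathbb S^3_R$ is the sphere of radius $R$ oriented as the boundary of the ball with $d\xi\wedge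 dx\wedge d\zeta\wedge dy>0$, and where the Chern number is $$ c[\Pi_-^{\rm BD}]=\frac i{2\pi}\int_{\mathbb S^2}{\rm tr}\,\Pi_-^{\rm BD}d\Pi_-^{\rm BD}\wedge d\Pi_-^{\rm BD}=\lim_{\rho\to\infty}\frac i{2\pi}\int_{|k|<\rho}{\rm tr}\Big(\Pi^S_-[\partial_1\Pi^S_-,\partial_2\Pi^S_-]-\Pi^N_-[\partial_1\Pi^N_-,\partial_2\Pi^N_-]\Big)dk ;$$ the limit exists, and it is the integral over $\mathbb R^2$ whenever the integrand is integrable there. Dirac operator. Let $H_1=D\cdot\sigma+m(y)\sigma_3$ with $m$ smooth, $m(y)=m_+\neq0$ for $y\ge L$ and $m(y)=m_-\ne0$ for $y\le-L$, for some $L>0$. Then the negative spectral projectors of the two bulk symbols satisfy the gluing condition, and ${\rm F}_2[a]=c[\Pi_-^{\rm BD}]=\frac12({\rm sgn}\,m_--{\rm sgn}\,m_+)$. -/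

import Mathlib

open Filter Topology MeasureTheory

noncomputable section

namespace BulkDifference

/-- Points of phase space `ℝ⁴`, with coordinates `(x, y, ξ, ζ)` in this order. -/
abbrev Phase := EuclideanSpace ℝ (Fin 4)

/-- Points `k = (ξ, ζ)` of a momentum plane. -/
abbrev Momentum := EuclideanSpace ℝ (Fin 2)

abbrev Mat (n : ℕ) := Matrix (Fin n) (Fin n) ℂ

/-- The unit sphere `𝕊²` in `ℝ³`. -/
abbrev Sphere2 := Metric.sphere (0 : EuclideanSpace ℝ (Fin 3)) 1

/-- The momentum component `(ξ, ζ)` of a phase space point. -/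
def mom (X : Phase) : Momentum := !₂[X 2, X 3]

/-- `⟨k⟩ = √(1 + |k|²)`. -/
def bracket (k : Momentum) : ℝ := Real.sqrt (1 + ‖k‖ ^ 2)

/-- The partial derivative along the `i`-th coordinate of a matrix-valued function, taken
entry by entry. -/
def pderiv {d n : ℕ} (i : Fin d) (f : EuclideanSpace ℝ (Fin d) → Mat n)
    (X : EuclideanSpace ℝ (Fin d)) : Mat n :=
  Matrix.of fun p q => fderiv ℝ (fun Y => f Y p q) X (EuclideanSpace.single i 1)

/-! ### Symbol classes and the hypothesis on the interface Hamiltonian -/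

/-- The class `S^m`: smooth matrix-valued symbols all of whose partial derivatives, with `|α|`
derivatives in `(ξ, ζ)` and any number of derivatives in `(x, y)`, are `O(⟨k⟩^(m - |α|))`
uniformly on phase space. A partial derivative of order `N` is given by the sequence
`s : Fin N → Fin 4` of the coordinates in which one differentiates. -/
structure IsSymbol {n : ℕ} (m : ℝ) (a : Phase → Mat n) : Prop where
  smooth : ∀ p q, ContDiff ℝ (⊤ : ℕ∞) fun X => a X p q
  bound : ∀ (N : ℕ) (s : Fin N → Fin 4), ∃ C : ℝ, ∀ X p q,
    ‖iteratedFDeriv ℝ N (fun Y => a Y p q) X (fun l => EuclideanSpace.single (s l) 1)‖ ≤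
      C * bracket (mom X) ^ (m - ((Finset.univ.filter fun l => 2 ≤ s l).card : ℝ))

/-- Ellipticity of order `m`: the smallest singular value of `a(X)` is at least `C⟨k⟩^m - 1`
for some `C > 0`. -/
def IsEllipticSymbol {n : ℕ} (m : ℝ) (a : Phase → Mat n) : Prop :=
  ∃ C : ℝ, 0 < C ∧ ∀ (X : Phase) (v : EuclideanSpace ℂ (Fin n)),
    (C * bracket (mom X) ^ m - 1) * ‖v‖ ≤ ‖Matrix.toEuclideanLin (a X) v‖

/-- Hermitian-valued elliptic symbols in `S^m`. -/
structure IsHermitianElliptic {n : ℕ} (m : ℝ) (a : Phase → Mat n) : Prop where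
  symbol : IsSymbol m a
  hermitian : ∀ X, (a X).IsHermitian
  elliptic : IsEllipticSymbol m a

/-- The Hamiltonian with Weyl symbol `σ` is elliptic of order `m > 0`, coincides for `y > L` and
for `y < -L` with elliptic bulk Hamiltonians with symbols `σN(ξ, ζ)` and `σS(ξ, ζ)`, and
`[E₁, E₂]` is a bulk spectral gap. -/
structure InterfaceHamiltonian {n : ℕ} (m : ℝ) (σ : Phase → Mat n) (σN σS : Momentum → Mat n)
    (L E₁ E₂ : ℝ) : Prop where
  order_pos : 0 < m
  interface : IsHermitianElliptic m σ
  bulk_north : IsHermitianElliptic m fun X => σN (mom X)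
  bulk_south : IsHermitianElliptic m fun X => σS (mom X)
  width_pos : 0 < L
  eq_north : ∀ X : Phase, L < X 1 → σ X = σN (mom X)
  eq_south : ∀ X : Phase, X 1 < -L → σ X = σS (mom X)
  gap_nonempty : E₁ < E₂
  gap_north : ∀ E ∈ Set.Icc E₁ E₂, ∀ k, IsUnit ((E : ℂ) • (1 : Mat n) - σN k)
  gap_south : ∀ E ∈ Set.Icc E₁ E₂, ∀ k, IsUnit ((E : ℂ) • (1 : Mat n) - σS k)

/-- The variation of the symbol across the interface is of lower order:
`∂σ/∂y = o(⟨k⟩^m)` as `|k| → ∞`, uniformly in `(x, y)`. -/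
def LowerOrderWall {n : ℕ} (m : ℝ) (σ : Phase → Mat n) : Prop :=
  ∀ ε : ℝ, 0 < ε → ∃ ρ : ℝ, ∀ (X : Phase) (p q : Fin n), ρ ≤ ‖mom X‖ →
    ‖pderiv 1 σ X p q‖ ≤ ε * bracket (mom X) ^ m

/-- `σ` is the symbol of a partial differential operator of order at most `d`: at each point
`(x, y)` it is a polynomial of degree at most `d` in `(ξ, ζ)`. -/
def IsDifferentialSymbol {n : ℕ} (d : ℕ) (σ : Phase → Mat n) : Prop :=
  ∀ (x y : ℝ) (p q : Fin n), ∃ P : MvPolynomial (Fin 2) ℂ, P.totalDegree ≤ d ∧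
    ∀ k : Momentum, σ !₂[x, y, k 0, k 1] p q = MvPolynomial.eval (fun l => ((k l : ℝ) : ℂ)) P

/-! ### The Fedosov–Hörmander invariant -/

/-- The symbol `a = σ - ix` of `F = H₁ - ix`. -/
def domainWallSymbol {n : ℕ} (σ : Phase → Mat n) (X : Phase) : Mat n :=
  σ X - (Complex.I * ((X 0 : ℝ) : ℂ)) • (1 : Mat n)

/-- The coordinates of phase space in the positive order `(ξ, x, ζ, y)`. -/
def orientedCoord : Fin 4 → Fin 4 := ![2, 0, 3, 1]

/-- The component `a⁻¹ ∂ᵢ a` of the matrix-valued one-form `a⁻¹ da` along the `i`-th coordinate,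
in the positive order of the coordinates. -/
def logDeriv {n : ℕ} (a : Phase → Mat n) (i : Fin 4) (X : Phase) : Mat n :=
  (a X)⁻¹ * pderiv (orientedCoord i) a X

/-- The density of the three-form `tr (a⁻¹ da)^{∧3}` with respect to the surface measure of the
sphere through `X` centred at the origin, `θ` being its outward unit normal at `X`: the value of
`θ♭ ∧ tr (a⁻¹ da)^{∧3}` on the positive orthonormal frame `(e_ξ, e_x, e_ζ, e_y)`. -/
def sphereDensity {n : ℕ} (a : Phase → Mat n) (θ X : Phase) : ℂ :=
  ∑ τ : Equiv.Perm (Fin 4), ((Equiv.Perm.sign τ : ℤ) : ℂ) *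
    ((θ (orientedCoord (τ 0)) : ℝ) : ℂ) *
      (logDeriv a (τ 1) X * logDeriv a (τ 2) X * logDeriv a (τ 3) X).trace

/-- `F₂[a] = (1 / 24π²) ∫ tr (a⁻¹ da)^{∧3}` over the sphere of radius `R` in phase space, oriented
as the boundary of the ball with `dξ ∧ dx ∧ dζ ∧ dy > 0`. -/
def fedosovHormander {n : ℕ} (a : Phase → Mat n) (R : ℝ) : ℂ :=
  1 / (24 * (Real.pi : ℂ) ^ 2) * ((R : ℂ) ^ 3 *
    ∫ θ : Metric.sphere (0 : Phase) 1, sphereDensity a θ (R • (θ : Phase))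
      ∂((volume : Measure Phase).toSphere))

/-- `a` is invertible outside the open ball of radius `R`. -/
def InvertibleOutside {n : ℕ} (a : Phase → Mat n) (R : ℝ) : Prop :=
  ∀ X : Phase, R ≤ ‖X‖ → IsUnit (a X)

/-! ### The bulk-difference projector and its Chern number -/

/-- The spectral projector of a Hermitian matrix onto its negative eigenvalues. -/
def negProj {n : ℕ} (A : Mat n) : Mat n :=
  cfc (fun t : ℝ => if t < 0 then (1 : ℝ) else 0) A

/-- The gluing condition: in each direction `θ`, both families of projectors converge at infinity
to the same limit `Pinf θ`, which is continuous in `θ`. -/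
structure GluesAtInfinity {n : ℕ} (PN PS Pinf : Momentum → Mat n) : Prop where
  continuous_limit : ContinuousOn Pinf (Metric.sphere 0 1)
  north : ∀ θ : Momentum, ‖θ‖ = 1 → Tendsto (fun r : ℝ => PN (r • θ)) atTop (𝓝 (Pinf θ))
  south : ∀ θ : Momentum, ‖θ‖ = 1 → Tendsto (fun r : ℝ => PS (r • θ)) atTop (𝓝 (Pinf θ))

lemma bracket_sq (k : Momentum) : bracket k ^ 2 = 1 + ‖k‖ ^ 2 :=
  Real.sq_sqrt (by positivity)

lemma bracket_pos (k : Momentum) : 0 < bracket k :=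
  Real.sqrt_pos.mpr (by positivity)

lemma planeToSphere_mem (s : ℤˣ) (k : Momentum) :
    !₂[k 0 / bracket k, k 1 / bracket k, ((s : ℤ) : ℝ) / bracket k] ∈ Sphere2 := by
  have h := bracket_sq k
  have hp := (bracket_pos k).ne'
  rw [EuclideanSpace.norm_eq, Real.sq_sqrt (by positivity)] at h
  simp only [Fin.sum_univ_two, Real.norm_eq_abs, sq_abs] at h
  have hs : (((s : ℤ) : ℝ)) ^ 2 = 1 := by
    rcases Int.units_eq_one_or s with rfl | rfl <;> simp
  rw [mem_sphere_zero_iff_norm, EuclideanSpace.norm_eq, Real.sqrt_eq_one]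
  simp only [Fin.sum_univ_three, Real.norm_eq_abs, sq_abs]
  simp only [Matrix.cons_val, div_pow, hs]
  field_simp
  linarith

/-- Radial compactification: the plane `P_N` (`s = 1`) is mapped onto the open upper hemisphere and
`P_S` (`s = -1`) onto the open lower one, by `k ↦ (k, s) / √(1 + |k|²)`. -/
def planeToSphere (s : ℤˣ) (k : Momentum) : Sphere2 :=
  ⟨!₂[k 0 / bracket k, k 1 / bracket k, ((s : ℤ) : ℝ) / bracket k], planeToSphere_mem s k⟩

/-- The inverse of both maps `planeToSphere s`, away from the equator. -/
def sphereToPlane (φ : Sphere2) : Momentum :=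
  !₂[φ.1 0 / |φ.1 2|, φ.1 1 / |φ.1 2|]

/-- The bulk-difference projector on `𝕊²`: `PN` on the upper hemisphere, `PS` on the lower one and
the common limit at infinity on the equator. -/
def bulkDifferenceProj {n : ℕ} (PN PS Pinf : Momentum → Mat n) (φ : Sphere2) : Mat n :=
  if 0 < φ.1 2 then PN (sphereToPlane φ)
  else if φ.1 2 < 0 then PS (sphereToPlane φ)
  else Pinf !₂[φ.1 0, φ.1 1]

/-- `tr P [∂₁P, ∂₂P]`. -/
def curvature {n : ℕ} (P : Momentum → Mat n) (k : Momentum) : ℂ :=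
  (P k * (pderiv 0 P k * pderiv 1 P k - pderiv 1 P k * pderiv 0 P k)).trace

/-- The two-form `tr P dP ∧ dP` on `𝕊²`, read off in the momentum planes: the two hemispheres are
added over each `k`, the orientation being that of `P_S` and opposite to that of `P_N`. -/
def chernDensity {n : ℕ} (P : Sphere2 → Mat n) (k : Momentum) : ℂ :=
  curvature (fun k' => P (planeToSphere (-1) k')) k -
    curvature (fun k' => P (planeToSphere 1 k')) k

/-- `(i / 2π) ∫ tr P dP ∧ dP` over `𝕊²` converges to `c`. As `P` need not be differentiable on the
equator, the integral is the limit of the integrals outside the bands around the equator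
that correspond to `|k| ≥ ρ`, as `ρ → ∞`. -/
def HasChernNumber {n : ℕ} (P : Sphere2 → Mat n) (c : ℂ) : Prop :=
  Tendsto (fun ρ : ℝ => Complex.I / (2 * (Real.pi : ℂ)) *
    ∫ k in Metric.ball (0 : Momentum) ρ, chernDensity P k) atTop (𝓝 c)

/-! ### Dirac operators -/

/-- The symbol `ξ σ₁ + ζ σ₂ + μ σ₃` of the Dirac operator with constant mass `μ`. -/
def diracBulk (μ : ℝ) (k : Momentum) : Mat 2 :=
  ((k 0 : ℝ) : ℂ) • !![0, 1; 1, 0] + ((k 1 : ℝ) : ℂ) • !![0, -Complex.I; Complex.I, 0] +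
    (μ : ℂ) • !![1, 0; 0, -1]

/-- The symbol of the Dirac operator `D·σ + μ(y) σ₃`. -/
def diracSymbol (μ : ℝ → ℝ) (X : Phase) : Mat 2 := diracBulk (μ (X 1)) (mom X)

end BulkDifference

end

/-! The form `tr (a⁻¹ da)^{∧3}` is closed wherever `a` is invertible. By Stokes, the sphere integral
equals the volume integral of `-du ∧ tr (a⁻¹ da)^{∧3}` for every compactly supported cutoff `u` that
is 1 near the singular points of `a` (`integral_wedge_eq_zero`,
`integral_wedge_eq_fedosovHormander`). For Hermitian `A` one has `‖(A - ix)v‖² = ‖Av‖² + x²‖v‖²`, so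
by the bulk gap and ellipticity `a` is singular only over `x = 0` and a bounded part of the wall.
The proof exploits the freedom in `u`.

The symbol may be frozen at `x = 0` by a deformation that stays invertible off this set
(`fedosovHormander_eq_freeze`). Stretching the cutoff to infinity in `x` then removes the derivative
of `u` along `x`. One of the three factors `a⁻¹∂a` is now `-i(σ - ix)⁻¹`, and the density becomes a
trace with three resolvents (`eq_integral_omega`).

Finally the cutoff is taken as `α(y) β(k/ρ)` with `ρ → ∞`. Where `α` is differentiated, the symbol
is a bulk symbol, and the integral over `x` of the resolvents is `4π` times the curvature of the
negative spectral projector (`curvature_negProj`). Where `β` is differentiated, the scaling `(x, k)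
↦ (ρᵐx, ρk)` shows that the contribution stays bounded, and it tends to 0
(`tendsto_integral_lateral`). Under (a) this is because `∂σ/∂y` is of lower order
(`IsWall.lateralParity_of_lowerOrder`). Under (b) the leading part of the symbol is odd in `k`, so
the limiting density is even under `(x, k) ↦ (-x, -k)` whereas `∂β` is odd
(`IsWall.lateralParity_of_polynomial`). As the bulk curvatures are `O(|k|⁻²)`, thin shells carry
little mass and smooth cutoffs may be replaced by balls (`tendsto_integral_ball`).

Continuity on the sphere rests on a uniform Lipschitz bound in the direction of `k` at large `|k|`
(`IsHermitianElliptic.angularLipschitz`), which turns radial limits into joint ones. For the Dirac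
operator the projectors are explicit, their curvature is radial, and (b) holds with order 1. -/

namespace BulkDifference

open scoped Matrix.Norms.L2Operator

/-! ### Operator norm and calculus of matrix-valued functions, reduced to entries. -/

section MatrixNorms

variable {n : ℕ}

lemma norm_entry_le (A : Mat n) (p q : Fin n) : ‖A p q‖ ≤ ‖A‖ := by
  have h := Matrix.l2_opNorm_mulVec A (EuclideanSpace.single q (1 : ℂ))
  rw [PiLp.norm_single, norm_one, mul_one] at h
  refine le_trans ?_ ((PiLp.norm_apply_le _ p).trans h)
  simp [Matrix.mulVec_single]

lemma norm_trace_le (A : Mat n) : ‖A.trace‖ ≤ n * ‖A‖ := by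
  refine (norm_sum_le _ _).trans ((Finset.sum_le_sum fun i _ => norm_entry_le A i i).trans ?_)
  simp

lemma norm_single_le (p q : Fin n) (c : ℂ) : ‖(Matrix.single p q c : Mat n)‖ ≤ ‖c‖ := by
  rw [Matrix.cstar_norm_def]
  refine ContinuousLinearMap.opNorm_le_bound _ (norm_nonneg _) fun v => ?_
  have : Matrix.toEuclideanCLM (n := Fin n) (𝕜 := ℂ) (Matrix.single p q c) v =
      EuclideanSpace.single p (c * v q) := by
    ext i
    simp only [Matrix.ofLp_toEuclideanCLM, Matrix.single_mulVec, EuclideanSpace.single]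
    simp [Function.update_apply]
  rw [this, PiLp.norm_single, norm_mul]
  exact mul_le_mul_of_nonneg_left (PiLp.norm_apply_le _ _) (norm_nonneg _)

lemma norm_le_sum_entries (A : Mat n) : ‖A‖ ≤ ∑ p, ∑ q, ‖A p q‖ := by
  conv_lhs => rw [Matrix.matrix_eq_sum_single A]
  refine (norm_sum_le _ _).trans (Finset.sum_le_sum fun p _ => (norm_sum_le _ _).trans
    (Finset.sum_le_sum fun q _ => norm_single_le _ _ _))

lemma norm_le_of_entries (A : Mat n) {M : ℝ} (h : ∀ p q, ‖A p q‖ ≤ M) : ‖A‖ ≤ n * (n * M) := by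
  refine (norm_le_sum_entries A).trans ?_
  refine (Finset.sum_le_sum fun p _ => Finset.sum_le_sum fun q _ => h p q).trans ?_
  simp

/-- Evaluation of a matrix entry. -/
noncomputable def entryCLM (p q : Fin n) : Mat n →L[ℝ] ℂ :=
  LinearMap.toContinuousLinearMap
    { toFun := fun A => A p q
      map_add' := fun _ _ => rfl
      map_smul' := fun _ _ => rfl }

/-- The matrix with a single nonzero entry. -/
noncomputable def singleCLM (p q : Fin n) : ℂ →L[ℝ] Mat n :=
  LinearMap.toContinuousLinearMap
    { toFun := fun c => Matrix.single p q c
      map_add' := fun _ _ => Matrix.single_add _ _ _ _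
      map_smul' := fun t c => by ext; simp [Matrix.single_apply] }

/-- The trace. -/
noncomputable def traceCLM : Mat n →L[ℝ] ℂ :=
  LinearMap.toContinuousLinearMap
    { toFun := fun A => A.trace
      map_add' := fun _ _ => Matrix.trace_add _ _
      map_smul' := fun _ _ => Matrix.trace_smul _ _ }

@[simp] lemma entryCLM_apply (p q : Fin n) (A : Mat n) : entryCLM p q A = A p q := rfl
@[simp] lemma singleCLM_apply (p q : Fin n) (c : ℂ) : singleCLM p q c = Matrix.single p q c := rfl
@[simp] lemma traceCLM_apply (A : Mat n) : traceCLM A = A.trace := rfl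

variable {E : Type*} [NormedAddCommGroup E] [NormedSpace ℝ E]

lemma eq_sum_singleCLM {E : Type*} (a : E → Mat n) : a = fun X => ∑ p, ∑ q, singleCLM p q (a X p q) := by
  funext X
  exact Matrix.matrix_eq_sum_single (a X)

lemma contDiff_of_entries {k : WithTop ℕ∞} {a : E → Mat n}
    (h : ∀ p q, ContDiff ℝ k fun X => a X p q) : ContDiff ℝ k a := by
  rw [eq_sum_singleCLM a]
  exact ContDiff.sum fun p _ => ContDiff.sum fun q _ => (singleCLM p q).contDiff.comp (h p q)

lemma differentiableAt_entry {a : E → Mat n} {X : E} (h : DifferentiableAt ℝ a X) (p q : Fin n) :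
    DifferentiableAt ℝ (fun Y => a Y p q) X :=
  (entryCLM p q).differentiableAt.comp X h

lemma hasFDerivAt_of_entries {a : E → Mat n} {X : E} {a' : Fin n → Fin n → E →L[ℝ] ℂ}
    (h : ∀ p q, HasFDerivAt (fun Y => a Y p q) (a' p q) X) :
    HasFDerivAt a (∑ p, ∑ q, (singleCLM p q).comp (a' p q)) X := by
  rw [eq_sum_singleCLM a]
  exact HasFDerivAt.fun_sum fun p _ => HasFDerivAt.fun_sum fun q _ =>
    (singleCLM p q).hasFDerivAt.comp X (h p q)

lemma pderiv_eq_fderiv {d : ℕ} {a : EuclideanSpace ℝ (Fin d) → Mat n}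
    {X : EuclideanSpace ℝ (Fin d)} (h : DifferentiableAt ℝ a X) (i : Fin d) :
    pderiv i a X = fderiv ℝ a X (EuclideanSpace.single i 1) := by
  ext p q
  have h2 : fderiv ℝ (fun Y => a Y p q) X = (entryCLM p q).comp (fderiv ℝ a X) :=
    ((entryCLM p q).hasFDerivAt.comp X h.hasFDerivAt).fderiv
  simp only [pderiv, Matrix.of_apply]
  rw [h2]; rfl

lemma pderiv_congr {d : ℕ} {a b : EuclideanSpace ℝ (Fin d) → Mat n}
    {X : EuclideanSpace ℝ (Fin d)} (h : a =ᶠ[𝓝 X] b) (i : Fin d) :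
    pderiv i a X = pderiv i b X := by
  ext p q
  have : (fun Y => a Y p q) =ᶠ[𝓝 X] fun Y => b Y p q := h.mono fun Y hY => congrFun (congrFun hY p) q
  simp only [pderiv, Matrix.of_apply, this.fderiv_eq]

lemma continuous_pderiv {d : ℕ} {a : EuclideanSpace ℝ (Fin d) → Mat n} (h : ContDiff ℝ 1 a)
    (i : Fin d) : Continuous (pderiv i a) := by
  have : pderiv i a = fun X => fderiv ℝ a X (EuclideanSpace.single i 1) := by
    funext X
    exact pderiv_eq_fderiv (h.differentiable one_ne_zero X) i
  rw [this]
  exact (h.continuous_fderiv one_ne_zero).clm_apply continuous_const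

lemma contDiffAt_matrix_inv {k : WithTop ℕ∞} {a : E → Mat n} {X : E} (h : ContDiffAt ℝ k a X)
    (hX : IsUnit (a X)) : ContDiffAt ℝ k (fun Y => (a Y)⁻¹) X := by
  simp_rw [Matrix.nonsing_inv_eq_ringInverse]
  obtain ⟨u, hu⟩ := hX
  have := contDiffAt_ringInverse ℝ (n := k) u
  rw [hu] at this
  exact this.comp X h

lemma continuousAt_matrix_inv {T : Type*} [TopologicalSpace T] {a : T → Mat n} {X : T}
    (h : ContinuousAt a X) (hX : IsUnit (a X)) : ContinuousAt (fun Y => (a Y)⁻¹) X := by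
  simp_rw [Matrix.nonsing_inv_eq_ringInverse]
  obtain ⟨u, hu⟩ := hX
  have := NormedRing.inverse_continuousAt u
  rw [hu] at this
  exact ContinuousAt.comp (f := a) this h

end MatrixNorms

/-! ### Singular value bounds and the resolvent of a Hermitian matrix on the imaginary axis. -/

section Coercive

variable {n : ℕ}

/-- The smallest singular value of `A` is at least `c`. -/
def Coercive (c : ℝ) (A : Mat n) : Prop :=
  ∀ v : EuclideanSpace ℂ (Fin n), c * ‖v‖ ≤ ‖Matrix.toEuclideanLin A v‖

lemma Coercive.mono {c c' : ℝ} {A : Mat n} (h : Coercive c A) (hc : c' ≤ c) : Coercive c' A :=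
  fun v => (mul_le_mul_of_nonneg_right hc (norm_nonneg _)).trans (h v)

lemma toEuclideanLin_mul (A B : Mat n) (v : EuclideanSpace ℂ (Fin n)) :
    Matrix.toEuclideanLin (A * B) v = Matrix.toEuclideanLin A (Matrix.toEuclideanLin B v) := by
  simp [Matrix.toEuclideanLin, Matrix.toLpLin_apply, Matrix.mulVec_mulVec]

lemma toEuclideanLin_one (v : EuclideanSpace ℂ (Fin n)) :
    Matrix.toEuclideanLin (1 : Mat n) v = v := by
  simp [Matrix.toEuclideanLin]

lemma norm_toEuclideanLin_le (A : Mat n) (v : EuclideanSpace ℂ (Fin n)) :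
    ‖Matrix.toEuclideanLin A v‖ ≤ ‖A‖ * ‖v‖ := by
  simpa [Matrix.toEuclideanLin, Matrix.toLpLin_apply] using Matrix.l2_opNorm_mulVec A v

lemma Coercive.isUnit {c : ℝ} {A : Mat n} (h : Coercive c A) (hc : 0 < c) : IsUnit A := by
  rw [← Matrix.mulVec_injective_iff_isUnit]
  refine (injective_iff_map_eq_zero (Matrix.mulVecLin A)).mpr fun v hv => ?_
  have h1 := h (WithLp.toLp 2 v)
  have h2 : Matrix.toEuclideanLin A (WithLp.toLp 2 v) = 0 := by
    simp only [Matrix.toEuclideanLin, Matrix.toLpLin_apply]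
    simpa using hv
  rw [h2, norm_zero] at h1
  have h3 : ‖WithLp.toLp 2 v‖ ≤ 0 := by
    by_contra! h4
    nlinarith
  simpa using norm_le_zero_iff.mp h3

lemma Coercive.norm_inv_le {c : ℝ} {A : Mat n} (h : Coercive c A) (hc : 0 < c) :
    ‖A⁻¹‖ ≤ c⁻¹ := by
  rw [Matrix.cstar_norm_def]
  refine ContinuousLinearMap.opNorm_le_bound _ (by positivity) fun v => ?_
  have h1 := h (Matrix.toEuclideanLin A⁻¹ v)
  rw [← toEuclideanLin_mul, Matrix.mul_nonsing_inv _ ((Matrix.isUnit_iff_isUnit_det _).mp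
    (h.isUnit hc)), toEuclideanLin_one] at h1
  rw [inv_mul_eq_div, le_div_iff₀' hc]
  exact h1

lemma exists_coercive_of_isUnit {A : Mat n} (h : IsUnit A) : ∃ c > 0, Coercive c A := by
  refine ⟨(‖A⁻¹‖ + 1)⁻¹, by positivity, fun v => ?_⟩
  have h1 := norm_toEuclideanLin_le A⁻¹ (Matrix.toEuclideanLin A v)
  rw [← toEuclideanLin_mul, Matrix.nonsing_inv_mul _ ((Matrix.isUnit_iff_isUnit_det _).mp h),
    toEuclideanLin_one] at h1
  rw [inv_mul_le_iff₀ (by positivity)]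
  nlinarith [norm_nonneg (Matrix.toEuclideanLin A v)]

lemma Coercive.of_tendsto {ι : Type*} {l : Filter ι} [l.NeBot] {c : ℝ} {A : ι → Mat n} {B : Mat n}
    (h : ∀ᶠ i in l, Coercive c (A i)) (hA : Tendsto A l (𝓝 B)) : Coercive c B := by
  intro v
  have hcont : Continuous fun M : Mat n => Matrix.toEuclideanLin M v := by
    have := LinearMap.continuous_of_finiteDimensional
      ((LinearMap.applyₗ v).comp (Matrix.toEuclideanLin (𝕜 := ℂ) (m := Fin n) (n := Fin n)).toLinearMap)
    exact this
  exact ge_of_tendsto ((hcont.norm.tendsto B).comp hA) (h.mono fun i hi => hi v)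

lemma Coercive.smul {c : ℝ} {A : Mat n} (h : Coercive c A) {t : ℝ} (ht : 0 ≤ t) :
    Coercive (t * c) ((t : ℂ) • A) := by
  intro v
  rw [map_smul, LinearMap.smul_apply, norm_smul, Complex.norm_real, Real.norm_of_nonneg ht, mul_assoc]
  exact mul_le_mul_of_nonneg_left (h v) ht

/-- `A - ix`. -/
noncomputable def shift (A : Mat n) (x : ℝ) : Mat n := A - (Complex.I * (x : ℂ)) • (1 : Mat n)

/-- Since `⟨Av, v⟩` is real, the vectors `Av` and `ixv` are orthogonal for the real inner product,
and Pythagoras gives `‖(A - ix)v‖² = ‖Av‖² + x²‖v‖²`. With `c = 0`, where the hypothesis is void,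
this still gives invertibility for `x ≠ 0`. -/
lemma Coercive.shift {c : ℝ} {A : Mat n} (h : Coercive c A) (hA : A.IsHermitian) (hc : 0 ≤ c)
    (x : ℝ) : Coercive (Real.sqrt (c ^ 2 + x ^ 2)) (shift A x) := by
  intro v
  have hs := Matrix.isSymmetric_toEuclideanLin_iff.mpr hA
  have h1 : Matrix.toEuclideanLin (BulkDifference.shift A x) v =
      Matrix.toEuclideanLin A v - (Complex.I * (x : ℂ)) • v := by
    rw [BulkDifference.shift, map_sub, LinearMap.sub_apply, map_smul, LinearMap.smul_apply,
      toEuclideanLin_one]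
  have h2 : ‖Matrix.toEuclideanLin (BulkDifference.shift A x) v‖ ^ 2 =
      ‖Matrix.toEuclideanLin A v‖ ^ 2 + x ^ 2 * ‖v‖ ^ 2 := by
    rw [h1, @norm_sub_sq ℂ, inner_smul_right, norm_smul]
    have h3 := hs.im_inner_apply_self v
    have h4 : (RCLike.re (Complex.I * (x : ℂ) * inner ℂ (Matrix.toEuclideanLin A v) v) : ℝ) = 0 := by
      have h3' : (inner ℂ (Matrix.toEuclideanLin A v) v).im = 0 := h3
      simp [h3']
    rw [h4]
    simp [mul_pow]
  refine le_of_sq_le_sq ?_ (norm_nonneg _)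
  rw [h2, mul_pow, Real.sq_sqrt (by positivity)]
  have := h v
  nlinarith [pow_le_pow_left₀ (by positivity) this 2, norm_nonneg v]
where
  le_of_sq_le_sq {a b : ℝ} (h : a ^ 2 ≤ b ^ 2) (hb : 0 ≤ b) : a ≤ b := abs_le_of_sq_le_sq' h hb |>.2

lemma isUnit_shift {c : ℝ} {A : Mat n} (h : Coercive c A) (hA : A.IsHermitian) (hc : 0 < c)
    (x : ℝ) : IsUnit (shift A x) :=
  (h.shift hA hc.le x).isUnit (Real.sqrt_pos.mpr (by positivity))

lemma isUnit_shift_of_ne_zero {A : Mat n} (hA : A.IsHermitian) {x : ℝ} (hx : x ≠ 0) :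
    IsUnit (shift A x) := by
  have h : Coercive 0 A := fun v => by simp
  exact (h.shift hA le_rfl x).isUnit (Real.sqrt_pos.mpr (by positivity))

lemma norm_inv_shift_le {c : ℝ} {A : Mat n} (h : Coercive c A) (hA : A.IsHermitian) (hc : 0 < c)
    (x : ℝ) : ‖(shift A x)⁻¹‖ ≤ (Real.sqrt (c ^ 2 + x ^ 2))⁻¹ :=
  (h.shift hA hc.le x).norm_inv_le (Real.sqrt_pos.mpr (by positivity))

lemma norm_inv_shift_le_of_ne_zero {A : Mat n} (hA : A.IsHermitian) {x : ℝ} (hx : x ≠ 0) :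
    ‖(shift A x)⁻¹‖ ≤ |x|⁻¹ := by
  have h : Coercive 0 A := fun v => by simp
  have := (h.shift hA le_rfl x).norm_inv_le (Real.sqrt_pos.mpr (by positivity))
  simpa [Real.sqrt_sq_eq_abs] using this

/-- Parseval in the eigenbasis, since the singular values of a Hermitian matrix are the moduli of
its eigenvalues. -/
lemma coercive_iff_eigenvalues {A : Mat n} (hA : A.IsHermitian) {c : ℝ} (hc : 0 ≤ c) :
    Coercive c A ↔ ∀ j, c ≤ |hA.eigenvalues j| := by
  have key : ∀ j, Matrix.toEuclideanLin A (hA.eigenvectorBasis j) =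
      (hA.eigenvalues j : ℂ) • hA.eigenvectorBasis j := fun j => by
    have := hA.mulVec_eigenvectorBasis j
    simp only [Matrix.toEuclideanLin, Matrix.toLpLin_apply]
    rw [this]; rfl
  constructor
  · intro h j
    have := h (hA.eigenvectorBasis j)
    rw [key, norm_smul, hA.eigenvectorBasis.norm_eq_one] at this
    simpa using this
  · intro h v
    have hs := Matrix.isSymmetric_toEuclideanLin_iff.mpr hA
    refine abs_le_of_sq_le_sq' ?_ (norm_nonneg _) |>.2
    rw [mul_pow, ← hA.eigenvectorBasis.sum_sq_norm_inner_right v,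
      ← hA.eigenvectorBasis.sum_sq_norm_inner_right (Matrix.toEuclideanLin A v), Finset.mul_sum]
    refine Finset.sum_le_sum fun j _ => ?_
    rw [← hs, key, inner_smul_left, norm_mul, mul_pow]
    refine mul_le_mul_of_nonneg_right ?_ (by positivity)
    simpa using pow_le_pow_left₀ hc (h j) 2

/-- An eigenvalue of modulus below `min (-E₁) E₂` would lie in `[E₁, E₂]`, where `E - A` is
invertible. The bound is the same for all momenta, which makes the bulk gap uniform. -/
lemma coercive_of_gap {A : Mat n} (hA : A.IsHermitian) {E₁ E₂ : ℝ} (h0 : (0 : ℝ) ∈ Set.Ioo E₁ E₂)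
    (h : ∀ E ∈ Set.Icc E₁ E₂, IsUnit ((E : ℂ) • (1 : Mat n) - A)) :
    Coercive (min (-E₁) E₂) A := by
  rw [coercive_iff_eigenvalues hA (le_min (by linarith [h0.1]) h0.2.le)]
  intro j
  by_contra! hj
  have hmem : hA.eigenvalues j ∈ Set.Icc E₁ E₂ := by
    have h1 := (abs_lt.mp (hj.trans_le (min_le_left _ _))).1
    have h2 := (abs_lt.mp (hj.trans_le (min_le_right _ _))).2
    exact ⟨by linarith, h2.le⟩
  have h1 := h _ hmem
  have h2 := hA.eigenvalues_mem_spectrum_real j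
  rw [spectrum.mem_iff] at h2
  apply h2
  convert h1 using 2
  simp [Algebra.algebraMap_eq_smul_one, ← Complex.coe_smul]

end Coercive

/-! ### Integrals of products of scalar resolvents along the imaginary axis. -/

section ScalarIntegral

lemma sub_I_mul_ne_zero {a : ℝ} (ha : a ≠ 0) (x : ℝ) : (a : ℂ) - Complex.I * x ≠ 0 := by
  intro h
  have := congrArg Complex.re h
  simp at this
  exact ha this

lemma normSq_sub_I_mul (a x : ℝ) : ‖(a : ℂ) - Complex.I * x‖ ^ 2 = a ^ 2 + x ^ 2 := by
  rw [Complex.sq_norm, Complex.normSq_apply]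
  simp
  ring

lemma integrable_inv_sq_add_sq {c : ℝ} (hc : c ≠ 0) :
    Integrable fun x : ℝ => (c ^ 2 + x ^ 2)⁻¹ := by
  have h := (integrable_inv_one_add_sq.comp_div hc).const_mul ((c ^ 2)⁻¹)
  refine h.congr (Eventually.of_forall fun x => ?_)
  have : c ^ 2 + x ^ 2 ≠ 0 := by positivity
  have : 1 + (x / c) ^ 2 ≠ 0 := by positivity
  simp only
  rw [← mul_inv]
  congr 1
  field_simp

lemma norm_resolvent_product_le (a : ℝ) {b : ℝ} (hb : b ≠ 0) (x : ℝ) :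
    ‖(((a : ℂ) - Complex.I * x) ^ 2)⁻¹ * ((b : ℂ) - Complex.I * x)⁻¹‖ ≤
      |b|⁻¹ * (a ^ 2 + x ^ 2)⁻¹ := by
  rw [norm_mul, norm_inv, norm_inv, norm_pow, normSq_sub_I_mul, mul_comm]
  refine mul_le_mul_of_nonneg_right ?_ (by positivity)
  refine inv_anti₀ (abs_pos.mpr hb) ?_
  have := Complex.abs_re_le_norm ((b : ℂ) - Complex.I * x)
  simpa using this

lemma integrable_resolvent_product {a b : ℝ} (ha : a ≠ 0) (hb : b ≠ 0) :
    Integrable fun x : ℝ =>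
      (((a : ℂ) - Complex.I * x) ^ 2)⁻¹ * ((b : ℂ) - Complex.I * x)⁻¹ := by
  refine ((integrable_inv_sq_add_sq ha).const_mul |b|⁻¹).mono' ?_
    (Eventually.of_forall fun x => norm_resolvent_product_le a hb x)
  refine Continuous.aestronglyMeasurable ?_
  refine Continuous.mul (Continuous.inv₀ (by fun_prop) fun x => pow_ne_zero _ (sub_I_mul_ne_zero ha x))
    (Continuous.inv₀ (by fun_prop) fun x => sub_I_mul_ne_zero hb x)

lemma hasDerivAt_sub_I_mul (a x : ℝ) :
    HasDerivAt (fun x : ℝ => (a : ℂ) - Complex.I * x) (-Complex.I) x := by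
  have h := ((hasDerivAt_id x).ofReal_comp.const_mul Complex.I).const_sub (a : ℂ)
  simpa using h

lemma tendsto_inv_sub_I_mul (a : ℝ) {l : Filter ℝ} (hl : Tendsto (fun x : ℝ => |x|) l atTop) :
    Tendsto (fun x : ℝ => ((a : ℂ) - Complex.I * x)⁻¹) l (𝓝 0) := by
  rw [tendsto_zero_iff_norm_tendsto_zero]
  refine squeeze_zero' (Eventually.of_forall fun x => norm_nonneg _) ?_
    (tendsto_inv_atTop_zero.comp hl)
  filter_upwards [hl.eventually_gt_atTop 0] with x hx
  rw [norm_inv]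
  refine inv_anti₀ hx ?_
  have := Complex.abs_im_le_norm ((a : ℂ) - Complex.I * x)
  simpa using this

/-- Each logarithm diverges, but only their difference occurs in the primitive of
`integral_resolvent_product`. -/
lemma tendsto_log_ratio (a b : ℝ) {l : Filter ℝ} (hl : Tendsto (fun x : ℝ => |x|) l atTop)
    (ha : a ≠ 0) (hb : b ≠ 0) :
    Tendsto (fun x : ℝ => Real.log (a ^ 2 + x ^ 2) - Real.log (b ^ 2 + x ^ 2)) l (𝓝 0) := by
  have h1 : Tendsto (fun x : ℝ => (b ^ 2 + x ^ 2)⁻¹) l (𝓝 0) := by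
    refine tendsto_inv_atTop_zero.comp (tendsto_atTop_add_const_left _ _ ?_)
    have := (tendsto_pow_atTop (α := ℝ) (n := 2) two_ne_zero).comp hl
    simpa [Function.comp_def] using this
  have h2 : Tendsto (fun x : ℝ => 1 + (a ^ 2 - b ^ 2) * (b ^ 2 + x ^ 2)⁻¹) l (𝓝 1) := by
    simpa using (h1.const_mul (a ^ 2 - b ^ 2)).const_add 1
  have h3 := (Real.continuousAt_log one_ne_zero).tendsto.comp h2
  rw [Real.log_one] at h3
  refine h3.congr fun x => ?_
  have hA : a ^ 2 + x ^ 2 ≠ 0 := by positivity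
  have hB : b ^ 2 + x ^ 2 ≠ 0 := by positivity
  rw [← Real.log_div hA hB]
  simp only [Function.comp]
  congr 1
  field_simp
  ring

lemma tendsto_arctan_div_atTop {a : ℝ} (ha : a ≠ 0) :
    Tendsto (fun x : ℝ => Real.arctan (x / a)) atTop (𝓝 (Real.pi / 2 * Real.sign a)) := by
  rcases ha.lt_or_gt with h | h
  · rw [Real.sign_of_neg h, mul_neg_one]
    exact (Real.tendsto_arctan_atBot.mono_right nhdsWithin_le_nhds).comp
      (tendsto_id.atTop_div_const_of_neg h)
  · rw [Real.sign_of_pos h, mul_one]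
    exact (Real.tendsto_arctan_atTop.mono_right nhdsWithin_le_nhds).comp
      (tendsto_id.atTop_div_const h)

lemma tendsto_arctan_div_atBot {a : ℝ} (ha : a ≠ 0) :
    Tendsto (fun x : ℝ => Real.arctan (x / a)) atBot (𝓝 (-(Real.pi / 2 * Real.sign a))) := by
  have := ((tendsto_arctan_div_atTop ha).comp tendsto_neg_atBot_atTop).neg
  refine this.congr fun x => ?_
  simp [neg_div, Real.arctan_neg]

/-- This is `i log (a - ix)` up to a constant, written with `arctan` and the real logarithm so that
no branch of the argument has to be chosen for `a < 0`. -/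
lemma hasDerivAt_resolvent_primitive {a : ℝ} (ha : a ≠ 0) (x : ℝ) :
    HasDerivAt (fun x : ℝ => ((Real.arctan (x / a) : ℝ) : ℂ) +
      Complex.I / 2 * ((Real.log (a ^ 2 + x ^ 2) : ℝ) : ℂ)) ((a : ℂ) - Complex.I * x)⁻¹ x := by
  have hA : a ^ 2 + x ^ 2 ≠ 0 := by positivity
  have h1 : HasDerivAt (fun x : ℝ => Real.arctan (x / a)) (1 / (1 + (x / a) ^ 2) * (1 / a)) x :=
    ((hasDerivAt_id x).div_const a).arctan
  have h2 : HasDerivAt (fun x : ℝ => Real.log (a ^ 2 + x ^ 2)) (2 * x / (a ^ 2 + x ^ 2)) x := by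
    have := (((hasDerivAt_id x).pow 2).const_add (a ^ 2)).log hA
    simpa using this
  refine (h1.ofReal_comp.add ((h2.ofReal_comp).const_mul (Complex.I / 2))).congr_deriv ?_
  have h3 : ((a : ℂ) - Complex.I * x) ≠ 0 := sub_I_mul_ne_zero ha x
  have h5 : 1 / (1 + (x / a) ^ 2) * (1 / a) = a / (a ^ 2 + x ^ 2) := by
    have h4 : (1 + (x / a) ^ 2) ≠ 0 := by positivity
    field_simp
  have hA' : ((a : ℂ) ^ 2 + (x : ℂ) ^ 2) ≠ 0 := by exact_mod_cast hA
  rw [h5, eq_comm, inv_eq_of_mul_eq_one_right]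
  push_cast
  field_simp
  linear_combination (-(x : ℂ) ^ 2) * Complex.I_sq

/-- Partial fractions: the simple-pole parts contribute differences of logarithms, whose real
logarithms cancel at infinity and whose arctangents leave the signs of `a` and `b`. For `a = b` the
primitive is half a squared resolvent, which decays at both ends, and the right-hand side is 0
because division by zero gives 0. -/
lemma integral_resolvent_product {a b : ℝ} (ha : a ≠ 0) (hb : b ≠ 0) :
    ∫ x : ℝ, (((a : ℂ) - Complex.I * x) ^ 2)⁻¹ * ((b : ℂ) - Complex.I * x)⁻¹ =
      -(Real.pi * (Real.sign a - Real.sign b)) / ((b : ℂ) - a) ^ 2 := by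
  have hT := tendsto_abs_atTop_atTop (G := ℝ)
  have hB := tendsto_abs_atBot_atTop (G := ℝ)
  rcases eq_or_ne a b with rfl | hab
  · have hd : ∀ x : ℝ, HasDerivAt (fun x : ℝ => (2 * Complex.I)⁻¹ *
        (((a : ℂ) - Complex.I * x)⁻¹) ^ 2)
        ((((a : ℂ) - Complex.I * x) ^ 2)⁻¹ * ((a : ℂ) - Complex.I * x)⁻¹) x := fun x => by
      have h3 := sub_I_mul_ne_zero ha x
      refine ((((hasDerivAt_sub_I_mul a x).fun_inv h3).pow 2).const_mul
        ((2 * Complex.I)⁻¹)).congr_deriv ?_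
      field_simp
      simp [mul_assoc, mul_inv_cancel₀ h3]
    have hlim : ∀ l : Filter ℝ, Tendsto (fun x : ℝ => |x|) l atTop →
        Tendsto (fun x : ℝ => (2 * Complex.I)⁻¹ * (((a : ℂ) - Complex.I * x)⁻¹) ^ 2) l (𝓝 0) :=
      fun l hl => by simpa using ((tendsto_inv_sub_I_mul a hl).pow 2).const_mul ((2 * Complex.I)⁻¹)
    rw [integral_of_hasDerivAt_of_tendsto hd (integrable_resolvent_product ha ha) (hlim _ hB)
      (hlim _ hT)]
    simp
  · have hm : (b : ℂ) - a ≠ 0 := by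
      rw [sub_ne_zero]; exact_mod_cast hab.symm
    have hd : ∀ x : ℝ, HasDerivAt (fun x : ℝ =>
        (Complex.I * (b - a))⁻¹ * ((a : ℂ) - Complex.I * x)⁻¹ - (((b : ℂ) - a) ^ 2)⁻¹ *
          ((((Real.arctan (x / a) : ℝ) : ℂ) + Complex.I / 2 * ((Real.log (a ^ 2 + x ^ 2) : ℝ) : ℂ)) -
          (((Real.arctan (x / b) : ℝ) : ℂ) + Complex.I / 2 * ((Real.log (b ^ 2 + x ^ 2) : ℝ) : ℂ))))
        ((((a : ℂ) - Complex.I * x) ^ 2)⁻¹ * ((b : ℂ) - Complex.I * x)⁻¹) x := fun x => by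
      have h3 := sub_I_mul_ne_zero ha x
      have h4 := sub_I_mul_ne_zero hb x
      refine ((((hasDerivAt_sub_I_mul a x).fun_inv h3).const_mul
        ((Complex.I * ((b : ℂ) - a))⁻¹)).sub (((hasDerivAt_resolvent_primitive ha x).sub
          (hasDerivAt_resolvent_primitive hb x)).const_mul ((((b : ℂ) - a) ^ 2)⁻¹))).congr_deriv ?_
      field_simp
      ring_nf
    have hlim : ∀ (l : Filter ℝ) (s t : ℝ), Tendsto (fun x : ℝ => |x|) l atTop →
        Tendsto (fun x : ℝ => Real.arctan (x / a)) l (𝓝 s) →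
        Tendsto (fun x : ℝ => Real.arctan (x / b)) l (𝓝 t) →
        Tendsto (fun x : ℝ => (Complex.I * (b - a))⁻¹ * ((a : ℂ) - Complex.I * x)⁻¹ -
          (((b : ℂ) - a) ^ 2)⁻¹ *
          ((((Real.arctan (x / a) : ℝ) : ℂ) + Complex.I / 2 * ((Real.log (a ^ 2 + x ^ 2) : ℝ) : ℂ)) -
          (((Real.arctan (x / b) : ℝ) : ℂ) + Complex.I / 2 * ((Real.log (b ^ 2 + x ^ 2) : ℝ) : ℂ))))
          l (𝓝 (-((((b : ℂ) - a) ^ 2)⁻¹ * ((s : ℂ) - t)))) := fun l s t hl hs ht => by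
      have h1 := (tendsto_inv_sub_I_mul a hl).const_mul ((Complex.I * ((b : ℂ) - a))⁻¹)
      have h2 := (Complex.continuous_ofReal.tendsto _).comp (tendsto_log_ratio a b hl ha hb)
      have h3 := (Complex.continuous_ofReal.tendsto _).comp hs
      have h4 := (Complex.continuous_ofReal.tendsto _).comp ht
      have h5 := h1.sub (((h3.sub h4).add (h2.const_mul (Complex.I / 2))).const_mul
        ((((b : ℂ) - a) ^ 2)⁻¹))
      simp only [mul_zero, zero_sub, Complex.ofReal_zero, add_zero] at h5
      refine h5.congr fun x => ?_
      simp only [Function.comp]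
      push_cast
      ring
    rw [integral_of_hasDerivAt_of_tendsto hd (integrable_resolvent_product ha hb)
      (hlim _ _ _ hB (tendsto_arctan_div_atBot ha) (tendsto_arctan_div_atBot hb))
      (hlim _ _ _ hT (tendsto_arctan_div_atTop ha) (tendsto_arctan_div_atTop hb))]
    field_simp
    push_cast
    ring

end ScalarIntegral

/-! ### The resolvent trace form: bounds, continuity, homogeneity. -/

section ResolventForm

variable {n : ℕ}

/-- `tr (R² B R C - R² C R B)` with `R = (A - ix)⁻¹`. -/
noncomputable def wForm (A B C : Mat n) (x : ℝ) : ℂ :=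
  ((shift A x)⁻¹ * (shift A x)⁻¹ * B * (shift A x)⁻¹ * C).trace -
    ((shift A x)⁻¹ * (shift A x)⁻¹ * C * (shift A x)⁻¹ * B).trace

/-- The integral of `wForm` over the real line. -/
noncomputable def qForm (A B C : Mat n) : ℂ := ∫ x : ℝ, wForm A B C x

lemma norm_trace_five_le (R B C : Mat n) :
    ‖(R * R * B * R * C).trace‖ ≤ n * (‖R‖ ^ 3 * ‖B‖ * ‖C‖) := by
  refine (norm_trace_le _).trans (mul_le_mul_of_nonneg_left ?_ (Nat.cast_nonneg _))
  calc ‖R * R * B * R * C‖ ≤ ‖R * R * B * R‖ * ‖C‖ := norm_mul_le _ _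
    _ ≤ (‖R * R * B‖ * ‖R‖) * ‖C‖ := by gcongr; exact norm_mul_le _ _
    _ ≤ ((‖R * R‖ * ‖B‖) * ‖R‖) * ‖C‖ := by gcongr; exact norm_mul_le _ _
    _ ≤ (((‖R‖ * ‖R‖) * ‖B‖) * ‖R‖) * ‖C‖ := by gcongr; exact norm_mul_le _ _
    _ = ‖R‖ ^ 3 * ‖B‖ * ‖C‖ := by ring

lemma norm_wForm_le (A B C : Mat n) (x : ℝ) :
    ‖wForm A B C x‖ ≤ 2 * n * (‖(shift A x)⁻¹‖ ^ 3 * ‖B‖ * ‖C‖) := by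
  refine (norm_sub_le _ _).trans ?_
  have h1 := norm_trace_five_le (shift A x)⁻¹ B C
  have h2 := norm_trace_five_le (shift A x)⁻¹ C B
  nlinarith

/-- One of the three resolvent factors is traded for the constant `c⁻¹`, so that what remains
integrates to an arctangent. -/
lemma inv_sqrt_cube_le {c : ℝ} (hc : 0 < c) (x : ℝ) :
    (Real.sqrt (c ^ 2 + x ^ 2))⁻¹ ^ 3 ≤ c⁻¹ * (c ^ 2 + x ^ 2)⁻¹ := by
  have h1 : c ≤ Real.sqrt (c ^ 2 + x ^ 2) := Real.le_sqrt_of_sq_le (by nlinarith [sq_nonneg x])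
  have h2 : Real.sqrt (c ^ 2 + x ^ 2) ^ 2 = c ^ 2 + x ^ 2 := Real.sq_sqrt (by positivity)
  rw [pow_succ', inv_pow, h2]
  exact mul_le_mul_of_nonneg_right (inv_anti₀ hc h1) (by positivity)

lemma norm_wForm_le_of_coercive {c : ℝ} {A : Mat n} (h : Coercive c A) (hA : A.IsHermitian)
    (hc : 0 < c) (B C : Mat n) (x : ℝ) :
    ‖wForm A B C x‖ ≤ 2 * n * ‖B‖ * ‖C‖ * (c⁻¹ * (c ^ 2 + x ^ 2)⁻¹) := by
  refine (norm_wForm_le A B C x).trans ?_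
  have h1 : ‖(shift A x)⁻¹‖ ^ 3 ≤ c⁻¹ * (c ^ 2 + x ^ 2)⁻¹ :=
    (pow_le_pow_left₀ (norm_nonneg _) (norm_inv_shift_le h hA hc x) 3).trans (inv_sqrt_cube_le hc x)
  calc _ ≤ 2 * n * ((c⁻¹ * (c ^ 2 + x ^ 2)⁻¹) * ‖B‖ * ‖C‖) := by gcongr
    _ = _ := by ring

lemma integral_inv_sq_add_sq {c : ℝ} (hc : 0 < c) :
    ∫ x : ℝ, c⁻¹ * (c ^ 2 + x ^ 2)⁻¹ = Real.pi * (c ^ 2)⁻¹ := by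
  have h : ∀ x : ℝ, c⁻¹ * (c ^ 2 + x ^ 2)⁻¹ = (c ^ 3)⁻¹ * (1 + (x / c) ^ 2)⁻¹ := fun x => by
    have : c ^ 2 + x ^ 2 ≠ 0 := by positivity
    have : 1 + (x / c) ^ 2 ≠ 0 := by positivity
    rw [← mul_inv, ← mul_inv]
    congr 1
    field_simp
  simp_rw [h]
  rw [integral_const_mul, Measure.integral_comp_div (fun x : ℝ => (1 + x ^ 2)⁻¹) c,
    integral_univ_inv_one_add_sq, abs_of_pos hc, smul_eq_mul]
  field_simp

lemma norm_qForm_le {c : ℝ} {A : Mat n} (h : Coercive c A) (hA : A.IsHermitian)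
    (hc : 0 < c) (B C : Mat n) :
    ‖qForm A B C‖ ≤ 2 * n * ‖B‖ * ‖C‖ * (Real.pi * (c ^ 2)⁻¹) := by
  rw [← integral_inv_sq_add_sq hc, ← integral_const_mul]
  refine norm_integral_le_of_norm_le
    (((integrable_inv_sq_add_sq hc.ne').const_mul _).const_mul _)
    (Eventually.of_forall fun x => norm_wForm_le_of_coercive h hA hc B C x)

lemma continuous_shift : Continuous fun p : Mat n × ℝ => shift p.1 p.2 := by
  unfold shift
  exact continuous_fst.sub ((continuous_const.mul (Complex.continuous_ofReal.comp
    continuous_snd)).smul continuous_const)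

lemma tendsto_wForm {ι : Type*} {l : Filter ι} {A B C : ι → Mat n} {x : ι → ℝ} {A₀ B₀ C₀ : Mat n}
    {x₀ : ℝ} (hA : Tendsto A l (𝓝 A₀)) (hB : Tendsto B l (𝓝 B₀)) (hC : Tendsto C l (𝓝 C₀))
    (hx : Tendsto x l (𝓝 x₀)) (h : IsUnit (shift A₀ x₀)) :
    Tendsto (fun i => wForm (A i) (B i) (C i) (x i)) l (𝓝 (wForm A₀ B₀ C₀ x₀)) := by
  have h1 : Tendsto (fun i => (shift (A i) (x i))⁻¹) l (𝓝 (shift A₀ x₀)⁻¹) :=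
    ContinuousAt.tendsto (f := fun M : Mat n => M⁻¹) (continuousAt_matrix_inv continuousAt_id h)
      |>.comp ((continuous_shift.tendsto (A₀, x₀)).comp (hA.prodMk_nhds hx))
  have ht : ∀ {F : ι → Mat n} {M : Mat n}, Tendsto F l (𝓝 M) →
      Tendsto (fun i => (F i).trace) l (𝓝 M.trace) := fun {F M} hF =>
    ((traceCLM (n := n)).continuous.tendsto M).comp hF
  have h2 := ((((h1.mul h1).mul hB).mul h1).mul hC)
  have h3 := ((((h1.mul h1).mul hC).mul h1).mul hB)
  exact (ht h2).sub (ht h3)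

lemma matrix_inv_smul {t : ℂ} (ht : t ≠ 0) (M : Mat n) : (t • M)⁻¹ = t⁻¹ • M⁻¹ := by
  by_cases hM : IsUnit M.det
  · have := Matrix.inv_smul' (k := Units.mk0 t ht) M hM
    simpa [Units.smul_def] using this
  · rw [Matrix.nonsing_inv_apply_not_isUnit _ hM, smul_zero, Matrix.nonsing_inv_apply_not_isUnit]
    rw [Matrix.det_smul]
    intro h
    exact hM (isUnit_of_mul_isUnit_right h)

lemma shift_smul (t : ℝ) (A : Mat n) (x : ℝ) :
    shift ((t : ℂ) • A) (t * x) = (t : ℂ) • shift A x := by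
  simp only [shift, smul_sub, smul_smul]
  push_cast
  congr 2
  ring

/-- The three resolvents contribute `t⁻³`, `B` contributes `t` and `C` contributes `s`. It serves
with `t = ρᵈ` to rescale large momenta and with `t = -1` for parity. -/
lemma wForm_smul {t : ℝ} (ht : t ≠ 0) (A B C : Mat n) (s x : ℝ) :
    wForm ((t : ℂ) • A) ((t : ℂ) • B) ((s : ℂ) • C) (t * x) =
      ((t : ℂ) ^ 2)⁻¹ * s * wForm A B C x := by
  have ht' : (t : ℂ) ≠ 0 := by exact_mod_cast ht
  simp only [wForm, shift_smul, matrix_inv_smul ht', Matrix.smul_mul, Matrix.mul_smul, smul_smul,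
    Matrix.trace_smul, smul_eq_mul]
  field_simp

lemma wForm_neg (A B C : Mat n) (x : ℝ) : wForm (-A) (-B) C (-x) = wForm A B C x := by
  have := wForm_smul (t := -1) (by norm_num) A B C 1 x
  simpa using this

lemma wForm_swap (A B C : Mat n) (x : ℝ) : wForm A C B x = -wForm A B C x := by
  simp [wForm]

end ResolventForm

/-! ### Evaluation of the resolvent integral in an eigenbasis. -/

section Diagonalization

variable {n : ℕ}

/-- The eigenvalue indicator of the negative half line. -/
noncomputable def negInd (t : ℝ) : ℝ := if t < 0 then 1 else 0

lemma negInd_mul_self (t : ℝ) : negInd t * negInd t = negInd t := by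
  unfold negInd; split_ifs <;> simp

lemma exists_diagonalization {A : Mat n} (hA : A.IsHermitian) :
    ∃ (U V : Mat n), U * V = 1 ∧ V * U = 1 ∧ V = star U ∧
      A = U * Matrix.diagonal (fun j => (hA.eigenvalues j : ℂ)) * V ∧
      negProj A = U * Matrix.diagonal (fun j => (negInd (hA.eigenvalues j) : ℂ)) * V := by
  refine ⟨hA.eigenvectorUnitary, star (hA.eigenvectorUnitary : Mat n), ?_, ?_, rfl, ?_, ?_⟩
  · exact Unitary.mul_star_self_of_mem hA.eigenvectorUnitary.2
  · exact Unitary.star_mul_self_of_mem hA.eigenvectorUnitary.2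
  · exact hA.spectral_theorem
  · rw [negProj, hA.cfc_eq]
    rfl

lemma conj_mul {U V : Mat n} (h : U * V = 1) (M N : Mat n) :
    V * (M * N) * U = V * M * U * (V * N * U) := by
  have : M * N = M * (U * V) * N := by rw [h, mul_one]
  rw [this]; noncomm_ring

lemma trace_conj {U V : Mat n} (h : U * V = 1) (M : Mat n) : (V * M * U).trace = M.trace := by
  rw [Matrix.trace_mul_comm, ← mul_assoc, h, one_mul]

lemma conj_cancel {U V : Mat n} (h : V * U = 1) (D : Mat n) : V * (U * D * V) * U = D := by
  calc V * (U * D * V) * U = (V * U) * D * (V * U) := by noncomm_ring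
    _ = D := by rw [h, one_mul, mul_one]

lemma conj_inv {U V : Mat n} (h : U * V = 1) (h' : V * U = 1) (M : Mat n) :
    V * M⁻¹ * U = (V * M * U)⁻¹ := by
  have hU : U⁻¹ = V := Matrix.inv_eq_right_inv h
  have hV : V⁻¹ = U := Matrix.inv_eq_right_inv h'
  rw [Matrix.mul_inv_rev, Matrix.mul_inv_rev, hU, hV, mul_assoc]

lemma wForm_conj {U V : Mat n} (h : U * V = 1) (h' : V * U = 1) (A B C : Mat n) (x : ℝ) :
    wForm A B C x = wForm (V * A * U) (V * B * U) (V * C * U) x := by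
  have hs : shift (V * A * U) x = V * shift A x * U := by
    simp only [shift, mul_sub, sub_mul, Matrix.mul_smul, Matrix.smul_mul, mul_one, h']
  simp only [wForm]
  rw [hs, ← conj_inv h h', ← trace_conj h, ← trace_conj h (_ * B)]
  simp only [conj_mul h]

lemma shift_diagonal (l : Fin n → ℝ) (x : ℝ) :
    shift (Matrix.diagonal fun j => (l j : ℂ)) x =
      Matrix.diagonal fun j => (l j : ℂ) - Complex.I * x := by
  rw [shift, ← Matrix.diagonal_one, ← Matrix.diagonal_smul, Matrix.diagonal_sub]
  simp

lemma inv_shift_diagonal {l : Fin n → ℝ} {x : ℝ} (h : ∀ j, (l j : ℂ) - Complex.I * x ≠ 0) :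
    (shift (Matrix.diagonal fun j => (l j : ℂ)) x)⁻¹ =
      Matrix.diagonal fun j => ((l j : ℂ) - Complex.I * x)⁻¹ := by
  rw [shift_diagonal]
  refine Matrix.inv_eq_right_inv ?_
  rw [Matrix.diagonal_mul_diagonal, ← Matrix.diagonal_one]
  congr 1
  funext j
  exact mul_inv_cancel₀ (h j)

lemma trace_diagonal_five (r : Fin n → ℂ) (B C : Mat n) :
    (Matrix.diagonal r * Matrix.diagonal r * B * Matrix.diagonal r * C).trace =
      ∑ j, ∑ k, r j ^ 2 * r k * (B j k * C k j) := by
  rw [Matrix.diagonal_mul_diagonal]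
  simp only [Matrix.trace, Matrix.diag_apply, Matrix.mul_apply (N := C), Matrix.mul_diagonal,
    Matrix.diagonal_mul]
  refine Finset.sum_congr rfl fun j _ => Finset.sum_congr rfl fun k _ => by ring

lemma wForm_diagonal {l : Fin n → ℝ} (hl : ∀ j, l j ≠ 0) (B C : Mat n) (x : ℝ) :
    wForm (Matrix.diagonal fun j => (l j : ℂ)) B C x =
      ∑ j, ∑ k, (B j k * C k j - C j k * B k j) *
        ((((l j : ℂ) - Complex.I * x) ^ 2)⁻¹ * ((l k : ℂ) - Complex.I * x)⁻¹) := by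
  rw [wForm, inv_shift_diagonal fun j => sub_I_mul_ne_zero (hl j) x, trace_diagonal_five,
    trace_diagonal_five, ← Finset.sum_sub_distrib]
  refine Finset.sum_congr rfl fun j _ => ?_
  rw [← Finset.sum_sub_distrib]
  refine Finset.sum_congr rfl fun k _ => ?_
  rw [inv_pow]
  ring

lemma qForm_diagonal {l : Fin n → ℝ} (hl : ∀ j, l j ≠ 0) (B C : Mat n) :
    qForm (Matrix.diagonal fun j => (l j : ℂ)) B C =
      ∑ j, ∑ k, (B j k * C k j - C j k * B k j) *
        (-(Real.pi * (Real.sign (l j) - Real.sign (l k))) / ((l k : ℂ) - l j) ^ 2) := by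
  simp only [qForm, wForm_diagonal hl]
  rw [integral_finsetSum _ fun j _ => integrable_finsetSum _ fun k _ =>
    (integrable_resolvent_product (hl j) (hl k)).const_mul _]
  refine Finset.sum_congr rfl fun j _ => ?_
  rw [integral_finsetSum _ fun k _ => (integrable_resolvent_product (hl j) (hl k)).const_mul _]
  refine Finset.sum_congr rfl fun k _ => ?_
  rw [integral_const_mul, integral_resolvent_product (hl j) (hl k)]

lemma sign_eq_negInd {t : ℝ} (ht : t ≠ 0) : Real.sign t = 1 - 2 * negInd t := by
  rcases ht.lt_or_gt with h | h
  · rw [Real.sign_of_neg h, negInd, if_pos h]; norm_num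
  · rw [Real.sign_of_pos h, negInd, if_neg h.not_gt]; norm_num

/-- The curvature of the negative spectral projector as an integral over the resolvent set: the
derivatives `D₁, D₂` of the projector are determined by those `B, C` of the matrix. -/
lemma qForm_eq_trace_commutator {A B C D₁ D₂ : Mat n} (hA : A.IsHermitian) {c : ℝ} (hc : 0 < c)
    (h : Coercive c A)
    (h₁ : D₁ = negProj A * D₁ + D₁ * negProj A)
    (h₁' : D₁ * A - A * D₁ + (negProj A * B - B * negProj A) = 0)
    (h₂ : D₂ = negProj A * D₂ + D₂ * negProj A)
    (h₂' : D₂ * A - A * D₂ + (negProj A * C - C * negProj A) = 0) :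
    qForm A B C = 4 * Real.pi * (negProj A * (D₁ * D₂ - D₂ * D₁)).trace := by
  obtain ⟨U, V, hUV, hVU, -, hAd, hPd⟩ := exists_diagonalization hA
  set l := hA.eigenvalues with hl
  have hl0 : ∀ j, l j ≠ 0 := fun j => by
    have := (coercive_iff_eigenvalues hA hc.le).mp h j
    exact abs_pos.mp (hc.trans_le this)
  have hAc : V * A * U = Matrix.diagonal fun j => (l j : ℂ) := by
    conv_lhs => rw [hAd]
    exact conj_cancel hVU _
  have hPc : V * negProj A * U = Matrix.diagonal fun j => (negInd (l j) : ℂ) := by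
    rw [hPd]
    exact conj_cancel hVU _
  -- In the eigenbasis of `A` the two relations determine `D`. It is the entrywise product of `B`
  -- with the divided difference of the indicator of the negative half line.
  have key : ∀ D B : Mat n, D = negProj A * D + D * negProj A →
      D * A - A * D + (negProj A * B - B * negProj A) = 0 → ∀ j k,
      (V * D * U) j k = ((negInd (l k) : ℂ) - negInd (l j)) / ((l k : ℂ) - l j) *
        (V * B * U) j k := by
    intro D B h1 h2 j k
    have e1 : V * D * U = V * negProj A * U * (V * D * U) + V * D * U * (V * negProj A * U) := by
      conv_lhs => rw [h1]
      rw [mul_add, add_mul, conj_mul hUV, conj_mul hUV]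
    have e2 : V * D * U * (V * A * U) - V * A * U * (V * D * U) +
        (V * negProj A * U * (V * B * U) - V * B * U * (V * negProj A * U)) = 0 := by
      simp only [← conj_mul hUV, ← mul_sub, ← sub_mul, ← mul_add, ← add_mul, h2, mul_zero, zero_mul]
    rw [hPc] at e1 e2
    rw [hAc] at e2
    have f1 := congrFun (congrFun e1 j) k
    have f2 := congrFun (congrFun e2 j) k
    simp only [Matrix.add_apply, Matrix.sub_apply, Matrix.diagonal_mul, Matrix.mul_diagonal,
      Matrix.zero_apply] at f1 f2
    -- Within a block of equal indicators the idempotency relation forces the entry of `D` to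
    -- vanish. Between the blocks the eigenvalues differ and the commutation relation can be divided
    -- by their difference.
    by_cases hjk : negInd (l j) = negInd (l k)
    · rw [hjk] at f1 ⊢
      rw [sub_self, zero_div, zero_mul]
      unfold negInd at f1
      split_ifs at f1
      · push_cast at f1; linear_combination -f1
      · push_cast at f1; linear_combination f1
    · have hne : (l k : ℂ) - l j ≠ 0 := by
        rw [sub_ne_zero]
        intro h3
        apply hjk
        rw [Complex.ofReal_injective h3]
      field_simp
      linear_combination f2
  have hq : qForm A B C = qForm (V * A * U) (V * B * U) (V * C * U) := by
    simp only [qForm]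
    exact integral_congr_ae (Eventually.of_forall fun x => wForm_conj hUV hVU A B C x)
  have ht : (negProj A * (D₁ * D₂ - D₂ * D₁)).trace =
      ∑ j, ∑ k, (negInd (l j) : ℂ) * ((V * D₁ * U) j k * (V * D₂ * U) k j -
        (V * D₂ * U) j k * (V * D₁ * U) k j) := by
    rw [← trace_conj hUV, conj_mul hUV, mul_sub, sub_mul, conj_mul hUV, conj_mul hUV, hPc]
    simp only [Matrix.trace, Matrix.diag_apply, Matrix.diagonal_mul, Matrix.sub_apply,
      Matrix.mul_apply (M := V * D₁ * U), Matrix.mul_apply (M := V * D₂ * U)]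
    refine Finset.sum_congr rfl fun j _ => ?_
    rw [← Finset.sum_sub_distrib, Finset.mul_sum]
  rw [hq, hAc, qForm_diagonal hl0, ht]
  set b := V * B * U
  set c' := V * C * U
  simp only [key D₁ B h₁ h₁', key D₂ C h₂ h₂']
  -- symmetrize
  have hsym : ∀ f : Fin n → Fin n → ℂ, ∑ j, ∑ k, f j k = ∑ j, ∑ k, (f j k + f k j) / 2 := by
    intro f
    have : ∑ j, ∑ k, f k j = ∑ j, ∑ k, f j k := Finset.sum_comm
    simp only [add_div, Finset.sum_add_distrib]
    simp only [← Finset.sum_div]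
    rw [this]
    ring
  rw [hsym, hsym (fun j k => (negInd (l j) : ℂ) * _), Finset.mul_sum]
  refine Finset.sum_congr rfl fun j _ => ?_
  rw [Finset.mul_sum]
  refine Finset.sum_congr rfl fun k _ => ?_
  rw [sign_eq_negInd (hl0 j), sign_eq_negInd (hl0 k)]
  -- After symmetrization the two double sums agree term by term. Equal eigenvalues give zero on
  -- both sides, partly by the convention for division by zero. Otherwise the cases of the two signs
  -- are checked.
  rcases eq_or_ne (l j) (l k) with hjk | hjk
  · rw [hjk]; simp
  · have hne : (l k : ℂ) - l j ≠ 0 := by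
      rw [sub_ne_zero]; exact_mod_cast hjk.symm
    have hne' : (l j : ℂ) - l k ≠ 0 := by
      rw [sub_ne_zero]; exact_mod_cast hjk
    have hsq : ((l j : ℂ) - l k) = -((l k : ℂ) - l j) := by ring
    rw [hsq]
    unfold negInd
    split_ifs <;> push_cast <;> field_simp <;> ring

end Diagonalization

/-! ### Continuity, differentiability and curvature of the negative spectral projector. -/

section NegativeProjector

variable {n : ℕ}

lemma isStarProjection_negProj (A : Mat n) : IsStarProjection (negProj A) := by
  by_cases hA : IsSelfAdjoint A
  · refine ⟨?_, cfc_predicate _ _⟩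
    have hA' : A.IsHermitian := hA
    rw [IsIdempotentElem]
    obtain ⟨U, V, -, hVU, -, -, hP⟩ := exists_diagonalization hA'
    rw [hP]
    have : ∀ D : Mat n, D * D = D → U * D * V * (U * D * V) = U * D * V := fun D hD => by
      calc U * D * V * (U * D * V) = U * D * (V * U) * D * V := by noncomm_ring
        _ = U * (D * D) * V := by rw [hVU]; noncomm_ring
        _ = U * D * V := by rw [hD]
    refine this _ ?_
    rw [Matrix.diagonal_mul_diagonal]
    congr 1
    funext j
    exact_mod_cast negInd_mul_self _
  -- The functional calculus takes the value 0 off the self-adjoint matrices, and 0 is a projection.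
  · have : negProj A = 0 := cfc_apply_of_not_predicate _ hA
    rw [this]
    exact .zero _

lemma norm_conj_le {U V : Mat n} (hU : U ∈ unitary (Mat n)) (hV : V ∈ unitary (Mat n))
    (M : Mat n) : ‖V * M * U‖ = ‖M‖ := by
  rw [CStarRing.norm_mul_mem_unitary _ hU, CStarRing.norm_mem_unitary_mul _ hV]

/-- In mixed eigenbases (of `B` on the left, of `A` on the right) the entries of `B - A` are `(s -
t)M` and those of the difference of projectors are `(χ(s) - χ(t))M`, with `s`, `t` eigenvalues of
`B`, `A`. If the indicators differ, `s` and `t` have opposite signs and `|s - t| ≥ 2c`. The factors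
`n` come from passing between entries and the norm. -/
lemma norm_negProj_sub_le {A B : Mat n} (hA : A.IsHermitian) (hB : B.IsHermitian) {c : ℝ}
    (hc : 0 < c) (hAc : Coercive c A) (hBc : Coercive c B) :
    ‖negProj B - negProj A‖ ≤ n * (n * (‖B - A‖ / (2 * c))) := by
  obtain ⟨U, V, hUV, hVU, hV, hAd, hPd⟩ := exists_diagonalization hA
  obtain ⟨U', V', hUV', hVU', hV', hBd, hQd⟩ := exists_diagonalization hB
  have mU : U ∈ unitary (Mat n) := by rw [Unitary.mem_iff, ← hV]; exact ⟨hVU, hUV⟩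
  have mU' : U' ∈ unitary (Mat n) := by rw [Unitary.mem_iff, ← hV']; exact ⟨hVU', hUV'⟩
  have mV' : V' ∈ unitary (Mat n) := by rw [hV']; exact Unitary.star_mem mU'
  have hl := (coercive_iff_eigenvalues hA hc.le).mp hAc
  have hl' := (coercive_iff_eigenvalues hB hc.le).mp hBc
  have e : ∀ D D' : Mat n, V' * (U' * D' * V' - U * D * V) * U =
      D' * (V' * U) - V' * U * D := fun D D' => by
    calc _ = (V' * U') * D' * (V' * U) - V' * U * D * (V * U) := by noncomm_ring
      _ = _ := by rw [hVU', hVU, one_mul, mul_one]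
  rw [← norm_conj_le mU mV' (negProj B - negProj A)]
  refine norm_le_of_entries _ fun i j => ?_
  have h1 : ‖(V' * (B - A) * U) i j‖ ≤ ‖B - A‖ := by
    rw [← norm_conj_le mU mV' (B - A)]
    exact norm_entry_le _ _ _
  have e1 := e (Matrix.diagonal fun j => (hA.eigenvalues j : ℂ))
    (Matrix.diagonal fun j => (hB.eigenvalues j : ℂ))
  have e2 := e (Matrix.diagonal fun j => (negInd (hA.eigenvalues j) : ℂ))
    (Matrix.diagonal fun j => (negInd (hB.eigenvalues j) : ℂ))
  rw [← hAd, ← hBd] at e1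
  rw [← hPd, ← hQd] at e2
  rw [e1] at h1
  rw [e2]
  simp only [Matrix.sub_apply, Matrix.diagonal_mul, Matrix.mul_diagonal] at h1 ⊢
  have hi := hl' i
  have hj := hl j
  set M := (V' * U) i j
  set s := hB.eigenvalues i
  set t := hA.eigenvalues j
  have h2 : ‖(s : ℂ) * M - M * t‖ = |s - t| * ‖M‖ := by
    rw [mul_comm M, ← sub_mul, norm_mul, ← Complex.ofReal_sub, Complex.norm_real, Real.norm_eq_abs]
  have h3 : ‖(negInd s : ℂ) * M - M * negInd t‖ = |negInd s - negInd t| * ‖M‖ := by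
    rw [mul_comm M, ← sub_mul, norm_mul, ← Complex.ofReal_sub, Complex.norm_real, Real.norm_eq_abs]
  rw [h2] at h1
  rw [h3, le_div_iff₀ (by positivity)]
  have hM := norm_nonneg M
  rcases le_abs.mp hi with hi | hi <;> rcases le_abs.mp hj with hj | hj
  · rw [negInd, negInd, if_neg (by linarith), if_neg (by linarith)]; simp
  · rw [negInd, negInd, if_neg (by linarith), if_pos (by linarith)]
    rw [abs_of_nonneg (by linarith)] at h1
    norm_num
    nlinarith
  · rw [negInd, negInd, if_pos (by linarith), if_neg (by linarith)]
    rw [abs_of_nonpos (by linarith)] at h1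
    norm_num
    nlinarith
  · rw [negInd, negInd, if_pos (by linarith), if_pos (by linarith)]; simp

lemma Coercive.of_norm_sub_le {A B : Mat n} {c δ : ℝ} (h : Coercive c A) (hB : ‖B - A‖ ≤ δ) :
    Coercive (c - δ) B := by
  intro v
  have h1 := h v
  have h2 := norm_toEuclideanLin_le (B - A) v
  rw [map_sub, LinearMap.sub_apply] at h2
  have h3 := norm_sub_norm_le (Matrix.toEuclideanLin A v) (Matrix.toEuclideanLin B v)
  rw [norm_sub_rev] at h3
  nlinarith [norm_nonneg v, mul_le_mul_of_nonneg_right hB (norm_nonneg v)]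

lemma negProj_commute {A : Mat n} (hA : A.IsHermitian) : negProj A * A = A * negProj A := by
  obtain ⟨U, V, -, hVU, -, hAd, hPd⟩ := exists_diagonalization hA
  have key : ∀ D D' B C : Mat n, D * D' = D' * D → B = U * D * V → C = U * D' * V →
      B * C = C * B := by
    rintro D D' _ _ h rfl rfl
    calc U * D * V * (U * D' * V) = U * D * (V * U) * D' * V := by noncomm_ring
      _ = U * D' * (V * U) * D * V := by rw [hVU, mul_one, mul_one, mul_assoc U, h]; noncomm_ring
      _ = _ := by noncomm_ring
  refine key _ _ _ _ ?_ hPd hAd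
  rw [Matrix.diagonal_mul_diagonal, Matrix.diagonal_mul_diagonal]
  simp only [mul_comm]

variable {E : Type*} [NormedAddCommGroup E] [NormedSpace ℝ E]

lemma hasFDerivAt_zero_of_mul {f g : E → ℂ} {X : E} (hf : Tendsto f (𝓝 X) (𝓝 0))
    (hg : g =O[𝓝 X] fun Y => Y - X) (hX : g X = 0) :
    HasFDerivAt (fun Y => f Y * g Y) (0 : E →L[ℝ] ℂ) X := by
  rw [hasFDerivAt_iff_isLittleO]
  simp only [hX, mul_zero, sub_zero, zero_apply]
  have h1 : f =o[𝓝 X] fun _ => (1 : ℝ) := (Asymptotics.isLittleO_one_iff ℝ).mpr hf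
  have := h1.mul_isBigO hg.norm_right
  simp only [one_mul] at this
  exact this.of_norm_right

/-- Continuity of `f` suffices: `(f - f X) g` is `o(1) · O(Y - X)` because `g` vanishes at `X`. -/
lemma differentiableAt_mul_of_vanish {f g : E → ℂ} {X : E} (hf : ContinuousAt f X)
    (hg : DifferentiableAt ℝ g X) (hX : g X = 0) :
    DifferentiableAt ℝ (fun Y => f Y * g Y) X := by
  have h1 : (fun Y => f Y * g Y) = fun Y => f X * g Y + (f Y - f X) * g Y := by
    funext Y; ring
  rw [h1]
  refine (hg.const_mul _).add (HasFDerivAt.differentiableAt (hasFDerivAt_zero_of_mul ?_ ?_ hX))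
  · have : Tendsto (fun Y => f Y - f X) (𝓝 X) (𝓝 (f X - f X)) := hf.tendsto.sub_const _
    simpa using this
  · have := hg.hasFDerivAt.isBigO_sub
    simpa [hX] using this

variable {H : E → Mat n} {X : E}

lemma eventually_norm_negProj_sub_le {E : Type*} [TopologicalSpace E] {H : E → Mat n} {X : E}
    (hH : ∀ Y, (H Y).IsHermitian) (hX : IsUnit (H X))
    (hd : ContinuousAt H X) :
    ∃ K : ℝ, ∀ᶠ Y in 𝓝 X, ‖negProj (H Y) - negProj (H X)‖ ≤ K * ‖H Y - H X‖ := by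
  obtain ⟨c, hc, hcX⟩ := exists_coercive_of_isUnit hX
  refine ⟨n * (n / (2 * (c / 2))), ?_⟩
  have h1 : ∀ᶠ Y in 𝓝 X, ‖H Y - H X‖ ≤ c / 2 := by
    have := hd.eventually (Metric.closedBall_mem_nhds (H X) (half_pos hc))
    simpa [dist_eq_norm] using this
  filter_upwards [h1] with Y hY
  have h2 : Coercive (c / 2) (H Y) := (hcX.of_norm_sub_le hY).mono (by linarith)
  refine (norm_negProj_sub_le (hH X) (hH Y) (half_pos hc) (hcX.mono (by linarith)) h2).trans
    (le_of_eq ?_)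
  ring

lemma continuousAt_negProj {E : Type*} [TopologicalSpace E] {H : E → Mat n} {X : E}
    (hH : ∀ Y, (H Y).IsHermitian) (hX : IsUnit (H X))
    (hd : ContinuousAt H X) : ContinuousAt (fun Y => negProj (H Y)) X := by
  obtain ⟨K, hK⟩ := eventually_norm_negProj_sub_le hH hX hd
  rw [ContinuousAt, tendsto_iff_norm_sub_tendsto_zero]
  have : Tendsto (fun Y => K * ‖H Y - H X‖) (𝓝 X) (𝓝 0) := by
    simpa using (tendsto_iff_norm_sub_tendsto_zero.mp hd.tendsto).const_mul K
  exact squeeze_zero' (Eventually.of_forall fun _ => norm_nonneg _) hK this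

/-- The Lipschitz bound `norm_negProj_sub_le` bootstraps to differentiability through the algebraic
relations `P² = P` and `PH = HP`, written in the eigenbasis of `H X`. The relation `P² = P` makes
the diagonal blocks of `P - P(X)` quadratically small. The commutation relation expresses the
off-diagonal blocks by entries of `H - H(X)`. -/
lemma differentiableAt_negProj (hH : ∀ Y, (H Y).IsHermitian) (hX : IsUnit (H X))
    (hd : DifferentiableAt ℝ H X) : DifferentiableAt ℝ (fun Y => negProj (H Y)) X := by
  obtain ⟨K, hK⟩ := eventually_norm_negProj_sub_le hH hX hd.continuousAt
  have hcont := continuousAt_negProj hH hX hd.continuousAt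
  have hO : (fun Y => negProj (H Y) - negProj (H X)) =O[𝓝 X] fun Y => Y - X :=
    (Asymptotics.IsBigO.of_bound K hK).trans hd.hasFDerivAt.isBigO_sub
  obtain ⟨c, hc, hcX⟩ := exists_coercive_of_isUnit hX
  obtain ⟨U, V, hUV, hVU, -, hAd, hPd⟩ := exists_diagonalization (hH X)
  set l := (hH X).eigenvalues with hl
  set P : E → Mat n := fun Y => V * negProj (H Y) * U with hP
  set G : E → Mat n := fun Y => V * H Y * U with hG
  have hG0 : G X = Matrix.diagonal fun j => (l j : ℂ) := by
    rw [hG]; simp only; rw [hAd]; exact conj_cancel hVU _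
  have hP0 : P X = Matrix.diagonal fun j => (negInd (l j) : ℂ) := by
    rw [hP]; simp only; rw [hPd]; exact conj_cancel hVU _
  have hGd : DifferentiableAt ℝ G X := (hd.const_mul V).mul_const U
  have hPc : ContinuousAt P X := (continuousAt_const.mul hcont).mul continuousAt_const
  have hPO : (fun Y => P Y - P X) =O[𝓝 X] fun Y => Y - X := by
    have h1 : (fun Y => P Y - P X) = fun Y => V * (negProj (H Y) - negProj (H X)) * U := by
      funext Y; simp only [hP]; noncomm_ring
    rw [h1]
    have h2 : (fun Y => V * (negProj (H Y) - negProj (H X)) * U) =O[𝓝 X]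
        fun Y => negProj (H Y) - negProj (H X) := by
      refine Asymptotics.IsBigO.of_bound (‖V‖ * ‖U‖) (Eventually.of_forall fun Y => ?_)
      refine (norm_mul_le _ _).trans ?_
      calc _ ≤ ‖V‖ * ‖negProj (H Y) - negProj (H X)‖ * ‖U‖ := by
            gcongr; exact norm_mul_le _ _
        _ = _ := by ring
    exact h2.trans hO
  have hcomm : ∀ Y, P Y * G Y = G Y * P Y := fun Y => by
    simp only [hP, hG, ← conj_mul hUV, negProj_commute (hH Y)]
  have hidem : ∀ Y, P Y * P Y = P Y := fun Y => by
    simp only [hP, ← conj_mul hUV, (isStarProjection_negProj (H Y)).isIdempotentElem.eq]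
  suffices hPd : ∀ j k, DifferentiableAt ℝ (fun Y => P Y j k) X by
    have h1 : DifferentiableAt ℝ P X :=
      (hasFDerivAt_of_entries fun j k => (hPd j k).hasFDerivAt).differentiableAt
    have h2 : (fun Y => negProj (H Y)) = fun Y => U * P Y * V := by
      funext Y; exact (conj_cancel hUV _).symm
    rw [h2]
    exact (h1.const_mul U).mul_const V
  intro j k
  by_cases hjk : negInd (l j) = negInd (l k)
  · -- the difference is quadratic
    have hsq : DifferentiableAt ℝ (fun Y => ((P Y - P X) * (P Y - P X)) j k) X := by
      simp only [Matrix.mul_apply]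
      refine DifferentiableAt.fun_sum fun i _ => HasFDerivAt.differentiableAt
        (hasFDerivAt_zero_of_mul ?_ ?_ (by simp))
      · have h1 : ContinuousAt (fun Y => P Y j i) X := (entryCLM j i).continuous.continuousAt.comp hPc
        have h2 : Tendsto (fun Y => P Y j i - P X j i) (𝓝 X) (𝓝 (P X j i - P X j i)) :=
          h1.tendsto.sub_const _
        simpa using h2
      · exact (Asymptotics.isBigO_of_le _ fun Y => norm_entry_le (P Y - P X) i k).trans hPO
    -- By idempotency `(P - P₀)² = P - P₀P - PP₀ + P₀`. On a block where `P₀ = diag(ε)` with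
    -- constant `ε`, this is `(1 - 2ε)(P - P₀)`, and `1 - 2ε = ±1`.
    have hexp : ∀ Y, ((P Y - P X) * (P Y - P X)) j k =
        (1 - 2 * (negInd (l j) : ℂ)) * (P Y j k - P X j k) := fun Y => by
      have h1 : (P Y - P X) * (P Y - P X) = P Y - P X * P Y - P Y * P X + P X := by
        calc _ = P Y * P Y - P X * P Y - P Y * P X + P X * P X := by noncomm_ring
          _ = _ := by rw [hidem, hidem]
      have h2 := congrFun (congrFun (hidem X) j) k
      rw [h1]
      rw [hP0] at h2 ⊢
      simp only [Matrix.add_apply, Matrix.sub_apply, Matrix.diagonal_mul, Matrix.mul_diagonal]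
        at h2 ⊢
      rw [← hjk] at h2 ⊢
      linear_combination (-2) * h2
    have hpm : (1 - 2 * (negInd (l j) : ℂ)) ^ 2 = 1 := by
      unfold negInd; split_ifs <;> push_cast <;> ring
    have h3 : (fun Y => P Y j k) = fun Y =>
        (1 - 2 * (negInd (l j) : ℂ)) * ((P Y - P X) * (P Y - P X)) j k + P X j k := by
      funext Y
      rw [hexp]
      linear_combination -(P Y j k - P X j k) * hpm
    rw [h3]
    exact (hsq.const_mul _).add_const _
  · have hne : (l k : ℂ) - l j ≠ 0 := by
      rw [sub_ne_zero]
      intro h3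
      apply hjk
      rw [Complex.ofReal_injective h3]
    -- With `Δ = G - G(X)` the relation `PG = GP` reads `P G(X) - G(X) P = ΔP - PΔ`, and `G(X)` is
    -- diagonal. Every term on the right is a continuous entry of `P` times a differentiable one
    -- that vanishes at `X`.
    have h3 : (fun Y => P Y j k) = fun Y => ((l k : ℂ) - l j)⁻¹ *
        ∑ i, ((P Y i k) * (G Y j i - G X j i) - P Y j i * (G Y i k - G X i k)) := by
      funext Y
      rw [eq_inv_mul_iff_mul_eq₀ hne, Finset.sum_sub_distrib]
      have h4 := congrFun (congrFun (hcomm Y) j) k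
      have h5 : ∀ M N : Mat n, ∑ i, M i k * N j i = (N * M) j k := fun M N => by
        rw [Matrix.mul_apply]
        exact Finset.sum_congr rfl fun i _ => mul_comm _ _
      have h6 := h5 (P Y) (G Y - G X)
      have h7 : ∑ i, P Y j i * (G Y i k - G X i k) = (P Y * (G Y - G X)) j k := rfl
      simp only [Matrix.sub_apply] at h6
      rw [h6, h7, mul_sub, sub_mul (G Y), hG0]
      simp only [Matrix.sub_apply, Matrix.diagonal_mul, Matrix.mul_diagonal]
      linear_combination h4
    rw [h3]
    refine DifferentiableAt.const_mul (DifferentiableAt.fun_sum fun i _ => ?_) _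
    have hPe : ∀ a b, ContinuousAt (fun Y => P Y a b) X := fun a b =>
      (entryCLM a b).continuous.continuousAt.comp hPc
    have hGe : ∀ a b, DifferentiableAt ℝ (fun Y => G Y a b - G X a b) X := fun a b =>
      (differentiableAt_entry hGd a b).sub_const _
    exact (differentiableAt_mul_of_vanish (hPe i k) (hGe j i) (sub_self _)).sub
      (differentiableAt_mul_of_vanish (hPe j i) (hGe i k) (sub_self _))

/-- The curvature of the negative spectral projector in terms of the resolvent. -/
lemma curvature_negProj {H : Momentum → Mat n} (hH : ∀ Y, (H Y).IsHermitian) {k : Momentum}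
    (hX : IsUnit (H k)) (hd : DifferentiableAt ℝ H k) :
    qForm (H k) (pderiv 0 H k) (pderiv 1 H k) =
      4 * Real.pi * curvature (fun k' => negProj (H k')) k := by
  obtain ⟨c, hc, hcX⟩ := exists_coercive_of_isUnit hX
  have hP := differentiableAt_negProj hH hX hd
  -- These are the derivatives of `P² = P` and of `PH = HP`, as needed by
  -- `qForm_eq_trace_commutator`.
  have key : ∀ i, pderiv i (fun k' => negProj (H k')) k =
      negProj (H k) * pderiv i (fun k' => negProj (H k')) k +
        pderiv i (fun k' => negProj (H k')) k * negProj (H k) ∧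
      pderiv i (fun k' => negProj (H k')) k * H k - H k * pderiv i (fun k' => negProj (H k')) k +
        (negProj (H k) * pderiv i H k - pderiv i H k * negProj (H k)) = 0 := by
    intro i
    rw [pderiv_eq_fderiv hP, pderiv_eq_fderiv hd]
    constructor
    · have h1 : ((fun k' => negProj (H k')) * fun k' => negProj (H k')) = fun k' => negProj (H k') := by
        funext k'; exact (isStarProjection_negProj (H k')).isIdempotentElem.eq
      have h2 := (hP.hasFDerivAt.mul' hP.hasFDerivAt).fderiv
      rw [h1] at h2
      conv_lhs => rw [h2]
      simp
    · have h1 : ((fun k' => negProj (H k')) * H) = H * fun k' => negProj (H k') := by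
        funext k'; exact negProj_commute (hH k')
      have h2 := hP.hasFDerivAt.mul' hd.hasFDerivAt
      rw [h1] at h2
      have h3 := h2.unique (hd.hasFDerivAt.mul' hP.hasFDerivAt)
      have h4 := DFunLike.congr_fun h3 (EuclideanSpace.single i 1)
      simp only [add_apply, smul_apply, smul_eq_mul,
        MulOpposite.smul_eq_mul_unop, MulOpposite.unop_op] at h4
      rw [← sub_eq_zero] at h4
      rw [← h4]
      abel
  rw [curvature]
  exact qForm_eq_trace_commutator (hH k) hc hcX (key 0).1 (key 0).2 (key 1).1 (key 1).2

end NegativeProjector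

/-! ### Alternating sums over permutations and the algebra of closedness. -/

section PermSums

/-- The translation `τ ↦ τ s` by an odd `s` reverses the sign of each term, so the sum equals its
negative. -/
lemma sum_perm_eq_zero {g : Equiv.Perm (Fin 4) → ℂ} (s : Equiv.Perm (Fin 4))
    (hs : Equiv.Perm.sign s = -1) (hg : ∀ τ, g (τ * s) = g τ) :
    ∑ τ : Equiv.Perm (Fin 4), ((Equiv.Perm.sign τ : ℤ) : ℂ) * g τ = 0 := by
  have h : ∑ τ : Equiv.Perm (Fin 4), ((Equiv.Perm.sign τ : ℤ) : ℂ) * g τ =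
      ∑ τ : Equiv.Perm (Fin 4), -(((Equiv.Perm.sign τ : ℤ) : ℂ) * g τ) := by
    conv_lhs => rw [← Equiv.sum_comp (Equiv.mulRight s)]
    refine Finset.sum_congr rfl fun τ _ => ?_
    simp [hg, hs]
  rw [Finset.sum_neg_distrib] at h
  exact self_eq_neg.mp h

variable {n : ℕ}

lemma sum_perm_mul_right {g : Equiv.Perm (Fin 4) → ℂ}
    (hg : ∑ τ : Equiv.Perm (Fin 4), ((Equiv.Perm.sign τ : ℤ) : ℂ) * g τ = 0)
    (s : Equiv.Perm (Fin 4)) :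
    ∑ τ : Equiv.Perm (Fin 4), ((Equiv.Perm.sign τ : ℤ) : ℂ) * g (τ * s) = 0 := by
  rw [← Equiv.sum_comp (Equiv.mulRight s)] at hg
  have h : ∑ τ : Equiv.Perm (Fin 4), ((Equiv.Perm.sign τ : ℤ) : ℂ) * g (τ * s) =
      ((Equiv.Perm.sign s : ℤ) : ℂ) * ∑ τ : Equiv.Perm (Fin 4),
        ((Equiv.Perm.sign (Equiv.mulRight s τ) : ℤ) : ℂ) * g (Equiv.mulRight s τ) := by
    rw [Finset.mul_sum]
    refine Finset.sum_congr rfl fun τ _ => ?_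
    rcases Int.units_eq_one_or (Equiv.Perm.sign s) with h | h <;> simp [h]
  rw [h, hg, mul_zero]

/-- The trace is invariant under the cyclic shift of four factors, which is an odd permutation. -/
lemma sum_perm_trace_four (A : Fin 4 → Mat n) :
    ∑ τ : Equiv.Perm (Fin 4), ((Equiv.Perm.sign τ : ℤ) : ℂ) *
      (A (τ 0) * A (τ 1) * A (τ 2) * A (τ 3)).trace = 0 := by
  refine sum_perm_eq_zero (finRotate 4) (by simp [sign_finRotate]; norm_num) fun τ => ?_
  simp only [Equiv.Perm.mul_apply, show finRotate 4 0 = 1 from rfl, show finRotate 4 1 = 2 from rfl,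
    show finRotate 4 2 = 3 from rfl, show finRotate 4 3 = 0 from rfl]
  rw [Matrix.trace_mul_comm]
  simp only [mul_assoc]

/-- The algebraic identity behind the closedness of `tr (a⁻¹ da)^{∧3}`. -/
lemma sum_perm_closed (A : Fin 4 → Mat n) (S : Fin 4 → Fin 4 → Mat n)
    (hS : ∀ i j, S i j = S j i) :
    ∑ τ : Equiv.Perm (Fin 4), ((Equiv.Perm.sign τ : ℤ) : ℂ) *
      ((-(A (τ 0) * A (τ 1)) + S (τ 0) (τ 1)) * A (τ 2) * A (τ 3) +
        A (τ 1) * (-(A (τ 0) * A (τ 2)) + S (τ 0) (τ 2)) * A (τ 3) +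
        A (τ 1) * A (τ 2) * (-(A (τ 0) * A (τ 3)) + S (τ 0) (τ 3))).trace = 0 := by
  -- The quartic terms occur in three orders of the factors, each of which sums to zero. The terms
  -- with `S` vanish separately, by the transposition of the two indices in which `S` is symmetric.
  have h0 := sum_perm_trace_four A
  have h1 := sum_perm_mul_right h0 (Equiv.swap 0 1)
  have h2 := sum_perm_mul_right h0 (Equiv.swap 0 1 * Equiv.swap 1 2)
  have h3 : ∑ τ : Equiv.Perm (Fin 4), ((Equiv.Perm.sign τ : ℤ) : ℂ) *
      (S (τ 0) (τ 1) * A (τ 2) * A (τ 3)).trace = 0 := by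
    refine sum_perm_eq_zero (Equiv.swap 0 1) (by simp) fun τ => ?_
    simp only [Equiv.Perm.mul_apply, show Equiv.swap (0 : Fin 4) 1 0 = 1 from by decide,
      show Equiv.swap (0 : Fin 4) 1 1 = 0 from by decide,
      show Equiv.swap (0 : Fin 4) 1 2 = 2 from by decide,
      show Equiv.swap (0 : Fin 4) 1 3 = 3 from by decide, hS (τ 1)]
  have h4 : ∑ τ : Equiv.Perm (Fin 4), ((Equiv.Perm.sign τ : ℤ) : ℂ) *
      (A (τ 1) * S (τ 0) (τ 2) * A (τ 3)).trace = 0 := by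
    refine sum_perm_eq_zero (Equiv.swap 0 2) (by simp) fun τ => ?_
    simp only [Equiv.Perm.mul_apply, show Equiv.swap (0 : Fin 4) 2 0 = 2 from by decide,
      show Equiv.swap (0 : Fin 4) 2 1 = 1 from by decide,
      show Equiv.swap (0 : Fin 4) 2 2 = 0 from by decide,
      show Equiv.swap (0 : Fin 4) 2 3 = 3 from by decide, hS (τ 2)]
  have h5 : ∑ τ : Equiv.Perm (Fin 4), ((Equiv.Perm.sign τ : ℤ) : ℂ) *
      (A (τ 1) * A (τ 2) * S (τ 0) (τ 3)).trace = 0 := by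
    refine sum_perm_eq_zero (Equiv.swap 0 3) (by simp) fun τ => ?_
    simp only [Equiv.Perm.mul_apply, show Equiv.swap (0 : Fin 4) 3 0 = 3 from by decide,
      show Equiv.swap (0 : Fin 4) 3 1 = 1 from by decide,
      show Equiv.swap (0 : Fin 4) 3 2 = 2 from by decide,
      show Equiv.swap (0 : Fin 4) 3 3 = 0 from by decide, hS (τ 3)]
  simp only [Equiv.Perm.mul_apply, show Equiv.swap (0 : Fin 4) 1 0 = 1 from by decide,
    show Equiv.swap (0 : Fin 4) 1 1 = 0 from by decide,
    show Equiv.swap (0 : Fin 4) 1 2 = 2 from by decide,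
    show Equiv.swap (0 : Fin 4) 1 3 = 3 from by decide,
    show Equiv.swap (1 : Fin 4) 2 0 = 0 from by decide,
    show Equiv.swap (1 : Fin 4) 2 1 = 2 from by decide,
    show Equiv.swap (1 : Fin 4) 2 2 = 1 from by decide,
    show Equiv.swap (1 : Fin 4) 2 3 = 3 from by decide] at h1 h2
  have key : ∀ τ : Equiv.Perm (Fin 4), ((Equiv.Perm.sign τ : ℤ) : ℂ) *
      ((-(A (τ 0) * A (τ 1)) + S (τ 0) (τ 1)) * A (τ 2) * A (τ 3) +
        A (τ 1) * (-(A (τ 0) * A (τ 2)) + S (τ 0) (τ 2)) * A (τ 3) +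
        A (τ 1) * A (τ 2) * (-(A (τ 0) * A (τ 3)) + S (τ 0) (τ 3))).trace =
      -(((Equiv.Perm.sign τ : ℤ) : ℂ) * (A (τ 0) * A (τ 1) * A (τ 2) * A (τ 3)).trace) -
      ((Equiv.Perm.sign τ : ℤ) : ℂ) * (A (τ 1) * A (τ 0) * A (τ 2) * A (τ 3)).trace -
      ((Equiv.Perm.sign τ : ℤ) : ℂ) * (A (τ 1) * A (τ 2) * A (τ 0) * A (τ 3)).trace +
      ((Equiv.Perm.sign τ : ℤ) : ℂ) * (S (τ 0) (τ 1) * A (τ 2) * A (τ 3)).trace +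
      ((Equiv.Perm.sign τ : ℤ) : ℂ) * (A (τ 1) * S (τ 0) (τ 2) * A (τ 3)).trace +
      ((Equiv.Perm.sign τ : ℤ) : ℂ) * (A (τ 1) * A (τ 2) * S (τ 0) (τ 3)).trace := fun τ => by
    simp only [add_mul, mul_add, neg_mul, mul_neg, Matrix.trace_add, Matrix.trace_neg, ← mul_assoc]
    ring
  simp only [key, Finset.sum_add_distrib, Finset.sum_sub_distrib, Finset.sum_neg_distrib, h0, h1,
    h2, h3, h4, h5]
  ring

end PermSums

/-! ### Stokes' theorem for the closed three-form. -/

section Stokes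

variable {n : ℕ}

/-- The coordinate direction of phase space in position `i` of the positive order. -/
noncomputable def orientedDir (i : Fin 4) : Phase := EuclideanSpace.single (orientedCoord i) 1

/-- The density `du ∧ tr (a⁻¹ da)^{∧3}`. -/
noncomputable def wedge (u : Phase → ℝ) (a : Phase → Mat n) (X : Phase) : ℂ :=
  ∑ τ : Equiv.Perm (Fin 4), ((Equiv.Perm.sign τ : ℤ) : ℂ) *
    ((fderiv ℝ u X (orientedDir (τ 0)) : ℝ) : ℂ) *
      (logDeriv a (τ 1) X * logDeriv a (τ 2) X * logDeriv a (τ 3) X).trace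

lemma logDeriv_eq {a : Phase → Mat n} {X : Phase} (ha : DifferentiableAt ℝ a X) (i : Fin 4) :
    logDeriv a i X = (a X)⁻¹ * fderiv ℝ a X (orientedDir i) := by
  rw [logDeriv, pderiv_eq_fderiv ha]; rfl

lemma contDiffAt_logDeriv {a : Phase → Mat n} (ha : ContDiff ℝ 2 a) {X : Phase}
    (hX : IsUnit (a X)) (i : Fin 4) : ContDiffAt ℝ 1 (logDeriv a i) X := by
  have h : logDeriv a i = fun X => (a X)⁻¹ * fderiv ℝ a X (orientedDir i) := by
    funext Y; exact logDeriv_eq (ha.differentiable two_ne_zero Y) i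
  rw [h]
  refine (contDiffAt_matrix_inv (ha.contDiffAt.of_le (by norm_num)) hX).mul ?_
  have : ContDiff ℝ 1 (fderiv ℝ a) := ha.fderiv_right (by norm_num)
  exact (this.clm_apply contDiff_const).contDiffAt

/-- The structure equation for `A = a⁻¹da`: from `d(a⁻¹) = -a⁻¹ da a⁻¹`, the derivative is `-A A`
plus a second-derivative term, which is symmetric in the two directions and drops out of alternating
sums. -/
lemma fderiv_logDeriv {a : Phase → Mat n} (ha : ContDiff ℝ 2 a) {X : Phase}
    (hX : IsUnit (a X)) (l i : Fin 4) :
    fderiv ℝ (logDeriv a i) X (orientedDir l) = -(logDeriv a l X * logDeriv a i X) +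
      (a X)⁻¹ * fderiv ℝ (fderiv ℝ a) X (orientedDir l) (orientedDir i) := by
  have hd := ha.differentiable two_ne_zero X
  have h : logDeriv a i = (fun X => (a X)⁻¹) * fun X => fderiv ℝ a X (orientedDir i) := by
    funext Y; exact logDeriv_eq (ha.differentiable two_ne_zero Y) i
  have h1 : ContDiff ℝ 1 (fderiv ℝ a) := ha.fderiv_right (by norm_num)
  have h2 : HasFDerivAt (fun X => fderiv ℝ a X (orientedDir i))
      ((ContinuousLinearMap.apply ℝ (Mat n) (orientedDir i)).comp (fderiv ℝ (fderiv ℝ a) X)) X :=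
    (ContinuousLinearMap.apply ℝ (Mat n) (orientedDir i)).hasFDerivAt.comp X
      (h1.differentiable one_ne_zero X).hasFDerivAt
  obtain ⟨U, hU⟩ := hX
  have h3 : HasFDerivAt (fun X => (a X)⁻¹)
      ((-ContinuousLinearMap.mulLeftRight ℝ (Mat n) ↑U⁻¹ ↑U⁻¹).comp (fderiv ℝ a X)) X := by
    simp_rw [Matrix.nonsing_inv_eq_ringInverse]
    have := hasFDerivAt_ringInverse (𝕜 := ℝ) U
    rw [hU] at this
    exact this.comp X hd.hasFDerivAt
  have hinv : (↑U⁻¹ : Mat n) = (a X)⁻¹ := by rw [← hU, Matrix.coe_units_inv]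
  rw [h, (h3.mul' h2).fderiv, logDeriv_eq hd, ← h, logDeriv_eq hd]
  simp [hinv]
  noncomm_ring

/-- Integration by parts against the constant 1, which need not be integrable itself, as only its
products with `V` and the derivative of `V` occur. -/
lemma integral_fderiv_eq_zero {V : Phase → ℂ} (hV : ContDiff ℝ 1 V) (hc : HasCompactSupport V)
    (v : Phase) : ∫ X, fderiv ℝ V X v = 0 := by
  have h1 : Continuous fun X => fderiv ℝ V X v :=
    (hV.continuous_fderiv one_ne_zero).clm_apply continuous_const
  have h2 : HasCompactSupport fun X => fderiv ℝ V X v := hc.fderiv_apply ℝ v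
  have h := integral_mul_fderiv_eq_neg_fderiv_mul_of_integrable (μ := (volume : Measure Phase))
    (f := fun _ => (1 : ℂ)) (g := V) (v := v) (by simp)
    (by simpa using h1.integrable_of_hasCompactSupport h2)
    (by simpa using hV.continuous.integrable_of_hasCompactSupport hc)
    (fun X _ => differentiableAt_const _) (fun X _ => hV.differentiable one_ne_zero X)
  simpa using h

/-- Stokes' theorem for the closed form `tr (a⁻¹ da)^{∧3}`. -/
theorem integral_wedge_eq_zero {a : Phase → Mat n} (ha : ContDiff ℝ 2 a) {u : Phase → ℝ}
    (hu : ContDiff ℝ 1 u) (hc : HasCompactSupport u) (hs : ∀ X ∈ tsupport u, IsUnit (a X)) :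
    ∫ X, wedge u a X = 0 := by
  set T : Equiv.Perm (Fin 4) → Phase → ℂ := fun τ X =>
    (logDeriv a (τ 1) X * logDeriv a (τ 2) X * logDeriv a (τ 3) X).trace with hT
  set V : Equiv.Perm (Fin 4) → Phase → ℂ := fun τ X => (u X : ℂ) * T τ X with hV
  have hTs : ∀ τ X, IsUnit (a X) → ContDiffAt ℝ 1 (T τ) X := fun τ X hX =>
    (traceCLM (n := n)).contDiff.contDiffAt.comp X
      (((contDiffAt_logDeriv ha hX _).mul (contDiffAt_logDeriv ha hX _)).mul
        (contDiffAt_logDeriv ha hX _))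
  have hu' : ContDiff ℝ 1 fun X => (u X : ℂ) := Complex.ofRealCLM.contDiff.comp hu
  have hVz : ∀ τ X, X ∉ tsupport u → V τ =ᶠ[𝓝 X] 0 := fun τ X hX => by
    filter_upwards [notMem_tsupport_iff_eventuallyEq.mp hX] with Y hY
    simp [hV, hY]
  -- Where `a` may be singular, `u` vanishes identically nearby, so `u` times the coefficient of the
  -- form is globally smooth of class `C¹`.
  have hVs : ∀ τ, ContDiff ℝ 1 (V τ) := fun τ => contDiff_iff_contDiffAt.mpr fun X => by
    by_cases hX : X ∈ tsupport u
    · exact hu'.contDiffAt.mul (hTs τ X (hs X hX))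
    · exact contDiffAt_const.congr_of_eventuallyEq (hVz τ X hX)
  have hVc : ∀ τ, HasCompactSupport (V τ) := fun τ => by
    refine hc.mono' fun X hX => subset_tsupport _ ?_
    intro h
    apply hX
    simp [hV, h]
  have hderiv : ∀ τ X v, fderiv ℝ (V τ) X v =
      ((fderiv ℝ u X v : ℝ) : ℂ) * T τ X + u X * fderiv ℝ (T τ) X v := fun τ X v => by
    by_cases hX : X ∈ tsupport u
    · have h1 : HasFDerivAt (fun X => (u X : ℂ)) (Complex.ofRealCLM.comp (fderiv ℝ u X)) X :=
        Complex.ofRealCLM.hasFDerivAt.comp X (hu.differentiable one_ne_zero X).hasFDerivAt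
      have h2 := ((hTs τ X (hs X hX)).differentiableAt one_ne_zero).hasFDerivAt
      have h3 : HasFDerivAt (V τ) _ X := h1.mul h2
      rw [h3.fderiv]
      simp
      ring
    · rw [(hVz τ X hX).fderiv_eq]
      have h1 := notMem_tsupport_iff_eventuallyEq.mp hX
      rw [h1.fderiv_eq, h1.eq_of_nhds]
      simp
  have hclosed : ∀ X ∈ tsupport u, ∑ τ : Equiv.Perm (Fin 4), ((Equiv.Perm.sign τ : ℤ) : ℂ) *
      fderiv ℝ (T τ) X (orientedDir (τ 0)) = 0 := fun X hX => by
    have hX' := hs X hX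
    have hsymm : IsSymmSndFDerivAt ℝ a X := ha.contDiffAt.isSymmSndFDerivAt (by simp)
    have h := sum_perm_closed (fun i => logDeriv a i X)
      (fun i j => (a X)⁻¹ * fderiv ℝ (fderiv ℝ a) X (orientedDir i) (orientedDir j))
      (fun i j => by rw [hsymm.eq])
    rw [← h]
    refine Finset.sum_congr rfl fun τ _ => ?_
    congr 1
    have hd : ∀ i, HasFDerivAt (logDeriv a i) (fderiv ℝ (logDeriv a i) X) X := fun i =>
      ((contDiffAt_logDeriv ha hX' i).differentiableAt one_ne_zero).hasFDerivAt
    have h1 : HasFDerivAt (T τ) _ X := (traceCLM (n := n)).hasFDerivAt.comp X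
      (((hd (τ 1)).mul' (hd (τ 2))).mul' (hd (τ 3)))
    rw [h1.fderiv]
    simp only [← fderiv_logDeriv ha hX']
    simp only [ContinuousLinearMap.comp_apply, traceCLM_apply, add_apply, smul_apply, smul_eq_mul,
      MulOpposite.smul_eq_mul_unop, MulOpposite.unop_op, Pi.mul_apply]
    congr 1
    noncomm_ring
  -- Closedness gives `du ∧ ω = d(u ω)`, a sum of derivatives of compactly supported functions.
  have hsum : ∀ X, wedge u a X = ∑ τ : Equiv.Perm (Fin 4), ((Equiv.Perm.sign τ : ℤ) : ℂ) *
      fderiv ℝ (V τ) X (orientedDir (τ 0)) := fun X => by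
    simp only [hderiv, mul_add, Finset.sum_add_distrib, wedge]
    have h0 : ∑ τ : Equiv.Perm (Fin 4), ((Equiv.Perm.sign τ : ℤ) : ℂ) *
        (u X * fderiv ℝ (T τ) X (orientedDir (τ 0))) = 0 := by
      by_cases hX : X ∈ tsupport u
      · rw [← mul_zero (u X : ℂ), ← hclosed X hX, Finset.mul_sum]
        exact Finset.sum_congr rfl fun τ _ => by ring
      · simp [image_eq_zero_of_notMem_tsupport hX]
    rw [h0, add_zero]
    exact Finset.sum_congr rfl fun τ _ => by rw [mul_assoc]
  simp only [hsum]
  rw [integral_finsetSum]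
  · refine Finset.sum_eq_zero fun τ _ => ?_
    rw [integral_const_mul, integral_fderiv_eq_zero (hVs τ) (hVc τ), mul_zero]
  · intro τ _
    refine Integrable.const_mul ?_ _
    exact (((hVs τ).continuous_fderiv one_ne_zero).clm_apply
      continuous_const).integrable_of_hasCompactSupport ((hVc τ).fderiv_apply ℝ _)

end Stokes

/-! ### From the sphere integral to volume integrals against a cutoff. -/

section Polar

lemma integral_polar {g : Phase → ℂ} (hg : Integrable g) :
    ∫ X, g X = ∫ r in Set.Ioi (0 : ℝ), (r : ℂ) ^ 3 *
      ∫ θ : Metric.sphere (0 : Phase) 1, g (r • (θ : Phase)) ∂(volume : Measure Phase).toSphere := by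
  have hmp := (volume : Measure Phase).measurePreserving_homeomorphUnitSphereProd
  set e := homeomorphUnitSphereProd Phase
  set G : Metric.sphere (0 : Phase) 1 × Set.Ioi (0 : ℝ) → ℂ := fun p => g ((p.2 : ℝ) • (p.1 : Phase))
  have hGe : ∀ x, G (e x) = g x := fun x => by
    have h := congrArg Subtype.val (e.symm_apply_apply x)
    simp only [e, homeomorphUnitSphereProd_symm_apply_coe] at h
    simp only [G, e, h]
  have hs : MeasurableSet ({0}ᶜ : Set Phase) := (measurableSet_singleton _).compl
  have h1 : ∫ X, g X = ∫ p, G p ∂((volume : Measure Phase).toSphere.prod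
      (Measure.volumeIoiPow (Module.finrank ℝ Phase - 1))) := by
    rw [← hmp.integral_comp e.measurableEmbedding G]
    simp only [hGe]
    rw [integral_subtype_comap hs g, restrict_compl_singleton]
  have h2 : Integrable G ((volume : Measure Phase).toSphere.prod
      (Measure.volumeIoiPow (Module.finrank ℝ Phase - 1))) := by
    rw [← hmp.integrable_comp_emb e.measurableEmbedding]
    have : (G ∘ e) = g ∘ Subtype.val := funext hGe
    rw [this, ← integrableOn_iff_comap_subtypeVal hs]
    exact hg.integrableOn
  have hfr : Module.finrank ℝ Phase - 1 = 3 := by simp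
  rw [h1, integral_prod_symm _ h2, hfr, Measure.volumeIoiPow,
    integral_withDensity_eq_integral_toReal_smul (by fun_prop) (by simp),
    integral_subtype_comap measurableSet_Ioi (fun r : ℝ => (ENNReal.ofReal (r ^ 3)).toReal •
      ∫ θ : Metric.sphere (0 : Phase) 1, g (r • (θ : Phase)) ∂(volume : Measure Phase).toSphere)]
  refine setIntegral_congr_fun measurableSet_Ioi fun r hr => ?_
  rw [ENNReal.toReal_ofReal (pow_nonneg (le_of_lt hr) 3), Complex.real_smul]
  push_cast
  rfl

end Polar

section SphereIntegral

variable {n : ℕ}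

lemma tendsto_trace {ι : Type*} {l : Filter ι} {F : ι → Mat n} {M : Mat n}
    (h : Tendsto F l (𝓝 M)) : Tendsto (fun i => (F i).trace) l (𝓝 M.trace) :=
  ((traceCLM (n := n)).continuous.tendsto M).comp h

/-- The integral of `tr (a⁻¹ da)^{∧3}` over the sphere of radius `r`. -/
noncomputable def sphereIntegral (a : Phase → Mat n) (r : ℝ) : ℂ :=
  (r : ℂ) ^ 3 * ∫ θ : Metric.sphere (0 : Phase) 1, sphereDensity a θ (r • (θ : Phase))
    ∂(volume : Measure Phase).toSphere

lemma fedosovHormander_eq (a : Phase → Mat n) (R : ℝ) :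
    fedosovHormander a R = 1 / (24 * (Real.pi : ℂ) ^ 2) * sphereIntegral a R := rfl

lemma continuousAt_sphereDensity {a : Phase → Mat n} (ha : ContDiff ℝ 2 a) {p : Phase × Phase}
    (hX : IsUnit (a p.2)) : ContinuousAt (fun p : Phase × Phase => sphereDensity a p.1 p.2) p := by
  unfold sphereDensity
  refine tendsto_finsetSum _ fun τ _ => ?_
  have hA : ∀ i, ContinuousAt (fun p : Phase × Phase => logDeriv a i p.2) p := fun i =>
    ContinuousAt.comp (g := logDeriv a i) (contDiffAt_logDeriv ha hX i).continuousAt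
      continuousAt_snd
  have h1 : ContinuousAt (fun p : Phase × Phase =>
      ((p.1 (orientedCoord (τ 0)) : ℝ) : ℂ)) p := by fun_prop
  have h2 : ContinuousAt (fun p : Phase × Phase =>
      (logDeriv a (τ 1) p.2 * logDeriv a (τ 2) p.2 * logDeriv a (τ 3) p.2).trace) p :=
    tendsto_trace (((hA _).mul (hA _)).mul (hA _))
  exact (continuousAt_const.mul h1).mul h2

/-- The radius `max r R` never enters the ball where `f` is uncontrolled, so the result is
continuous on the whole line without restricting `r`. -/
lemma continuous_integral_sphere {f : Phase → Phase → ℂ} {R : ℝ} (hR : 0 < R)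
    (hf : ∀ p : Phase × Phase, R ≤ ‖p.2‖ →
      ContinuousAt (fun p : Phase × Phase => f p.1 p.2) p) :
    Continuous fun r : ℝ => ∫ θ : Metric.sphere (0 : Phase) 1, f θ (max r R • (θ : Phase))
      ∂(volume : Measure Phase).toSphere := by
  have h2 : Continuous (Function.uncurry fun (r : ℝ) (θ : Metric.sphere (0 : Phase) 1) =>
      f θ (max r R • (θ : Phase))) := by
    refine continuous_iff_continuousAt.mpr fun p => ?_
    have h3 : Continuous fun p : ℝ × Metric.sphere (0 : Phase) 1 =>
        ((p.2 : Phase), max p.1 R • (p.2 : Phase)) := by fun_prop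
    have h5 : R ≤ ‖max p.1 R • (p.2 : Phase)‖ := by
      have h4 : ‖(p.2 : Phase)‖ = 1 := norm_eq_of_mem_sphere _
      rw [norm_smul, h4, mul_one, Real.norm_of_nonneg (hR.le.trans (le_max_right _ _))]
      exact le_max_right _ _
    exact (hf ((p.2 : Phase), max p.1 R • (p.2 : Phase)) h5).tendsto.comp (h3.tendsto p)
  have h3 := continuous_parametric_integral_of_continuous
    (μ := (volume : Measure Phase).toSphere) h2 isCompact_univ
  simpa using h3

lemma continuous_sphereIntegral {a : Phase → Mat n} (ha : ContDiff ℝ 2 a) {R : ℝ} (hR : 0 < R)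
    (hinv : InvertibleOutside a R) : Continuous fun r => sphereIntegral a (max r R) := by
  have h1 : Continuous fun r : ℝ => (((max r R : ℝ) : ℂ)) ^ 3 := by fun_prop
  exact h1.mul (continuous_integral_sphere hR fun p hp => continuousAt_sphereDensity ha (hinv _ hp))

end SphereIntegral

section Wedge

variable {n : ℕ}

lemma wedge_congr {u : Phase → ℝ} {a b : Phase → Mat n} {X : Phase} (h : a =ᶠ[𝓝 X] b) :
    wedge u a X = wedge u b X := by
  have h1 : ∀ i, logDeriv a i X = logDeriv b i X := fun i => by
    rw [logDeriv, logDeriv, h.eq_of_nhds, pderiv_congr h]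
  simp only [wedge, h1]

lemma wedge_eq_zero {u : Phase → ℝ} {a : Phase → Mat n} {X : Phase} (h : fderiv ℝ u X = 0) :
    wedge u a X = 0 := by
  simp [wedge, h]

lemma notMem_tsupport_fderiv {u : Phase → ℝ} {X : Phase} (h : u =ᶠ[𝓝 X] 1) :
    X ∉ tsupport (fderiv ℝ u) := by
  rw [notMem_tsupport_iff_eventuallyEq]
  filter_upwards [h.eventually_nhds] with Y hY
  have : u =ᶠ[𝓝 Y] fun _ => (1 : ℝ) := hY
  rw [this.fderiv_eq]
  simp

/-- At singular points of `a` the inverse has a conventional value, but there `u` is locally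
constant, so the density is locally zero. -/
lemma continuous_wedge {a : Phase → Mat n} (ha : ContDiff ℝ 2 a) {u : Phase → ℝ}
    (hu : ContDiff ℝ 1 u) (h1 : ∀ X, ¬IsUnit (a X) → u =ᶠ[𝓝 X] 1) : Continuous (wedge u a) := by
  refine continuous_iff_continuousAt.mpr fun X => ?_
  by_cases hX : IsUnit (a X)
  · refine tendsto_finsetSum _ fun τ _ => ?_
    have hA : ∀ i, ContinuousAt (logDeriv a i) X := fun i =>
      (contDiffAt_logDeriv ha hX i).continuousAt
    have h2 : ContinuousAt (fun X => ((fderiv ℝ u X (orientedDir (τ 0)) : ℝ) : ℂ)) X :=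
      (Complex.continuous_ofReal.comp ((hu.continuous_fderiv one_ne_zero).clm_apply
        continuous_const)).continuousAt
    have h3 : ContinuousAt (fun X =>
        (logDeriv a (τ 1) X * logDeriv a (τ 2) X * logDeriv a (τ 3) X).trace) X :=
      tendsto_trace (((hA _).mul (hA _)).mul (hA _))
    exact (continuousAt_const.mul h2).mul h3
  · have h2 := notMem_tsupport_iff_eventuallyEq.mp (notMem_tsupport_fderiv (h1 X hX))
    have h3 : wedge u a =ᶠ[𝓝 X] fun _ => 0 := h2.mono fun Y hY => wedge_eq_zero hY
    exact continuousAt_const.congr h3.symm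

lemma hasCompactSupport_wedge {a : Phase → Mat n} {u : Phase → ℝ} (hc : HasCompactSupport u) :
    HasCompactSupport (wedge u a) :=
  (hc.fderiv ℝ).mono' fun _ hX => subset_tsupport _ fun h => hX (wedge_eq_zero h)

lemma integrable_wedge {a : Phase → Mat n} (ha : ContDiff ℝ 2 a) {u : Phase → ℝ}
    (hu : ContDiff ℝ 1 u) (hc : HasCompactSupport u)
    (h1 : ∀ X, ¬IsUnit (a X) → u =ᶠ[𝓝 X] 1) : Integrable (wedge u a) :=
  (continuous_wedge ha hu h1).integrable_of_hasCompactSupport (hasCompactSupport_wedge hc)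

/-- The integral of `du ∧ tr (a⁻¹ da)^{∧3}` does not depend on the cutoff `u`. -/
lemma integral_wedge_congr {a : Phase → Mat n} (ha : ContDiff ℝ 2 a) {u v : Phase → ℝ}
    (hu : ContDiff ℝ 1 u) (hv : ContDiff ℝ 1 v) (huc : HasCompactSupport u)
    (hvc : HasCompactSupport v) (hu1 : ∀ X, ¬IsUnit (a X) → u =ᶠ[𝓝 X] 1)
    (hv1 : ∀ X, ¬IsUnit (a X) → v =ᶠ[𝓝 X] 1) :
    ∫ X, wedge u a X = ∫ X, wedge v a X := by
  have h := integral_wedge_eq_zero ha (hu.sub hv) (huc.sub hvc) fun X hX => by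
    by_contra hX'
    refine notMem_tsupport_iff_eventuallyEq.mpr ?_ hX
    filter_upwards [hu1 X hX', hv1 X hX'] with Y h1 h2
    simp [h1, h2]
  have h2 : ∀ X, wedge (fun Y => u Y - v Y) a X = wedge u a X - wedge v a X := fun X => by
    have h3 : fderiv ℝ (fun Y => u Y - v Y) X = fderiv ℝ u X - fderiv ℝ v X :=
      fderiv_fun_sub (hu.differentiable one_ne_zero X) (hv.differentiable one_ne_zero X)
    simp only [wedge, h3, ← Finset.sum_sub_distrib]
    refine Finset.sum_congr rfl fun τ _ => ?_
    simp only [sub_apply]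
    push_cast
    ring
  simp only [h2] at h
  rw [integral_sub (integrable_wedge ha hu huc hu1) (integrable_wedge ha hv hvc hv1)] at h
  exact sub_eq_zero.mp h

end Wedge

section RadialCutoff

variable {n : ℕ}

/-- The radial cutoff `1 - ∫₀^{|X|} η`. -/
noncomputable def radialCutoff (η : ℝ → ℝ) (X : Phase) : ℝ := 1 - ∫ t in (0 : ℝ)..‖X‖, η t

variable {η : ℝ → ℝ} {α β : ℝ}

lemma radialCutoff_of_norm_le (hs : Function.support η ⊆ Set.Ioc α β) {X : Phase}
    (hX : ‖X‖ ≤ α) : radialCutoff η X = 1 := by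
  rw [radialCutoff, intervalIntegral.integral_zero_ae, sub_zero]
  refine Eventually.of_forall fun t ht => ?_
  rw [Set.uIoc_of_le (norm_nonneg _)] at ht
  by_contra h
  exact absurd (hs h).1 (not_lt.mpr (ht.2.trans hX))

lemma radialCutoff_of_le_norm (hα : 0 ≤ α) (hs : Function.support η ⊆ Set.Ioc α β)
    (h1 : ∫ t, η t = 1) {X : Phase} (hX : β ≤ ‖X‖) : radialCutoff η X = 0 := by
  rw [radialCutoff, intervalIntegral.integral_eq_integral_of_support_subset
    (hs.trans (Set.Ioc_subset_Ioc hα hX)), h1, sub_self]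

lemma hasFDerivAt_radialCutoff (hη : Continuous η) {X : Phase} (hX : X ≠ 0) :
    HasFDerivAt (radialCutoff η) (-(η ‖X‖ • fderiv ℝ (fun Y : Phase => ‖Y‖) X)) X := by
  have h1 : HasDerivAt (fun s => ∫ t in (0 : ℝ)..s, η t) (η ‖X‖) ‖X‖ :=
    intervalIntegral.integral_hasDerivAt_right (hη.intervalIntegrable _ _)
      (hη.stronglyMeasurableAtFilter _ _) hη.continuousAt
  have h2 : DifferentiableAt ℝ (fun Y : Phase => ‖Y‖) X :=
    (contDiffAt_norm ℝ hX (n := 1)).differentiableAt one_ne_zero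
  exact (h1.comp_hasFDerivAt X h2.hasFDerivAt).const_sub 1

lemma fderiv_norm_apply {X : Phase} (hX : X ≠ 0) (v : Phase) :
    fderiv ℝ (fun Y : Phase => ‖Y‖) X v = inner ℝ X v / ‖X‖ := by
  have hX' : ‖X‖ ≠ 0 := norm_ne_zero_iff.mpr hX
  have h2 : DifferentiableAt ℝ (fun Y : Phase => ‖Y‖) X :=
    (contDiffAt_norm ℝ hX (n := 1)).differentiableAt one_ne_zero
  have h3 := (h2.hasFDerivAt.pow 2)
  have h4 : HasFDerivAt (fun Y : Phase => ‖Y‖ ^ 2) (2 • innerSL ℝ X) X :=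
    (hasStrictFDerivAt_norm_sq X).hasFDerivAt
  have h5 := DFunLike.congr_fun (h3.unique h4) v
  simp at h5
  field_simp
  linarith

lemma contDiff_radialCutoff (hη : Continuous η) (hα : 0 < α)
    (hs : Function.support η ⊆ Set.Ioc α β) : ContDiff ℝ 1 (radialCutoff η) := by
  refine contDiff_iff_contDiffAt.mpr fun X => ?_
  by_cases hX : X = 0
  · have : radialCutoff η =ᶠ[𝓝 X] fun _ => 1 := by
      have hb : Metric.ball (0 : Phase) α ∈ 𝓝 X := by
        rw [hX]; exact Metric.ball_mem_nhds _ hα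
      filter_upwards [hb] with Y hY
      exact radialCutoff_of_norm_le hs (mem_ball_zero_iff.mp hY).le
    exact contDiffAt_const.congr_of_eventuallyEq this
  · have h1 : ContDiff ℝ 1 fun s => ∫ t in (0 : ℝ)..s, η t := by
      rw [contDiff_one_iff_deriv]
      refine ⟨fun s => (intervalIntegral.integral_hasDerivAt_right (hη.intervalIntegrable _ _)
        (hη.stronglyMeasurableAtFilter _ _) hη.continuousAt).differentiableAt, ?_⟩
      have : deriv (fun s => ∫ t in (0 : ℝ)..s, η t) = η := funext fun s =>
        hη.deriv_integral _ _ _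
      rwa [this]
    exact contDiffAt_const.sub (h1.contDiffAt.comp X (contDiffAt_norm ℝ hX))

lemma hasCompactSupport_radialCutoff (hα : 0 ≤ α) (hs : Function.support η ⊆ Set.Ioc α β)
    (h1 : ∫ t, η t = 1) : HasCompactSupport (radialCutoff η) := by
  refine HasCompactSupport.of_support_subset_isCompact (isCompact_closedBall (0 : Phase) β) ?_
  intro X hX
  rw [mem_closedBall_zero_iff]
  by_contra! h
  exact hX (radialCutoff_of_le_norm hα hs h1 h.le)

/-- The gradient of the cutoff is `-η(|X|)` times the outward unit normal, so the density is a
multiple of the surface density on the sphere through `X`. -/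
lemma wedge_radialCutoff (hη : Continuous η) (a : Phase → Mat n) {X : Phase} (hX : X ≠ 0) :
    wedge (radialCutoff η) a X = -((η ‖X‖ : ℝ) * sphereDensity a (‖X‖⁻¹ • X) X) := by
  simp only [wedge, sphereDensity, (hasFDerivAt_radialCutoff hη hX).fderiv, Finset.mul_sum,
    ← Finset.sum_neg_distrib]
  refine Finset.sum_congr rfl fun τ _ => ?_
  have h : inner ℝ X (orientedDir (τ 0)) = X (orientedCoord (τ 0)) := by
    simp [orientedDir, EuclideanSpace.inner_single_right]
  simp only [neg_apply, smul_apply, fderiv_norm_apply hX, h, PiLp.smul_apply, smul_eq_mul]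
  push_cast
  ring

/-- Polar coordinates turn the volume integral into the average, with weight `η`, of the integrals
over the spheres of radius `r`. The Jacobian `r³` is part of `sphereIntegral`. -/
lemma integral_wedge_radialCutoff (hη : Continuous η) (hα : 0 < α)
    (hs : Function.support η ⊆ Set.Ioc α β) (hint : ∫ t, η t = 1) {a : Phase → Mat n}
    (ha : ContDiff ℝ 2 a) {R : ℝ} (hR : R < α) (hinv : InvertibleOutside a R) :
    -∫ X, wedge (radialCutoff η) a X = ∫ r, (η r : ℂ) * sphereIntegral a r := by
  have hi : Integrable (wedge (radialCutoff η) a) := by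
    refine integrable_wedge ha (contDiff_radialCutoff hη hα hs)
      (hasCompactSupport_radialCutoff hα.le hs hint) fun X hX => ?_
    have hX' : ‖X‖ < α := by
      by_contra! h
      exact hX (hinv X (hR.le.trans h))
    filter_upwards [Metric.isOpen_ball.mem_nhds (mem_ball_zero_iff.mpr hX')] with Y hY
    exact radialCutoff_of_norm_le hs (mem_ball_zero_iff.mp hY).le
  rw [integral_polar hi, ← integral_neg,
    ← setIntegral_eq_integral_of_forall_compl_eq_zero (s := Set.Ioi (0 : ℝ))
      (f := fun r => (η r : ℂ) * sphereIntegral a r)]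
  · refine setIntegral_congr_fun measurableSet_Ioi fun r hr => ?_
    have hr' : (0 : ℝ) < r := hr
    have h1 : ∀ θ : Metric.sphere (0 : Phase) 1, wedge (radialCutoff η) a (r • (θ : Phase)) =
        -((η r : ℂ) * sphereDensity a θ (r • (θ : Phase))) := fun θ => by
      have h4 : ‖(θ : Phase)‖ = 1 := by simp
      have h2 : ‖r • (θ : Phase)‖ = r := by
        rw [norm_smul, h4, mul_one, Real.norm_of_nonneg hr'.le]
      have h3 : r • (θ : Phase) ≠ 0 := by
        rw [← norm_ne_zero_iff, h2]; exact hr'.ne'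
      rw [wedge_radialCutoff hη a h3, h2, smul_smul, inv_mul_cancel₀ hr'.ne', one_smul]
    simp only [h1, sphereIntegral]
    rw [integral_neg, integral_const_mul]
    ring
  · intro r hr
    have : η r = 0 := by
      by_contra h
      exact hr (hα.trans (hs h).1)
    simp [this]

/-- The Fedosov–Hörmander invariant as a volume integral against a cutoff function. -/
theorem integral_wedge_eq_fedosovHormander {a : Phase → Mat n} (ha : ContDiff ℝ 2 a) {R : ℝ}
    (hR : 0 < R) (hinv : InvertibleOutside a R) {u : Phase → ℝ} (hu : ContDiff ℝ 1 u)
    (hc : HasCompactSupport u) (h1 : ∀ X, ¬IsUnit (a X) → u =ᶠ[𝓝 X] 1) :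
    24 * (Real.pi : ℂ) ^ 2 * fedosovHormander a R = -∫ X, wedge u a X := by
  have hpi : (Real.pi : ℂ) ≠ 0 := by exact_mod_cast Real.pi_ne_zero
  have h0 : 24 * (Real.pi : ℂ) ^ 2 * fedosovHormander a R = sphereIntegral a R := by
    rw [fedosovHormander_eq]; field_simp
  rw [h0]
  -- By continuity of `S`, averages against bumps concentrated near `R` approximate `S R`. The
  -- volume integral does not depend on the bump, so it equals `S R`.
  set S : ℝ → ℂ := fun r => sphereIntegral a (max r R) with hS
  have hSc : Continuous S := continuous_sphereIntegral ha hR hinv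
  have hSR : S R = sphereIntegral a R := by simp [hS]
  rw [← hSR, ← sub_eq_zero, ← norm_le_zero_iff]
  refine le_of_forall_pos_le_add fun ε hε => ?_
  rw [zero_add]
  obtain ⟨δ, hδ, hball⟩ := Metric.continuousAt_iff.mp (hSc.continuousAt (x := R)) ε hε
  -- The bump sits strictly to the right of `R` and within `δ` of it. The resulting radial cutoff is
  -- then 1 on a neighbourhood of the closed ball of radius `R`, hence near every singular point.
  let b : ContDiffBump (R + δ / 2) := ⟨δ / 8, δ / 4, by linarith, by linarith⟩
  set η : ℝ → ℝ := b.normed volume with hη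
  have hηc : Continuous η := b.continuous_normed
  have hint : ∫ t, η t = 1 := b.integral_normed
  have hnn : ∀ t, 0 ≤ η t := b.nonneg_normed
  have hs : Function.support η ⊆ Set.Ioc (R + δ / 5) (R + δ) := by
    intro t ht
    rw [hη, b.support_normed_eq, Metric.mem_ball, Real.dist_eq, abs_lt] at ht
    have h2 : b.rOut = δ / 4 := rfl
    rw [h2] at ht
    constructor <;> linarith [ht.1, ht.2]
  have hα : 0 < R + δ / 5 := by positivity
  have h2 : -∫ X, wedge u a X = ∫ r, (η r : ℂ) * sphereIntegral a r := by
    rw [← integral_wedge_radialCutoff hηc hα hs hint ha (by linarith : R < R + δ / 5) hinv]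
    congr 1
    refine integral_wedge_congr ha hu (contDiff_radialCutoff hηc hα hs) hc
      (hasCompactSupport_radialCutoff hα.le hs hint) h1 fun X hX => ?_
    have hX' : ‖X‖ < R + δ / 5 := by
      by_contra! h
      exact hX (hinv X (by linarith))
    filter_upwards [Metric.isOpen_ball.mem_nhds (mem_ball_zero_iff.mpr hX')] with Y hY
    exact radialCutoff_of_norm_le hs (mem_ball_zero_iff.mp hY).le
  have h3 : ∫ r, (η r : ℂ) * sphereIntegral a r = ∫ r, (η r : ℂ) * S r := by
    refine integral_congr_ae (Eventually.of_forall fun r => ?_)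
    by_cases hr : η r = 0
    · simp [hr]
    · have := (hs hr).1
      simp only [hS]
      rw [max_eq_left (by linarith)]
  have hηs : HasCompactSupport η := b.hasCompactSupport_normed
  have hcη : Continuous fun r => (η r : ℂ) := Complex.continuous_ofReal.comp hηc
  have hi : ∀ f : ℝ → ℂ, Continuous f → Integrable fun r => (η r : ℂ) * f r := fun f hf => by
    refine (hcη.mul hf).integrable_of_hasCompactSupport ?_
    exact HasCompactSupport.mul_right (hηs.comp_left Complex.ofReal_zero)
  have h4 : S R = ∫ r, (η r : ℂ) * S R := by
    rw [integral_mul_const, integral_complex_ofReal, hint]; simp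
  rw [h2, h3]
  conv_lhs => rw [h4]
  rw [← integral_sub (hi _ continuous_const) (hi _ hSc)]
  have h5 : ∀ r, ‖(η r : ℂ) * S R - (η r : ℂ) * S r‖ ≤ η r * ε := fun r => by
    rw [← mul_sub, norm_mul, Complex.norm_real, Real.norm_of_nonneg (hnn r)]
    by_cases hr : η r = 0
    · simp [hr]
    · refine mul_le_mul_of_nonneg_left ?_ (hnn r)
      have hr' : r ∈ Metric.ball (R + δ / 2) (δ / 4) := by
        have : r ∈ Function.support η := hr
        rwa [hη, b.support_normed_eq] at this
      rw [Metric.mem_ball, Real.dist_eq, abs_lt] at hr'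
      have h6 := hball (x := r) (by rw [Real.dist_eq, abs_lt]; constructor <;> linarith [hr'.1, hr'.2])
      rw [dist_comm, dist_eq_norm] at h6
      exact h6.le
  refine (norm_integral_le_of_norm_le ((hηc.integrable_of_hasCompactSupport hηs).mul_const ε)
    (Eventually.of_forall h5)).trans (le_of_eq ?_)
  rw [integral_mul_const, hint, one_mul]

end RadialCutoff

/-! ### Freezing the symbol at `x = 0`. -/

section Gluing

variable {n : ℕ}

/-- The phase space point with first coordinate replaced by `x`. -/
noncomputable def setX (x : ℝ) (X : Phase) : Phase := X + (x - X 0) • EuclideanSpace.single 0 1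

@[simp] lemma setX_zero (x : ℝ) (X : Phase) : setX x X 0 = x := by simp [setX]
@[simp] lemma setX_one (x : ℝ) (X : Phase) : setX x X 1 = X 1 := by simp [setX]
@[simp] lemma setX_two (x : ℝ) (X : Phase) : setX x X 2 = X 2 := by simp [setX]
@[simp] lemma setX_three (x : ℝ) (X : Phase) : setX x X 3 = X 3 := by simp [setX]

@[simp] lemma setX_self (X : Phase) : setX (X 0) X = X := by simp [setX]

@[simp] lemma mom_setX (x : ℝ) (X : Phase) : mom (setX x X) = mom X := by
  simp [mom]

lemma setX_add (x t : ℝ) (X : Phase) :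
    setX x (X + t • EuclideanSpace.single 0 1) = setX x X := by
  simp only [setX, add_assoc, ← add_smul]
  congr 2
  simp
  ring

lemma contDiff_setX {k : WithTop ℕ∞} {f : Phase → ℝ} (hf : ContDiff ℝ k f) :
    ContDiff ℝ k fun X => setX (f X) X := by
  unfold setX
  have h0 : ContDiff ℝ k fun X : Phase => X 0 :=
    (EuclideanSpace.proj (𝕜 := ℝ) (0 : Fin 4)).contDiff
  exact contDiff_id.add ((hf.sub h0).smul contDiff_const)

lemma domainWallSymbol_eq (σ : Phase → Mat n) (X : Phase) :
    domainWallSymbol σ X = shift (σ X) (X 0) := rfl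

lemma contDiff_domainWallSymbol {k : WithTop ℕ∞} {σ : Phase → Mat n} (h : ContDiff ℝ k σ) :
    ContDiff ℝ k (domainWallSymbol σ) := by
  unfold domainWallSymbol
  have h0 : ContDiff ℝ k fun X : Phase => ((X 0 : ℝ) : ℂ) :=
    Complex.ofRealCLM.contDiff.comp (EuclideanSpace.proj (𝕜 := ℝ) (0 : Fin 4)).contDiff
  exact h.sub ((contDiff_const.mul h0).smul contDiff_const)

/-- Points at which `σ - ix` is invertible, whatever the dependence of `σ` on `x`. -/
def IsGood (σ : Phase → Mat n) (X : Phase) : Prop := X 0 ≠ 0 ∨ ∀ x, IsUnit (σ (setX x X))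

lemma isUnit_domainWallSymbol_of_isGood {σ : Phase → Mat n} (hσ : ∀ X, (σ X).IsHermitian)
    {X : Phase} (h : IsGood σ X) (x : ℝ) :
    IsUnit (shift (σ (setX x X)) (X 0)) := by
  by_cases h0 : X 0 = 0
  · have h1 := h.resolve_left (not_not.mpr h0) x
    obtain ⟨c, hc, hcX⟩ := exists_coercive_of_isUnit h1
    exact isUnit_shift hcX (hσ _) hc _
  · exact isUnit_shift_of_ne_zero (hσ _) h0

/-- The invariant of `σ - ix` only depends on the values of `σ` at `x = 0`. -/
theorem fedosovHormander_eq_freeze {σ : Phase → Mat n} (hs : ContDiff ℝ 2 σ)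
    (hσ : ∀ X, (σ X).IsHermitian) {K : ℝ} (hK : ∀ X, ¬IsGood σ X → ‖X‖ < K) {R : ℝ} (hR : 0 < R)
    (hinv : InvertibleOutside (domainWallSymbol σ) R) {u : Phase → ℝ} (hu : ContDiff ℝ 1 u)
    (hc : HasCompactSupport u) (hu1 : ∀ X, ¬IsGood σ X → u =ᶠ[𝓝 X] 1) :
    24 * (Real.pi : ℂ) ^ 2 * fedosovHormander (domainWallSymbol σ) R =
      -∫ X, wedge u (domainWallSymbol fun X => σ (setX 0 X)) X := by
  obtain ⟨R₀, hR₀⟩ := hc.isCompact.isBounded.subset_ball (0 : Phase)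
  set R₁ : ℝ := max (max R₀ K) 1 with hR₁
  have hR₁0 : 0 < R₁ := zero_lt_one.trans_le (le_max_right _ _)
  have hKR : K ≤ R₁ := (le_max_right _ _).trans (le_max_left _ _)
  have hsupp : ∀ X, R₁ ≤ ‖X‖ → X ∉ tsupport u := fun X hX hX' => by
    have h1 := hR₀ hX'
    rw [mem_ball_zero_iff] at h1
    have h2 : R₀ ≤ R₁ := (le_max_left _ _).trans (le_max_left _ _)
    linarith
  -- The deformation lives in `‖X‖ < R₁ + 1`. The cutoff `v` is constant out to `R₁ + 2`, so `dv`
  -- only sees the original symbol, while `du` lives where the symbol is completely frozen. The two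
  -- cutoffs are compared for the interpolated symbol `σ'`.
  let g : ContDiffBump (0 : Phase) := ⟨R₁, R₁ + 1, hR₁0, by linarith⟩
  let v : ContDiffBump (0 : Phase) := ⟨R₁ + 2, R₁ + 3, by linarith, by linarith⟩
  have hg1 : ∀ X, ‖X‖ ≤ R₁ → g X = 1 := fun X hX =>
    g.one_of_mem_closedBall (mem_closedBall_zero_iff.mpr hX)
  have hg0 : ∀ X, R₁ + 1 ≤ ‖X‖ → g X = 0 := fun X hX =>
    g.zero_of_le_dist (by rw [dist_zero_right]; exact hX)
  have hv1 : ∀ X, ‖X‖ < R₁ + 2 → (v : Phase → ℝ) =ᶠ[𝓝 X] 1 := fun X hX => by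
    filter_upwards [Metric.isOpen_ball.mem_nhds (mem_ball_zero_iff.mpr hX)] with Y hY
    exact v.one_of_mem_closedBall (mem_closedBall_zero_iff.mpr (mem_ball_zero_iff.mp hY).le)
  set σ' : Phase → Mat n := fun X => σ (setX (X 0 * (1 - g X)) X) with hσ'
  have hsσ' : ContDiff ℝ 2 σ' := by
    refine hs.comp (contDiff_setX ?_)
    have h0 : ContDiff ℝ 2 fun X : Phase => X 0 :=
      (EuclideanSpace.proj (𝕜 := ℝ) (0 : Fin 4)).contDiff
    exact h0.mul (contDiff_const.sub g.contDiff)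
  have ha := contDiff_domainWallSymbol hs
  have ha' := contDiff_domainWallSymbol hsσ'
  have hbad : ∀ X, ¬IsUnit (domainWallSymbol σ X) → ¬IsGood σ X := fun X h1 h2 => h1 (by
    have := isUnit_domainWallSymbol_of_isGood hσ h2 (X 0)
    rwa [setX_self] at this)
  -- `IsGood` quantifies over all values of the frozen coordinate, so the interpolation creates no
  -- new singular points.
  have hbad' : ∀ X, ¬IsUnit (domainWallSymbol σ' X) → ¬IsGood σ X := fun X h1 h2 =>
    h1 (isUnit_domainWallSymbol_of_isGood hσ h2 _)
  have e1 := integral_wedge_eq_fedosovHormander ha hR hinv v.contDiff v.hasCompactSupport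
    fun X hX => hv1 X (by linarith [hK X (hbad X hX)])
  have e2 : ∫ X, wedge v (domainWallSymbol σ) X = ∫ X, wedge v (domainWallSymbol σ') X := by
    refine integral_congr_ae (Eventually.of_forall fun X => ?_)
    by_cases hX : ‖X‖ < R₁ + 2
    · have h1 : fderiv ℝ v X = 0 := by
        rw [(hv1 X hX).fderiv_eq]
        exact fderiv_const_apply (1 : ℝ)
      simp only [wedge_eq_zero h1]
    · refine wedge_congr ?_
      have h1 : {Y : Phase | R₁ + 1 < ‖Y‖} ∈ 𝓝 X :=
        (isOpen_lt continuous_const continuous_norm).mem_nhds (by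
          change R₁ + 1 < ‖X‖
          linarith)
      filter_upwards [h1] with Y hY
      have hY' : R₁ + 1 < ‖Y‖ := hY
      rw [domainWallSymbol_eq, domainWallSymbol_eq, hσ']
      simp only
      rw [hg0 Y hY'.le, sub_zero, mul_one, setX_self]
  have e3 : ∫ X, wedge v (domainWallSymbol σ') X = ∫ X, wedge u (domainWallSymbol σ') X :=
    integral_wedge_congr ha' v.contDiff hu v.hasCompactSupport hc
      (fun X hX => hv1 X (by linarith [hK X (hbad' X hX)])) fun X hX => hu1 X (hbad' X hX)
  have e4 : ∫ X, wedge u (domainWallSymbol σ') X =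
      ∫ X, wedge u (domainWallSymbol fun X => σ (setX 0 X)) X := by
    refine integral_congr_ae (Eventually.of_forall fun X => ?_)
    by_cases hX : ‖X‖ < R₁
    · refine wedge_congr ?_
      filter_upwards [Metric.isOpen_ball.mem_nhds (mem_ball_zero_iff.mpr hX)] with Y hY
      rw [domainWallSymbol_eq, domainWallSymbol_eq, hσ']
      simp only
      rw [hg1 Y (mem_ball_zero_iff.mp hY).le, sub_self, mul_zero]
    · have h1 : fderiv ℝ u X = 0 := by
        rw [(notMem_tsupport_iff_eventuallyEq.mp (hsupp X (not_lt.mp hX))).fderiv_eq]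
        exact fderiv_const_apply (0 : ℝ)
      simp only [wedge_eq_zero h1]
  rw [e1, e2, e3, e4]

end Gluing

/-! ### Dominated convergence and measurability on phase space. -/

section Slab

lemma integrable_slab (r : ℝ) : Integrable fun X : Phase =>
    (1 + X 0 ^ 2)⁻¹ * (Set.Icc (-r) r).indicator 1 (X 1) * (Set.Icc (-r) r).indicator 1 (X 2) *
      (Set.Icc (-r) r).indicator (1 : ℝ → ℝ) (X 3) := by
  have hI : Integrable ((Set.Icc (-r) r).indicator (1 : ℝ → ℝ)) := by
    rw [integrable_indicator_iff measurableSet_Icc]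
    exact integrableOn_const (by simp)
  have h := Integrable.fintype_prod (μ := fun _ : Fin 4 => (volume : Measure ℝ))
    (f := ![fun x : ℝ => (1 + x ^ 2)⁻¹, (Set.Icc (-r) r).indicator 1,
      (Set.Icc (-r) r).indicator 1, (Set.Icc (-r) r).indicator (1 : ℝ → ℝ)]) (by
        intro i
        fin_cases i
        · exact integrable_inv_one_add_sq
        · exact hI
        · exact hI
        · exact hI)
  have h2 := (EuclideanSpace.volume_preserving_symm_measurableEquiv_toLp (Fin 4)).integrable_comp_emb
    (MeasurableEquiv.measurableEmbedding _) |>.mpr h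
  refine h2.congr (Eventually.of_forall fun X => ?_)
  simp [Fin.prod_univ_four]

/-- Dominated convergence on phase space for functions that decay quadratically in `x` and are
supported in a fixed compact set of the other variables. -/
lemma tendsto_integral_slab {ι : Type*} {l : Filter ι} [l.IsCountablyGenerated]
    {F : ι → Phase → ℂ} {f : Phase → ℂ} {C r : ℝ}
    (hm : ∀ᶠ i in l, AEStronglyMeasurable (F i))
    (hb : ∀ᶠ i in l, ∀ X, ‖F i X‖ ≤ C * (1 + X 0 ^ 2)⁻¹)
    (hs : ∀ᶠ i in l, ∀ X, F i X ≠ 0 → |X 1| ≤ r ∧ |X 2| ≤ r ∧ |X 3| ≤ r)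
    (hl : ∀ X, Tendsto (fun i => F i X) l (𝓝 (f X))) :
    Tendsto (fun i => ∫ X, F i X) l (𝓝 (∫ X, f X)) := by
  refine tendsto_integral_filter_of_dominated_convergence _ hm ?_
    ((integrable_slab r).const_mul C) (Eventually.of_forall hl)
  filter_upwards [hb, hs] with i hbi hsi
  refine Eventually.of_forall fun X => ?_
  by_cases h : F i X = 0
  · rw [h, norm_zero]
    have hC : 0 ≤ C * (1 + X 0 ^ 2)⁻¹ := (norm_nonneg _).trans (hbi X)
    have h0 : ∀ y, 0 ≤ (Set.Icc (-r) r).indicator (1 : ℝ → ℝ) y := fun y =>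
      Set.indicator_nonneg (fun _ _ => zero_le_one) y
    calc (0 : ℝ) ≤ (C * (1 + X 0 ^ 2)⁻¹) * (Set.Icc (-r) r).indicator (1 : ℝ → ℝ) (X 1) *
          (Set.Icc (-r) r).indicator (1 : ℝ → ℝ) (X 2) *
          (Set.Icc (-r) r).indicator (1 : ℝ → ℝ) (X 3) :=
        mul_nonneg (mul_nonneg (mul_nonneg hC (h0 _)) (h0 _)) (h0 _)
      _ = _ := by ring
  · obtain ⟨h1, h2, h3⟩ := hsi X h
    rw [Set.indicator_of_mem (Set.mem_Icc.mpr (abs_le.mp h1)), Set.indicator_of_mem (Set.mem_Icc.mpr (abs_le.mp h2)),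
      Set.indicator_of_mem (Set.mem_Icc.mpr (abs_le.mp h3))]
    simpa using hbi X

lemma integrable_of_slab {f : Phase → ℂ} {C r : ℝ} (hm : AEStronglyMeasurable f)
    (hb : ∀ X, ‖f X‖ ≤ C * (1 + X 0 ^ 2)⁻¹)
    (hs : ∀ X, f X ≠ 0 → |X 1| ≤ r ∧ |X 2| ≤ r ∧ |X 3| ≤ r) : Integrable f := by
  refine ((integrable_slab r).const_mul C).mono' hm (Eventually.of_forall fun X => ?_)
  by_cases h : f X = 0
  · rw [h, norm_zero]
    have hC : 0 ≤ C * (1 + X 0 ^ 2)⁻¹ := (norm_nonneg _).trans (hb X)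
    have h0 : ∀ y, 0 ≤ (Set.Icc (-r) r).indicator (1 : ℝ → ℝ) y := fun y =>
      Set.indicator_nonneg (fun _ _ => zero_le_one) y
    calc (0 : ℝ) ≤ (C * (1 + X 0 ^ 2)⁻¹) * (Set.Icc (-r) r).indicator (1 : ℝ → ℝ) (X 1) *
          (Set.Icc (-r) r).indicator (1 : ℝ → ℝ) (X 2) *
          (Set.Icc (-r) r).indicator (1 : ℝ → ℝ) (X 3) :=
        mul_nonneg (mul_nonneg (mul_nonneg hC (h0 _)) (h0 _)) (h0 _)
      _ = _ := by ring
  · obtain ⟨h1, h2, h3⟩ := hs X h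
    rw [Set.indicator_of_mem (Set.mem_Icc.mpr (abs_le.mp h1)), Set.indicator_of_mem (Set.mem_Icc.mpr (abs_le.mp h2)),
      Set.indicator_of_mem (Set.mem_Icc.mpr (abs_le.mp h3))]
    simpa using hb X

end Slab

section Measurability

variable {n : ℕ} {T : Type*}

/-- The formula `det⁻¹ • adj` is measurable everywhere, also across singular matrices where the
inverse is discontinuous. -/
lemma stronglyMeasurable_matrix_inv [TopologicalSpace T] [MeasurableSpace T]
    [OpensMeasurableSpace T] {A : T → Mat n} (hA : Continuous A) :
    StronglyMeasurable fun t => (A t)⁻¹ := by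
  simp only [Matrix.inv_def, Ring.inverse_eq_inv']
  have h1 : Continuous fun t => (A t).det := hA.matrix_det
  have h2 : Continuous fun t => (A t).adjugate := hA.matrix_adjugate
  exact (h1.measurable.inv).stronglyMeasurable.smul h2.stronglyMeasurable

lemma stronglyMeasurable_trace [MeasurableSpace T] {A : T → Mat n} (hA : StronglyMeasurable A) :
    StronglyMeasurable fun t => (A t).trace :=
  (traceCLM (n := n)).continuous.comp_stronglyMeasurable hA

lemma stronglyMeasurable_wForm [TopologicalSpace T] [MeasurableSpace T] [OpensMeasurableSpace T]
    [SecondCountableTopology T] {A B C : T → Mat n} {x : T → ℝ} (hA : Continuous A)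
    (hB : Continuous B) (hC : Continuous C) (hx : Continuous x) :
    StronglyMeasurable fun t => wForm (A t) (B t) (C t) (x t) := by
  have hR := stronglyMeasurable_matrix_inv (continuous_shift.comp (hA.prodMk hx))
  have hB' := hB.stronglyMeasurable
  have hC' := hC.stronglyMeasurable
  exact (stronglyMeasurable_trace ((((hR.mul hR).mul hB').mul hR).mul hC')).sub
    (stronglyMeasurable_trace ((((hR.mul hR).mul hC').mul hR).mul hB'))

end Measurability

/-! ### Explicit form of the density for a symbol independent of `x`. -/

section PermExpansion

/-- The 24 permutations are enumerated by peeling off one image at a time with `decomposeFin`. Signs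
and values are then finite checks. -/
lemma sum_perm_four (f : Fin 4 → Fin 4 → Fin 4 → Fin 4 → ℂ) :
    ∑ τ : Equiv.Perm (Fin 4), ((Equiv.Perm.sign τ : ℤ) : ℂ) * f (τ 0) (τ 1) (τ 2) (τ 3) =
      (f 0 1 2 3 - f 0 1 3 2 - f 0 2 1 3 + f 0 2 3 1 + f 0 3 1 2 - f 0 3 2 1) -
      (f 1 0 2 3 - f 1 0 3 2 - f 1 2 0 3 + f 1 2 3 0 + f 1 3 0 2 - f 1 3 2 0) +
      (f 2 0 1 3 - f 2 0 3 1 - f 2 1 0 3 + f 2 1 3 0 + f 2 3 0 1 - f 2 3 1 0) -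
      (f 3 0 1 2 - f 3 0 2 1 - f 3 1 0 2 + f 3 1 2 0 + f 3 2 0 1 - f 3 2 1 0) := by
  have hsum : ∀ g : Equiv.Perm (Fin 4) → ℂ, ∑ τ, g τ = ∑ p : Fin 4, ∑ q : Fin 3, ∑ r : Fin 2,
      g (Equiv.Perm.decomposeFin.symm (p, Equiv.Perm.decomposeFin.symm (q,
        Equiv.Perm.decomposeFin.symm (r, 1)))) := fun g => by
    rw [← Equiv.Perm.decomposeFin.symm.sum_comp, Fintype.sum_prod_type]
    refine Finset.sum_congr rfl fun p _ => ?_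
    rw [← Equiv.Perm.decomposeFin.symm.sum_comp, Fintype.sum_prod_type]
    refine Finset.sum_congr rfl fun q _ => ?_
    rw [← Equiv.Perm.decomposeFin.symm.sum_comp, Fintype.sum_prod_type]
    refine Finset.sum_congr rfl fun r _ => ?_
    rw [Fintype.sum_unique]
    rfl
  rw [hsum]
  set e : Fin 4 → Fin 3 → Fin 2 → Equiv.Perm (Fin 4) := fun p q r =>
    Equiv.Perm.decomposeFin.symm (p, Equiv.Perm.decomposeFin.symm (q,
      Equiv.Perm.decomposeFin.symm (r, 1)))
  have hs : ∀ p q r, Equiv.Perm.sign (e p q r) =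
      (if p = 0 then 1 else -1) * ((if q = 0 then 1 else -1) * (if r = 0 then 1 else -1)) := by
    decide
  have h0 : ∀ p q r, e p q r 0 = p := by decide
  have h1 : ∀ p q r, e p q r 1 = Equiv.swap 0 p q.succ := by decide
  have h2 : ∀ p q r, e p q r 2 = Equiv.swap 0 p (Equiv.swap 0 q r.succ).succ := by decide
  have h3 : ∀ p q r, e p q r 3 =
      Equiv.swap 0 p (Equiv.swap 0 q (Equiv.swap 0 r 1).succ).succ := by decide
  simp only [Fin.sum_univ_four, Fin.sum_univ_three, Fin.sum_univ_two]
  simp only [e] at hs h0 h1 h2 h3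
  simp only [hs, h0, h1, h2, h3]
  simp [Equiv.swap_apply_def]
  ring

end PermExpansion

section WedgeExpansion

variable {n : ℕ}

/-- `wForm` evaluated on the partial derivatives of `s` along the coordinates `i` and `j`. -/
noncomputable def wDeriv (s : Phase → Mat n) (i j : Fin 4) (X : Phase) : ℂ :=
  wForm (s X) (pderiv i s X) (pderiv j s X) (X 0)

/-- The density obtained from `du ∧ tr (a⁻¹ da)^{∧3}` for `a = s - ix` when neither `u` nor `s`
depends on `x`. -/
noncomputable def omega (s : Phase → Mat n) (u : Phase → ℝ) (X : Phase) : ℂ :=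
  ((fderiv ℝ u X (EuclideanSpace.single 2 1) : ℝ) : ℂ) * wDeriv s 3 1 X +
    ((fderiv ℝ u X (EuclideanSpace.single 3 1) : ℝ) : ℂ) * wDeriv s 1 2 X +
    ((fderiv ℝ u X (EuclideanSpace.single 1 1) : ℝ) : ℂ) * wDeriv s 2 3 X

/-- The remaining part of the density, in which `u` is differentiated along `x`. -/
noncomputable def faceTerm (s : Phase → Mat n) (X : Phase) : ℂ :=
  ((shift (s X) (X 0))⁻¹ * pderiv 2 s X * ((shift (s X) (X 0))⁻¹ * pderiv 3 s X) *
      ((shift (s X) (X 0))⁻¹ * pderiv 1 s X)).trace -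
    ((shift (s X) (X 0))⁻¹ * pderiv 2 s X * ((shift (s X) (X 0))⁻¹ * pderiv 1 s X) *
      ((shift (s X) (X 0))⁻¹ * pderiv 3 s X)).trace

lemma pderiv_domainWallSymbol {s : Phase → Mat n} {X : Phase} (hs : DifferentiableAt ℝ s X)
    (i : Fin 4) : pderiv i (domainWallSymbol s) X =
      pderiv i s X - if i = 0 then Complex.I • (1 : Mat n) else 0 := by
  have h0 : HasFDerivAt (fun X : Phase => (Complex.I * ((X 0 : ℝ) : ℂ)) • (1 : Mat n))
      ((((ContinuousLinearMap.mul ℝ ℂ Complex.I).comp (Complex.ofRealCLM.comp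
        (EuclideanSpace.proj (𝕜 := ℝ) (0 : Fin 4)))).smulRight (1 : Mat n))) X := by
    have h1 : HasFDerivAt (fun X : Phase => Complex.I * ((X 0 : ℝ) : ℂ))
        ((ContinuousLinearMap.mul ℝ ℂ Complex.I).comp (Complex.ofRealCLM.comp
        (EuclideanSpace.proj (𝕜 := ℝ) (0 : Fin 4)))) X :=
      ((ContinuousLinearMap.mul ℝ ℂ Complex.I).comp (Complex.ofRealCLM.comp
        (EuclideanSpace.proj (𝕜 := ℝ) (0 : Fin 4)))).hasFDerivAt
    exact h1.smul_const 1
  have h2 : HasFDerivAt (domainWallSymbol s) _ X := hs.hasFDerivAt.sub h0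
  rw [pderiv_eq_fderiv h2.differentiableAt, pderiv_eq_fderiv hs, h2.fderiv]
  simp only [sub_apply, ContinuousLinearMap.smulRight_apply, ContinuousLinearMap.comp_apply]
  congr 1
  by_cases h : i = 0
  · subst h; simp
  · simp [h, Ne.symm h]

/-- As `s` does not depend on `x`, the factor along `x` is `-i` times the resolvent. It occurs
exactly once in each term where `u` is differentiated along another coordinate. Cyclicity of the
trace merges these terms in threes, whence the factors 3. -/
lemma neg_wedge_domainWallSymbol {s : Phase → Mat n} {u : Phase → ℝ} {X : Phase}
    (hs : DifferentiableAt ℝ s X) (h0 : pderiv 0 s X = 0) :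
    -wedge u (domainWallSymbol s) X = 3 * Complex.I * omega s u X +
      3 * ((fderiv ℝ u X (EuclideanSpace.single 0 1) : ℝ) : ℂ) * faceTerm s X := by
  set A : Fin 4 → Mat n := fun i => logDeriv (domainWallSymbol s) i X with hA
  set R := (shift (s X) (X 0))⁻¹ with hR
  have a0 : A 0 = R * pderiv 2 s X := by
    simp only [hA, logDeriv, pderiv_domainWallSymbol hs, orientedCoord]
    simp [hR, domainWallSymbol_eq]
  have a1 : A 1 = -(Complex.I • R) := by
    simp only [hA, logDeriv, pderiv_domainWallSymbol hs, orientedCoord]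
    simp [hR, domainWallSymbol_eq, h0]
  have a2 : A 2 = R * pderiv 3 s X := by
    simp only [hA, logDeriv, pderiv_domainWallSymbol hs, orientedCoord]
    simp [hR, domainWallSymbol_eq]
  have a3 : A 3 = R * pderiv 1 s X := by
    simp only [hA, logDeriv, pderiv_domainWallSymbol hs, orientedCoord]
    simp [hR, domainWallSymbol_eq]
  have hcyc : ∀ i j k, (A i * A j * A k).trace = (A k * A i * A j).trace := fun i j k => by
    rw [Matrix.trace_mul_comm, mul_assoc]
  have hw : ∀ i j, (A 1 * (R * pderiv i s X) * (R * pderiv j s X)).trace -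
      (A 1 * (R * pderiv j s X) * (R * pderiv i s X)).trace = -(Complex.I * wDeriv s i j X) := by
    intro i j
    simp only [a1, wDeriv, wForm, ← hR, neg_mul, Matrix.smul_mul, Matrix.trace_neg,
      Matrix.trace_smul, smul_eq_mul, mul_assoc]
    ring
  have h31 := hw 3 1
  have h12 := hw 1 2
  have h23 := hw 2 3
  rw [← a2, ← a3] at h31
  rw [← a3, ← a0] at h12
  rw [← a0, ← a2] at h23
  have hface : faceTerm s X = (A 0 * A 2 * A 3).trace - (A 0 * A 3 * A 2).trace := by
    simp only [faceTerm, a0, a2, a3, hR]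
  have hsum := sum_perm_four fun i j k l =>
    ((fderiv ℝ u X (orientedDir i) : ℝ) : ℂ) * (A j * A k * A l).trace
  have hwedge : wedge u (domainWallSymbol s) X = ∑ τ : Equiv.Perm (Fin 4),
      ((Equiv.Perm.sign τ : ℤ) : ℂ) * (((fderiv ℝ u X (orientedDir (τ 0)) : ℝ) : ℂ) *
        (A (τ 1) * A (τ 2) * A (τ 3)).trace) :=
    Finset.sum_congr rfl fun τ _ => by rw [mul_assoc]
  rw [hwedge, hsum, hface, omega]
  have d0 : orientedDir 0 = EuclideanSpace.single 2 1 := rfl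
  have d1 : orientedDir 1 = EuclideanSpace.single 0 1 := rfl
  have d2 : orientedDir 2 = EuclideanSpace.single 3 1 := rfl
  have d3 : orientedDir 3 = EuclideanSpace.single 1 1 := rfl
  rw [d0, d1, d2, d3]
  -- Each trace is rotated until the factor `A 1` along `x` stands in front, or `A 0` if there is no
  -- `A 1`.
  have c231 : (A 2 * A 3 * A 1).trace = (A 1 * A 2 * A 3).trace := hcyc 2 3 1
  have c312 : (A 3 * A 1 * A 2).trace = (A 1 * A 2 * A 3).trace := (hcyc 3 1 2).trans (hcyc 2 3 1)
  have c213 : (A 2 * A 1 * A 3).trace = (A 1 * A 3 * A 2).trace := (hcyc 2 1 3).trans (hcyc 3 2 1)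
  have c321 : (A 3 * A 2 * A 1).trace = (A 1 * A 3 * A 2).trace := hcyc 3 2 1
  have c301 : (A 3 * A 0 * A 1).trace = (A 1 * A 3 * A 0).trace := hcyc 3 0 1
  have c013 : (A 0 * A 1 * A 3).trace = (A 1 * A 3 * A 0).trace := (hcyc 0 1 3).trans (hcyc 3 0 1)
  have c031 : (A 0 * A 3 * A 1).trace = (A 1 * A 0 * A 3).trace := hcyc 0 3 1
  have c310 : (A 3 * A 1 * A 0).trace = (A 1 * A 0 * A 3).trace := (hcyc 3 1 0).trans (hcyc 0 3 1)
  have c021 : (A 0 * A 2 * A 1).trace = (A 1 * A 0 * A 2).trace := hcyc 0 2 1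
  have c210 : (A 2 * A 1 * A 0).trace = (A 1 * A 0 * A 2).trace := (hcyc 2 1 0).trans (hcyc 0 2 1)
  have c012 : (A 0 * A 1 * A 2).trace = (A 1 * A 2 * A 0).trace := (hcyc 0 1 2).trans (hcyc 2 0 1)
  have c201 : (A 2 * A 0 * A 1).trace = (A 1 * A 2 * A 0).trace := hcyc 2 0 1
  have c230 : (A 2 * A 3 * A 0).trace = (A 0 * A 2 * A 3).trace := hcyc 2 3 0
  have c302 : (A 3 * A 0 * A 2).trace = (A 0 * A 2 * A 3).trace := (hcyc 3 0 2).trans (hcyc 2 3 0)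
  have c203 : (A 2 * A 0 * A 3).trace = (A 0 * A 3 * A 2).trace := (hcyc 2 0 3).trans (hcyc 3 2 0)
  have c320 : (A 3 * A 2 * A 0).trace = (A 0 * A 3 * A 2).trace := hcyc 3 2 0
  rw [c231, c312, c213, c321, c301, c013, c031, c310, c021, c210, c012, c201, c230, c302,
    c203, c320]
  linear_combination 3 * ((fderiv ℝ u X (EuclideanSpace.single 2 1) : ℝ) : ℂ) * (-h31) +
    3 * ((fderiv ℝ u X (EuclideanSpace.single 3 1) : ℝ) : ℂ) * (-h12) +
    3 * ((fderiv ℝ u X (EuclideanSpace.single 1 1) : ℝ) : ℂ) * (-h23)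

end WedgeExpansion

/-! ### Functions on phase space independent of `x`. -/

section XInvariance

variable {n : ℕ} {F : Type*}

/-- Independence of the first coordinate `x`. -/
def XInvariant (f : Phase → F) : Prop :=
  ∀ (X : Phase) (t : ℝ), f (X + t • EuclideanSpace.single 0 1) = f X

lemma XInvariant.setX {f : Phase → F} (h : XInvariant f) (x : ℝ) (X : Phase) :
    f (setX x X) = f X := h X _

lemma xInvariant_comp_setX (f : Phase → F) (x : ℝ) : XInvariant fun X => f (setX x X) :=
  fun X t => by simp only [setX_add]

lemma XInvariant.fderiv [NormedAddCommGroup F] [NormedSpace ℝ F] {f : Phase → F}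
    (h : XInvariant f) : XInvariant (fderiv ℝ f) := fun X t => by
  have h1 : (fun Y => f (Y + t • EuclideanSpace.single 0 1)) = f := funext fun Y => h Y t
  rw [← fderiv_comp_add_right, h1]

lemma XInvariant.fderiv_single_zero [NormedAddCommGroup F] [NormedSpace ℝ F] {f : Phase → F}
    (h : XInvariant f) {X : Phase} (hd : DifferentiableAt ℝ f X) :
    _root_.fderiv ℝ f X (EuclideanSpace.single 0 1) = 0 := by
  have h1 : HasDerivAt (fun t : ℝ => X + t • (EuclideanSpace.single 0 1 : Phase))
      (EuclideanSpace.single 0 1) 0 := by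
    simpa using ((hasDerivAt_id (0 : ℝ)).smul_const
      (EuclideanSpace.single 0 1 : Phase)).const_add X
  have h2 : HasFDerivAt f (_root_.fderiv ℝ f X)
      (X + (0 : ℝ) • (EuclideanSpace.single 0 1 : Phase)) := by
    simpa using hd.hasFDerivAt
  have h3 := h2.comp_hasDerivAt (0 : ℝ) h1
  have h4 : (f ∘ fun t : ℝ => X + t • (EuclideanSpace.single 0 1 : Phase)) = fun _ => f X :=
    funext fun t => h X t
  rw [h4] at h3
  exact h3.unique (hasDerivAt_const _ _)

lemma XInvariant.pderiv {s : Phase → Mat n} (h : XInvariant s) (hs : Differentiable ℝ s)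
    (i : Fin 4) : XInvariant (pderiv i s) := fun X t => by
  rw [pderiv_eq_fderiv (hs _), pderiv_eq_fderiv (hs _), h.fderiv]

lemma XInvariant.pderiv_zero {s : Phase → Mat n} (h : XInvariant s) {X : Phase}
    (hs : DifferentiableAt ℝ s X) : BulkDifference.pderiv 0 s X = 0 := by
  rw [pderiv_eq_fderiv hs, h.fderiv_single_zero hs]

lemma norm_setX_zero_le {r : ℝ} {X : Phase} (h1 : |X 1| ≤ r) (h2 : |X 2| ≤ r) (h3 : |X 3| ≤ r) :
    ‖BulkDifference.setX 0 X‖ ≤ 2 * r := by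
  have hr : 0 ≤ r := (abs_nonneg _).trans h1
  rw [EuclideanSpace.norm_eq, Fin.sum_univ_four]
  refine Real.sqrt_le_iff.mpr ⟨by positivity, ?_⟩
  simp only [setX_zero, setX_one, setX_two, setX_three, Real.norm_eq_abs]
  have h1' := pow_le_pow_left₀ (abs_nonneg _) h1 2
  have h2' := pow_le_pow_left₀ (abs_nonneg _) h2 2
  have h3' := pow_le_pow_left₀ (abs_nonneg _) h3 2
  rw [abs_zero]
  nlinarith

/-- The slice `x = 0` over a bounded set of the other coordinates is bounded, and invariance
transports its bound to the whole unbounded slab. -/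
lemma XInvariant.exists_bound [NormedAddCommGroup F] {f : Phase → F} (h : XInvariant f)
    (hf : Continuous f) (r : ℝ) :
    ∃ C, 0 ≤ C ∧ ∀ X : Phase, |X 1| ≤ r → |X 2| ≤ r → |X 3| ≤ r → ‖f X‖ ≤ C := by
  obtain ⟨C, hC⟩ := (isCompact_closedBall (0 : Phase) (2 * r)).exists_bound_of_continuousOn
    hf.continuousOn
  refine ⟨max C 0, le_max_right _ _, fun X h1 h2 h3 => ?_⟩
  rw [← h.setX 0]
  exact (hC _ (mem_closedBall_zero_iff.mpr (norm_setX_zero_le h1 h2 h3))).trans (le_max_left _ _)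

lemma XInvariant.exists_pderiv_bound {s : Phase → Mat n} (h : XInvariant s)
    (hs : ContDiff ℝ 2 s) (r : ℝ) : ∃ M, 0 ≤ M ∧
      ∀ X : Phase, |X 1| ≤ r → |X 2| ≤ r → |X 3| ≤ r → ∀ i, ‖BulkDifference.pderiv i s X‖ ≤ M := by
  choose M hM0 hM using fun i => (h.pderiv (hs.differentiable two_ne_zero) i).exists_bound
    (continuous_pderiv (hs.of_le (by norm_num)) i) r
  refine ⟨∑ i, M i, Finset.sum_nonneg fun i _ => hM0 i, fun X h1 h2 h3 i =>
    (hM i X h1 h2 h3).trans ?_⟩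
  exact Finset.single_le_sum (fun i _ => hM0 i) (Finset.mem_univ i)

end XInvariance

/-! ### Stretching the cutoff to infinity in the direction of `x`. -/

section LongCylinder

variable {n : ℕ}

lemma inv_sq_add_sq_le {c : ℝ} (hc : 0 < c) (x : ℝ) :
    (c ^ 2 + x ^ 2)⁻¹ ≤ (1 + (c ^ 2)⁻¹) * (1 + x ^ 2)⁻¹ := by
  rw [← div_eq_mul_inv, le_div_iff₀ (by positivity), inv_mul_le_iff₀ (by positivity)]
  have : (c ^ 2)⁻¹ * c ^ 2 = 1 := inv_mul_cancel₀ (by positivity)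
  have h2 : 0 ≤ (c ^ 2)⁻¹ * x ^ 2 := by positivity
  nlinarith [sq_nonneg c, sq_nonneg x]

lemma norm_trace_three_le (R A B C : Mat n) {M : ℝ} (hA : ‖A‖ ≤ M) (hB : ‖B‖ ≤ M)
    (hC : ‖C‖ ≤ M) : ‖(R * A * (R * B) * (R * C)).trace‖ ≤ n * (‖R‖ ^ 3 * M ^ 3) := by
  have hM : 0 ≤ M := (norm_nonneg _).trans hA
  have h : ∀ D : Mat n, ‖D‖ ≤ M → ‖R * D‖ ≤ ‖R‖ * M := fun D hD =>
    (norm_mul_le _ _).trans (by gcongr)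
  refine (norm_trace_le _).trans (mul_le_mul_of_nonneg_left ?_ (Nat.cast_nonneg _))
  calc ‖R * A * (R * B) * (R * C)‖ ≤ ‖R * A‖ * ‖R * B‖ * ‖R * C‖ :=
        (norm_mul_le _ _).trans (by gcongr; exact norm_mul_le _ _)
    _ ≤ (‖R‖ * M) * (‖R‖ * M) * (‖R‖ * M) := by
        gcongr
        · exact h _ hA
        · exact h _ hB
        · exact h _ hC
    _ = ‖R‖ ^ 3 * M ^ 3 := by ring

/-- Here `s` may be singular, so only the bound `1/|x|` is available for the resolvent. For `|x| ≥
1` its cube is at most `2/(1 + x²)`. -/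
lemma norm_faceTerm_le {s : Phase → Mat n} (hσ : ∀ X, (s X).IsHermitian) {X : Phase} {M : ℝ}
    (h1 : ‖pderiv 1 s X‖ ≤ M) (h2 : ‖pderiv 2 s X‖ ≤ M) (h3 : ‖pderiv 3 s X‖ ≤ M)
    (hx : 1 ≤ |X 0|) : ‖faceTerm s X‖ ≤ 4 * n * M ^ 3 * (1 + X 0 ^ 2)⁻¹ := by
  have hM : 0 ≤ M := (norm_nonneg _).trans h1
  have hR := norm_inv_shift_le_of_ne_zero (hσ X) (x := X 0)
    (abs_pos.mp (zero_lt_one.trans_le hx))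
  have hR3 : ‖(shift (s X) (X 0))⁻¹‖ ^ 3 ≤ 2 * (1 + X 0 ^ 2)⁻¹ := by
    refine (pow_le_pow_left₀ (norm_nonneg _) hR 3).trans ?_
    rw [inv_pow, ← div_eq_mul_inv, le_div_iff₀ (by positivity), inv_mul_le_iff₀ (by positivity)]
    have : X 0 ^ 2 = |X 0| ^ 2 := (sq_abs _).symm
    rw [this]
    nlinarith [mul_nonneg (sub_nonneg.mpr hx) (sub_nonneg.mpr hx), sq_nonneg (|X 0|),
      mul_nonneg (sub_nonneg.mpr hx) (sq_nonneg (|X 0|))]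
  refine (norm_sub_le _ _).trans ?_
  refine (add_le_add (norm_trace_three_le _ _ _ _ h2 h3 h1)
    (norm_trace_three_le _ _ _ _ h2 h1 h3)).trans ?_
  calc _ = (2 * n * M ^ 3) * ‖(shift (s X) (X 0))⁻¹‖ ^ 3 := by ring
    _ ≤ (2 * n * M ^ 3) * (2 * (1 + X 0 ^ 2)⁻¹) := by gcongr
    _ = _ := by ring

lemma norm_wDeriv_le {s : Phase → Mat n} (hσ : ∀ X, (s X).IsHermitian) {X : Phase} {c M : ℝ}
    (hc : 0 < c) (h : Coercive c (s X)) {i j : Fin 4} (hi : ‖pderiv i s X‖ ≤ M)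
    (hj : ‖pderiv j s X‖ ≤ M) :
    ‖wDeriv s i j X‖ ≤ 2 * n * M ^ 2 * c⁻¹ * (1 + (c ^ 2)⁻¹) * (1 + X 0 ^ 2)⁻¹ := by
  have hM : 0 ≤ M := (norm_nonneg _).trans hi
  refine (norm_wForm_le_of_coercive h (hσ X) hc _ _ _).trans ?_
  calc _ ≤ 2 * n * M * M * (c⁻¹ * ((1 + (c ^ 2)⁻¹) * (1 + X 0 ^ 2)⁻¹)) := by
        gcongr
        exact inv_sq_add_sq_le hc _
    _ = _ := by ring

lemma norm_omega_term_le {s : Phase → Mat n} (hσ : ∀ X, (s X).IsHermitian) {u : Phase → ℝ}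
    {X : Phase} {c M D : ℝ} (hc : 0 < c) (h : fderiv ℝ u X ≠ 0 → Coercive c (s X))
    (hM : ∀ i, ‖pderiv i s X‖ ≤ M) (hD : ‖fderiv ℝ u X‖ ≤ D) (k i j : Fin 4) :
    ‖((fderiv ℝ u X (EuclideanSpace.single k 1) : ℝ) : ℂ) * wDeriv s i j X‖ ≤
      D * (2 * n * M ^ 2 * c⁻¹ * (1 + (c ^ 2)⁻¹)) * (1 + X 0 ^ 2)⁻¹ := by
  have hM0 : 0 ≤ M := (norm_nonneg _).trans (hM 0)
  have hD0 : 0 ≤ D := (norm_nonneg _).trans hD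
  by_cases h0 : fderiv ℝ u X = 0
  · simp only [h0, zero_apply, Complex.ofReal_zero, zero_mul, norm_zero]
    positivity
  rw [norm_mul, Complex.norm_real, mul_assoc]
  refine mul_le_mul ?_ (norm_wDeriv_le hσ hc (h h0) (hM i) (hM j)) (norm_nonneg _) hD0
  refine ((fderiv ℝ u X).le_opNorm _).trans ?_
  simpa using hD

lemma norm_omega_le {s : Phase → Mat n} (hσ : ∀ X, (s X).IsHermitian) {u : Phase → ℝ} {X : Phase}
    {c M D : ℝ} (hc : 0 < c) (h : fderiv ℝ u X ≠ 0 → Coercive c (s X))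
    (hM : ∀ i, ‖pderiv i s X‖ ≤ M) (hD : ‖fderiv ℝ u X‖ ≤ D) :
    ‖omega s u X‖ ≤ 3 * D * (2 * n * M ^ 2 * c⁻¹ * (1 + (c ^ 2)⁻¹)) * (1 + X 0 ^ 2)⁻¹ := by
  have hterm := norm_omega_term_le hσ hc h hM hD
  refine ((norm_add_le _ _).trans (add_le_add ((norm_add_le _ _).trans
    (add_le_add (hterm _ _ _) (hterm _ _ _))) (hterm _ _ _))).trans (le_of_eq ?_)
  ring

lemma norm_le_of_support {u : Phase → ℝ} {r : ℝ}
    (hr : ∀ X, u X ≠ 0 → |X 1| ≤ r ∧ |X 2| ≤ r ∧ |X 3| ≤ r) {X : Phase}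
    (hX : X ∈ tsupport u) : |X 1| ≤ r ∧ |X 2| ≤ r ∧ |X 3| ≤ r := by
  have hcl : IsClosed {X : Phase | |X 1| ≤ r ∧ |X 2| ≤ r ∧ |X 3| ≤ r} := by
    have h : ∀ i, Continuous fun X : Phase => |X i| := fun i =>
      (EuclideanSpace.proj (𝕜 := ℝ) i).continuous.abs
    exact (isClosed_le (h 1) continuous_const).inter
      ((isClosed_le (h 2) continuous_const).inter (isClosed_le (h 3) continuous_const))
  exact closure_minimal (fun Y hY => hr Y hY) hcl hX

lemma fderiv_eq_zero_of_notMem {u : Phase → ℝ} {X : Phase} (hX : X ∉ tsupport u) :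
    fderiv ℝ u X = 0 := by
  rw [(notMem_tsupport_iff_eventuallyEq.mp hX).fderiv_eq]
  exact fderiv_const_apply (0 : ℝ)

/-- Cutting off in `x` at larger and larger distance, only the lateral part of the boundary
contributes. -/
theorem eq_integral_omega {s : Phase → Mat n} (hs : ContDiff ℝ 2 s)
    (hσ : ∀ X, (s X).IsHermitian) (hsx : XInvariant s) {ψ : Phase → ℝ} (hψ : ContDiff ℝ 1 ψ)
    (hψx : XInvariant ψ) {r : ℝ} (hr : ∀ X, ψ X ≠ 0 → |X 1| ≤ r ∧ |X 2| ≤ r ∧ |X 3| ≤ r)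
    {c : ℝ} (hc : 0 < c) (hco : ∀ X, fderiv ℝ ψ X ≠ 0 → Coercive c (s X))
    {Bad : Phase → Prop} (hB0 : ∀ X, Bad X → X 0 = 0) (hBψ : ∀ X, Bad X → ψ =ᶠ[𝓝 X] 1)
    (hBu : ∀ X, ¬IsUnit (domainWallSymbol s X) → Bad X) {F : ℂ}
    (hF : ∀ u : Phase → ℝ, ContDiff ℝ 1 u → HasCompactSupport u → (∀ X, Bad X → u =ᶠ[𝓝 X] 1) →
      F = -∫ X, wedge u (domainWallSymbol s) X) :
    F = 3 * Complex.I * ∫ X, omega s ψ X := by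
  have hsd : Differentiable ℝ s := hs.differentiable two_ne_zero
  let φ : ContDiffBump (0 : ℝ) := ⟨1, 2, one_pos, one_lt_two⟩
  have hφc : ContDiff ℝ 1 φ := φ.contDiff
  have h0c : ContDiff ℝ 1 fun X : Phase => X 0 := (EuclideanSpace.proj (𝕜 := ℝ) (0 : Fin 4)).contDiff
  -- For every `M > 0` this is an admissible cutoff, since the bad points have `x = 0`.
  set u : ℝ → Phase → ℝ := fun M X => φ (X 0 / M) * ψ X with hu
  have huc : ∀ M, ContDiff ℝ 1 (u M) := fun M =>
    (hφc.comp (h0c.div_const M)).mul hψ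
  have hone : ∀ M : ℝ, 0 < M → ∀ X : Phase, |X 0| < M → u M =ᶠ[𝓝 X] ψ := fun M hM X hX => by
    have h1 : {Y : Phase | |Y 0| < M} ∈ 𝓝 X :=
      (isOpen_lt h0c.continuous.abs continuous_const).mem_nhds hX
    filter_upwards [h1] with Y hY
    have hY' : |Y 0| < M := hY
    have h2 : φ (Y 0 / M) = 1 := by
      refine φ.one_of_mem_closedBall ?_
      rw [mem_closedBall_zero_iff, Real.norm_eq_abs, abs_div, abs_of_pos hM]
      exact (div_lt_one hM).mpr hY' |>.le
    simp [hu, h2]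
  have husupp : ∀ M : ℝ, 0 < M → HasCompactSupport (u M) := fun M hM => by
    refine HasCompactSupport.of_support_subset_isCompact
      (isCompact_closedBall (0 : Phase) (2 * r + 2 * M)) fun X hX => ?_
    obtain ⟨h1, h2, h3⟩ := hr X (right_ne_zero_of_mul hX)
    have h4 : X 0 / M ∈ Function.support φ := left_ne_zero_of_mul hX
    rw [φ.support_eq, mem_ball_zero_iff, Real.norm_eq_abs, abs_div, abs_of_pos hM,
      div_lt_iff₀ hM] at h4
    have h5 : X = setX 0 X + X 0 • EuclideanSpace.single 0 1 := by
      simp [setX]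
    rw [mem_closedBall_zero_iff, h5]
    refine (norm_add_le _ _).trans (add_le_add (norm_setX_zero_le h1 h2 h3) ?_)
    rw [norm_smul]
    simpa using h4.le
  have huB : ∀ M : ℝ, 0 < M → ∀ X, Bad X → u M =ᶠ[𝓝 X] 1 := fun M hM X hX =>
    (hone M hM X (by rw [hB0 X hX, abs_zero]; exact hM)).trans (hBψ X hX)
  obtain ⟨D, hD0, hD⟩ := hψx.fderiv.exists_bound (hψ.continuous_fderiv one_ne_zero) r
  obtain ⟨D', hD'0, hD'⟩ := hψx.exists_bound hψ.continuous r
  obtain ⟨B, hBnn, hB⟩ := hsx.exists_pderiv_bound hs r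
  obtain ⟨E, hE⟩ : ∃ E, ∀ t : ℝ, ‖deriv φ t‖ ≤ E :=
    (hφc.continuous_deriv le_rfl).bounded_above_of_compact_support
      φ.hasCompactSupport.deriv
  have hE0 : 0 ≤ E := (norm_nonneg _).trans (hE 0)
  have hderiv : ∀ M X, fderiv ℝ (u M) X = φ (X 0 / M) • fderiv ℝ ψ X +
      (ψ X * (deriv φ (X 0 / M) / M)) • EuclideanSpace.proj (𝕜 := ℝ) (0 : Fin 4) := fun M X => by
    have h1 : HasFDerivAt (fun X : Phase => X 0 / M) (M⁻¹ • EuclideanSpace.proj (𝕜 := ℝ) (0 : Fin 4))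
        X := by
      have := (EuclideanSpace.proj (𝕜 := ℝ) (0 : Fin 4)).hasFDerivAt (x := X) |>.mul_const M⁻¹
      simpa [div_eq_mul_inv] using this
    have h2 := (hφc.differentiable one_ne_zero (X 0 / M)).hasDerivAt.comp_hasFDerivAt X h1
    have h3 : HasFDerivAt (u M) _ X := h2.mul (hψ.differentiable one_ne_zero X).hasFDerivAt
    rw [h3.fderiv]
    ext v
    simp [div_eq_mul_inv]
    ring
  have hform : ∀ M X, -wedge (u M) (domainWallSymbol s) X =
      3 * Complex.I * (φ (X 0 / M) * omega s ψ X) +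
        3 * ((ψ X * (deriv φ (X 0 / M) / M) : ℝ) : ℂ) * faceTerm s X := fun M X => by
    rw [neg_wedge_domainWallSymbol (hsd X) (hsx.pderiv_zero (hsd X))]
    have h0 := hψx.fderiv_single_zero (hψ.differentiable one_ne_zero X)
    simp only [omega, hderiv, add_apply, smul_apply, h0, smul_eq_mul]
    simp
    ring
  have hlim : Tendsto (fun M : ℝ => ∫ X, -wedge (u M) (domainWallSymbol s) X) atTop
      (𝓝 (∫ X, 3 * Complex.I * omega s ψ X)) := by
    refine tendsto_integral_slab
      (C := 3 * (3 * D * (2 * n * B ^ 2 * c⁻¹ * (1 + (c ^ 2)⁻¹))) + 3 * (D' * E) * (4 * n * B ^ 3))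
      (r := r) ?_ ?_ ?_ ?_
    · filter_upwards [eventually_gt_atTop 0] with M hM
      exact (integrable_wedge (contDiff_domainWallSymbol hs) (huc M) (husupp M hM)
        fun X hX => huB M hM X (hBu X hX)).neg.aestronglyMeasurable
    · filter_upwards [eventually_ge_atTop 1] with M hM X
      by_cases hX : X ∈ tsupport ψ
      · obtain ⟨h1, h2, h3⟩ := norm_le_of_support hr hX
        rw [hform, add_mul]
        refine (norm_add_le _ _).trans (add_le_add ?_ ?_)
        · have h4 := norm_omega_le hσ hc (hco X) (hB X h1 h2 h3) (hD X h1 h2 h3)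
          have h5 : ‖((φ (X 0 / M) : ℝ) : ℂ)‖ ≤ 1 := by
            rw [Complex.norm_real, Real.norm_of_nonneg φ.nonneg]
            exact φ.le_one
          rw [norm_mul, norm_mul, norm_mul, Complex.norm_I, mul_one]
          have h6 : ‖(3 : ℂ)‖ = 3 := by simp
          rw [h6, mul_assoc 3 (3 * D * _)]
          refine mul_le_mul_of_nonneg_left ?_ (by norm_num)
          exact (mul_le_of_le_one_left (norm_nonneg _) h5).trans h4
        · by_cases h7 : deriv φ (X 0 / M) = 0
          · rw [h7]
            simp only [zero_div, mul_zero, Complex.ofReal_zero, zero_mul, norm_zero]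
            positivity
          -- The derivative of `φ(x/M)` vanishes for `|x| < M`, and `M ≥ 1`, so the face term is
          -- only estimated away from possible singularities.
          · have h8 : 1 ≤ |X 0| := by
              by_contra! h9
              apply h7
              have h10 : (φ : ℝ → ℝ) =ᶠ[𝓝 (X 0 / M)] fun _ => 1 := by
                have hMpos : 0 < M := zero_lt_one.trans_le hM
                have h11 : X 0 / M ∈ Metric.ball (0 : ℝ) 1 := by
                  rw [mem_ball_zero_iff, Real.norm_eq_abs, abs_div, abs_of_pos hMpos,
                    div_lt_one hMpos]
                  linarith
                filter_upwards [Metric.isOpen_ball.mem_nhds h11] with t ht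
                exact φ.one_of_mem_closedBall (Metric.ball_subset_closedBall ht)
              rw [h10.deriv_eq]
              simp
            have h9 := norm_faceTerm_le hσ (hB X h1 h2 h3 1) (hB X h1 h2 h3 2) (hB X h1 h2 h3 3) h8
            rw [norm_mul, norm_mul, Complex.norm_real, norm_mul, norm_div, mul_assoc (3 * (D' * E))]
            have h6 : ‖(3 : ℂ)‖ = 3 := by simp
            have h10 : ‖deriv φ (X 0 / M)‖ / ‖M‖ ≤ E := by
              refine (div_le_self (norm_nonneg _) ?_).trans (hE _)
              rw [Real.norm_of_nonneg (by linarith)]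
              exact hM
            rw [h6]
            have h11 : ‖ψ X‖ * (‖deriv φ (X 0 / M)‖ / ‖M‖) ≤ D' * E :=
              mul_le_mul (hD' X h1 h2 h3) h10 (by positivity) hD'0
            exact mul_le_mul (mul_le_mul_of_nonneg_left h11 (by norm_num)) h9 (norm_nonneg _)
              (by positivity)
      · have h1 : ψ X = 0 := image_eq_zero_of_notMem_tsupport hX
        have h2 : omega s ψ X = 0 := by simp [omega, fderiv_eq_zero_of_notMem hX]
        rw [hform, h1, h2]
        simp only [zero_mul, mul_zero, Complex.ofReal_zero, add_zero, norm_zero]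
        positivity
    · refine Eventually.of_forall fun M X hX => ?_
      by_contra h
      have h1 : X ∉ tsupport ψ := fun h2 => h (norm_le_of_support hr h2)
      have h2 : ψ X = 0 := image_eq_zero_of_notMem_tsupport h1
      have h3 : omega s ψ X = 0 := by simp [omega, fderiv_eq_zero_of_notMem h1]
      exact hX (by rw [hform, h2, h3]; simp)
    -- At a fixed point the cutoff agrees with `ψ` near `X` as soon as `M` exceeds `|x|`, so the
    -- face term disappears.
    · intro X
      refine tendsto_const_nhds.congr' ?_
      filter_upwards [eventually_gt_atTop (max |X 0| 0)] with M hM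
      have h1 := hone M ((le_max_right _ _).trans_lt hM) X ((le_max_left _ _).trans_lt hM)
      have h2 : wedge (u M) (domainWallSymbol s) X = wedge ψ (domainWallSymbol s) X := by
        simp only [wedge, h1.fderiv_eq]
      rw [h2, neg_wedge_domainWallSymbol (hsd X) (hsx.pderiv_zero (hsd X)),
        hψx.fderiv_single_zero (hψ.differentiable one_ne_zero X)]
      simp
  have hconst : Tendsto (fun M : ℝ => ∫ X, -wedge (u M) (domainWallSymbol s) X) atTop (𝓝 F) := by
    refine tendsto_const_nhds.congr' ?_
    filter_upwards [eventually_gt_atTop 0] with M hM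
    rw [integral_neg]
    exact hF (u M) (huc M) (husupp M hM) (huB M hM)
  rw [tendsto_nhds_unique hconst hlim, integral_const_mul]

end LongCylinder

/-! ### Linear changes of variables and splitting of coordinates. -/

section Coordinates

/-- Multiplication of the coordinates by the entries of `D`. -/
noncomputable def diagMap (D : Fin 4 → ℝ) (X : Phase) : Phase := WithLp.toLp 2 fun i => D i * X i

@[simp] lemma diagMap_apply (D : Fin 4 → ℝ) (X : Phase) (i : Fin 4) : diagMap D X i = D i * X i :=
  rfl

lemma continuous_diagMap (D : Fin 4 → ℝ) : Continuous (diagMap D) := by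
  unfold diagMap
  fun_prop

lemma integral_diagMap {D : Fin 4 → ℝ} (hD : ∏ i, D i ≠ 0) (f : Phase → ℂ) :
    ∫ X, f X = ((|∏ i, D i| : ℝ) : ℂ) * ∫ X, f (diagMap D X) := by
  have hmp := EuclideanSpace.volume_preserving_symm_measurableEquiv_toLp (Fin 4)
  have h1 : ∀ g : Phase → ℂ, ∫ X, g X = ∫ v : Fin 4 → ℝ, g (WithLp.toLp 2 v) := fun g => by
    rw [← hmp.integral_comp (MeasurableEquiv.measurableEmbedding _)
      (fun v : Fin 4 → ℝ => g (WithLp.toLp 2 v))]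
    rfl
  rw [h1, h1]
  have hdet : (Matrix.diagonal D).det ≠ 0 := by rwa [Matrix.det_diagonal]
  have h2 := Real.smul_map_diagonal_volume_pi hdet
  have hemb : MeasurableEmbedding (Matrix.toLin' (Matrix.diagonal D)) := by
    have hc : IsClosedEmbedding (Matrix.toLin' (Matrix.diagonal D)) := by
      refine LinearMap.isClosedEmbedding_of_injective ?_
      rw [LinearMap.ker_eq_bot, Matrix.toLin'_apply']
      exact Matrix.mulVec_injective_iff_isUnit.mpr
        ((Matrix.isUnit_iff_isUnit_det _).mpr (isUnit_iff_ne_zero.mpr hdet))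
    exact hc.measurableEmbedding
  conv_lhs => rw [← h2]
  rw [integral_smul_measure, hemb.integral_map, ENNReal.toReal_ofReal (abs_nonneg _),
    Matrix.det_diagonal, Complex.real_smul]
  congr 1
  refine integral_congr_ae (Eventually.of_forall fun v => ?_)
  have : Matrix.toLin' (Matrix.diagonal D) v = fun i => D i * v i := by
    ext i
    simp [Matrix.mulVec_diagonal]
  simp only [this]
  rfl

/-- The coordinates `(y, (k, x))` of phase space. -/
noncomputable def splitCoord : Phase ≃ᵐ ℝ × (Momentum × ℝ) :=
  (MeasurableEquiv.toLp 2 (Fin 4 → ℝ)).symm.trans <|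
    (MeasurableEquiv.piFinSuccAbove (fun _ => ℝ) 1).trans <|
      (MeasurableEquiv.refl ℝ).prodCongr <|
        (MeasurableEquiv.piFinSuccAbove (fun _ => ℝ) 0).trans <|
          ((MeasurableEquiv.refl ℝ).prodCongr (MeasurableEquiv.toLp 2 (Fin 2 → ℝ))).trans
            MeasurableEquiv.prodComm

lemma splitCoord_apply (X : Phase) : splitCoord X = (X 1, (mom X, X 0)) := by
  refine Prod.ext rfl (Prod.ext ?_ rfl)
  ext i
  fin_cases i <;> rfl

lemma measurePreserving_splitCoord : MeasurePreserving splitCoord := by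
  have h1 := EuclideanSpace.volume_preserving_symm_measurableEquiv_toLp (Fin 4)
  have h2 := volume_preserving_piFinSuccAbove (fun _ : Fin 4 => ℝ) 1
  have h3 := volume_preserving_piFinSuccAbove (fun _ : Fin 3 => ℝ) 0
  have h4 := (EuclideanSpace.volume_preserving_symm_measurableEquiv_toLp (Fin 2)).symm
  have h5 : MeasurePreserving (Prod.swap : ℝ × Momentum → Momentum × ℝ) :=
    Measure.measurePreserving_swap
  have h6 := h5.comp (((MeasurePreserving.id (volume : Measure ℝ)).prod h4).comp h3)
  exact ((MeasurePreserving.id (volume : Measure ℝ)).prod h6).comp (h2.comp h1)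

lemma integral_split (f : ℝ → ℂ) (g : Momentum × ℝ → ℂ) :
    ∫ X : Phase, f (X 1) * g (mom X, X 0) = (∫ y, f y) * ∫ p, g p := by
  rw [← integral_prod_mul]
  rw [← Measure.volume_eq_prod, ← measurePreserving_splitCoord.integral_comp
    splitCoord.measurableEmbedding]
  simp only [splitCoord_apply]

end Coordinates

/-! ### Scaling, reflection and the vanishing of the lateral contribution. -/

section Cutoff

variable {n : ℕ}

/-- The projection `X ↦ (ξ, ζ)` as a continuous linear map. -/
noncomputable def momCLM : Phase →L[ℝ] Momentum :=
  (EuclideanSpace.equiv (Fin 2) ℝ).symm.toContinuousLinearMap.comp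
    (ContinuousLinearMap.pi ![EuclideanSpace.proj (𝕜 := ℝ) (2 : Fin 4),
      EuclideanSpace.proj (𝕜 := ℝ) (3 : Fin 4)])

lemma momCLM_apply (X : Phase) : momCLM X = mom X := by
  ext i
  fin_cases i <;> rfl

lemma coe_momCLM : (momCLM : Phase → Momentum) = mom := funext momCLM_apply

lemma contDiff_mom {k : WithTop ℕ∞} : ContDiff ℝ k mom := coe_momCLM ▸ momCLM.contDiff

lemma continuous_mom : Continuous mom := coe_momCLM ▸ momCLM.continuous

@[simp] lemma mom_zero (X : Phase) : mom X 0 = X 2 := rfl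
@[simp] lemma mom_one (X : Phase) : mom X 1 = X 3 := rfl

lemma abs_apply_le_norm (k : Momentum) (i : Fin 2) : |k i| ≤ ‖k‖ := PiLp.norm_apply_le k i

lemma contDiff_coord {k : WithTop ℕ∞} (i : Fin 4) : ContDiff ℝ k fun X : Phase => X i :=
  (EuclideanSpace.proj (𝕜 := ℝ) i).contDiff

/-- The scaling `(x, y, ξ, ζ) ↦ (ρᵐ x, y, ρ ξ, ρ ζ)`. -/
noncomputable def scaleMap (m ρ : ℝ) : Phase → Phase := diagMap ![ρ ^ m, 1, ρ, ρ]

/-- The reflection `(x, y, ξ, ζ) ↦ (-x, y, -ξ, -ζ)`. -/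
noncomputable def reflect : Phase → Phase := diagMap ![-1, 1, -1, -1]

@[simp] lemma reflect_zero (X : Phase) : reflect X 0 = -X 0 := by simp [reflect]
@[simp] lemma reflect_one (X : Phase) : reflect X 1 = X 1 := by simp [reflect]
@[simp] lemma mom_reflect (X : Phase) : mom (reflect X) = -mom X := by
  ext i
  fin_cases i <;> simp [reflect, mom]

@[simp] lemma scaleMap_zero (m ρ : ℝ) (X : Phase) : scaleMap m ρ X 0 = ρ ^ m * X 0 := by
  simp [scaleMap]
@[simp] lemma scaleMap_one (m ρ : ℝ) (X : Phase) : scaleMap m ρ X 1 = X 1 := by simp [scaleMap]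
@[simp] lemma mom_scaleMap (m ρ : ℝ) (X : Phase) : mom (scaleMap m ρ X) = ρ • mom X := by
  ext i
  fin_cases i <;> simp [scaleMap, mom]

/-- The lateral contribution vanishes in the limit if the rescaled density is asymptotically
even. -/
lemma tendsto_integral_lateral {m r C ρ₀ : ℝ} {w : Phase → ℂ} (hw : StronglyMeasurable w)
    (hb : ∀ ρ, ρ₀ ≤ ρ → ∀ Y, 1 ≤ ‖mom Y‖ → ‖mom Y‖ ≤ 2 →
      ‖((ρ ^ (m + 1) : ℝ) : ℂ) * w (scaleMap m ρ Y)‖ ≤ C * (1 + Y 0 ^ 2)⁻¹)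
    (hlim : ∀ Y, 1 ≤ ‖mom Y‖ → ‖mom Y‖ ≤ 2 → Tendsto (fun ρ : ℝ =>
      ((ρ ^ (m + 1) : ℝ) : ℂ) * w (scaleMap m ρ Y) -
        ((ρ ^ (m + 1) : ℝ) : ℂ) * w (scaleMap m ρ (reflect Y))) atTop (𝓝 0))
    {a : ℝ → ℝ} (ha : Continuous a) (ha0 : ∀ y, a y ≠ 0 → |y| ≤ r) {Ca : ℝ} (haC : ∀ y, |a y| ≤ Ca)
    {b : Momentum → ℝ} (hbc : Continuous b) (hodd : ∀ k, b (-k) = -b k)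
    (hb0 : ∀ k, b k ≠ 0 → 1 ≤ ‖k‖ ∧ ‖k‖ ≤ 2) {Cb : ℝ} (hbC : ∀ k, |b k| ≤ Cb) :
    Tendsto (fun ρ : ℝ => ∫ X, ((a (X 1) * (ρ⁻¹ * b (ρ⁻¹ • mom X)) : ℝ) : ℂ) * w X) atTop (𝓝 0) := by
  have hCa : 0 ≤ Ca := (abs_nonneg _).trans (haC 0)
  have hCb : 0 ≤ Cb := (abs_nonneg _).trans (hbC 0)
  set G : ℝ → Phase → ℂ := fun ρ Y => ((a (Y 1) * b (mom Y) : ℝ) : ℂ) *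
    (((ρ ^ (m + 1) : ℝ) : ℂ) * w (scaleMap m ρ Y)) with hG
  -- The Jacobian of the scaling is `ρᵐ · ρ²`, and the factor `ρ⁻¹` from the derivative of the
  -- cutoff leaves `ρ^(m + 1)`.
  have hscale : ∀ ρ, 0 < ρ → ∫ X, ((a (X 1) * (ρ⁻¹ * b (ρ⁻¹ • mom X)) : ℝ) : ℂ) * w X =
      ∫ Y, G ρ Y := fun ρ hρ => by
    have hprod : ∏ i, (![ρ ^ m, 1, ρ, ρ] : Fin 4 → ℝ) i = ρ ^ (m + 1) * ρ := by
      rw [Fin.prod_univ_four, Real.rpow_add_one hρ.ne']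
      simp
    have hpos : 0 < ρ ^ (m + 1) * ρ := mul_pos (Real.rpow_pos_of_pos hρ _) hρ
    rw [integral_diagMap (D := ![ρ ^ m, 1, ρ, ρ]) (by rw [hprod]; exact hpos.ne'), hprod,
      abs_of_pos hpos, ← integral_const_mul]
    refine integral_congr_ae (Eventually.of_forall fun Y => ?_)
    change _ * ((((a (scaleMap m ρ Y 1)) * (ρ⁻¹ * b (ρ⁻¹ • mom (scaleMap m ρ Y))) : ℝ) : ℂ) *
      w (scaleMap m ρ Y)) = _
    rw [scaleMap_one, mom_scaleMap, inv_smul_smul₀ hρ.ne']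
    have hρ' : (ρ : ℂ) ≠ 0 := by exact_mod_cast hρ.ne'
    simp only [hG, Complex.ofReal_mul, Complex.ofReal_inv]
    field_simp
  have hmeas : ∀ ρ, StronglyMeasurable (G ρ) := fun ρ => by
    refine StronglyMeasurable.mul ?_ (stronglyMeasurable_const.mul
      (hw.comp_measurable (continuous_diagMap _).measurable))
    exact (Complex.continuous_ofReal.comp ((ha.comp (contDiff_coord (k := 0) 1).continuous).mul
      (hbc.comp continuous_mom))).stronglyMeasurable
  have hbound : ∀ ρ, ρ₀ ≤ ρ → ∀ Y, ‖G ρ Y‖ ≤ Ca * Cb * C * (1 + Y 0 ^ 2)⁻¹ := fun ρ hρ Y => by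
    by_cases h0 : b (mom Y) = 0
    -- The bound evaluated at any point over the annulus shows `C ≥ 0`.
    · obtain ⟨k, hk⟩ : ∃ k : Momentum, ‖k‖ = 1 := ⟨EuclideanSpace.single 0 1, by simp⟩
      have hC : 0 ≤ C := by
        have := (norm_nonneg _).trans (hb ρ hρ !₂[0, 0, k 0, k 1]
          (by have : mom !₂[0, 0, k 0, k 1] = k := by ext i; fin_cases i <;> rfl
              rw [this, hk]) (by have : mom !₂[0, 0, k 0, k 1] = k := by ext i; fin_cases i <;> rfl
                                 rw [this, hk]; norm_num))
        simpa using this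
      simp only [hG, h0, mul_zero, Complex.ofReal_zero, zero_mul, norm_zero]
      positivity
    · obtain ⟨h1, h2⟩ := hb0 _ h0
      simp only [hG]
      rw [norm_mul, Complex.norm_real, norm_mul, mul_assoc (Ca * Cb)]
      exact mul_le_mul (mul_le_mul (haC _) (hbC _) (norm_nonneg _) hCa) (hb ρ hρ Y h1 h2)
        (norm_nonneg _) (by positivity)
  have hsupp : ∀ ρ Y, G ρ Y ≠ 0 → |Y 1| ≤ max r 2 ∧ |Y 2| ≤ max r 2 ∧ |Y 3| ≤ max r 2 :=
    fun ρ Y h => by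
      have h1 : a (Y 1) * b (mom Y) ≠ 0 := by
        have := left_ne_zero_of_mul h
        exact_mod_cast this
      have h2 := (hb0 _ (right_ne_zero_of_mul h1)).2
      exact ⟨(ha0 _ (left_ne_zero_of_mul h1)).trans (le_max_left _ _),
        ((abs_apply_le_norm (mom Y) 0).trans h2).trans (le_max_right _ _),
        ((abs_apply_le_norm (mom Y) 1).trans h2).trans (le_max_right _ _)⟩
  have hrefl : ∀ ρ, ∫ Y, G ρ Y = ∫ Y, G ρ (reflect Y) := fun ρ => by
    rw [integral_diagMap (D := ![-1, 1, -1, -1]) (by simp [Fin.prod_univ_four])]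
    simp [Fin.prod_univ_four, reflect]
  have hcr : Continuous reflect := continuous_diagMap _
  have hb' : ∀ ρ, ρ₀ ≤ ρ → ∀ Y, ‖G ρ (reflect Y)‖ ≤ Ca * Cb * C * (1 + Y 0 ^ 2)⁻¹ :=
    fun ρ hρ Y => by simpa using hbound ρ hρ (reflect Y)
  have hs' : ∀ ρ Y, G ρ (reflect Y) ≠ 0 → |Y 1| ≤ max r 2 ∧ |Y 2| ≤ max r 2 ∧ |Y 3| ≤ max r 2 :=
    fun ρ Y h => by simpa [reflect] using hsupp ρ _ h
  have hmeas' : ∀ ρ, StronglyMeasurable fun Y => G ρ (reflect Y) := fun ρ =>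
    (hmeas ρ).comp_measurable hcr.measurable
  -- The reflection preserves the measure, so `G` may be averaged with its reflection. As `b` is
  -- odd, the average contains the difference of the two densities, which tends to 0.
  have hsum : ∀ ρ, ρ₀ ≤ ρ → ∫ Y, G ρ Y = 2⁻¹ * ∫ Y, (G ρ Y + G ρ (reflect Y)) := fun ρ hρ => by
    rw [integral_add, ← hrefl]
    · ring
    · exact integrable_of_slab (hmeas ρ).aestronglyMeasurable (hbound ρ hρ) (hsupp ρ)
    · exact integrable_of_slab (hmeas' ρ).aestronglyMeasurable (hb' ρ hρ) (hs' ρ)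
  have hmain : Tendsto (fun ρ => ∫ Y, (G ρ Y + G ρ (reflect Y))) atTop
      (𝓝 (∫ _ : Phase, (0 : ℂ))) := by
    refine tendsto_integral_slab (C := Ca * Cb * C + Ca * Cb * C) (r := max r 2) ?_ ?_ ?_ ?_
    · exact Eventually.of_forall fun ρ => ((hmeas ρ).add (hmeas' ρ)).aestronglyMeasurable
    · filter_upwards [eventually_ge_atTop ρ₀] with ρ hρ Y
      rw [add_mul]
      exact (norm_add_le _ _).trans (add_le_add (hbound ρ hρ Y) (hb' ρ hρ Y))
    · refine Eventually.of_forall fun ρ Y h => ?_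
      by_cases h1 : G ρ Y = 0
      · exact hs' ρ Y (by simpa [h1] using h)
      · exact hsupp ρ Y h1
    · intro Y
      have hform : ∀ ρ, G ρ Y + G ρ (reflect Y) = ((a (Y 1) * b (mom Y) : ℝ) : ℂ) *
          (((ρ ^ (m + 1) : ℝ) : ℂ) * w (scaleMap m ρ Y) -
            ((ρ ^ (m + 1) : ℝ) : ℂ) * w (scaleMap m ρ (reflect Y))) := fun ρ => by
        simp only [hG, reflect_one, mom_reflect, hodd, Complex.ofReal_mul, Complex.ofReal_neg]
        ring
      simp only [hform]
      by_cases h0 : b (mom Y) = 0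
      · simp [h0]
      · obtain ⟨h1, h2⟩ := hb0 _ h0
        simpa using (hlim Y h1 h2).const_mul _
  rw [integral_zero] at hmain
  have h3 := hmain.const_mul 2⁻¹
  rw [mul_zero] at h3
  refine h3.congr' ?_
  filter_upwards [eventually_ge_atTop ρ₀, eventually_gt_atTop 0] with ρ h1 h2
  rw [hscale ρ h2, hsum ρ h1]

end Cutoff

/-! ### The contribution of the two bulk regions. -/

section Normal

variable {n : ℕ}

lemma pderiv_comp_mom {f : Momentum → Mat n} {X : Phase} (hf : DifferentiableAt ℝ f (mom X)) :
    pderiv 2 (fun Y => f (mom Y)) X = pderiv 0 f (mom X) ∧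
      pderiv 3 (fun Y => f (mom Y)) X = pderiv 1 f (mom X) := by
  have h1 : HasFDerivAt (fun Y => f (mom Y)) ((fderiv ℝ f (mom X)).comp momCLM) X := by
    have h2 : HasFDerivAt mom momCLM X := by
      rw [← coe_momCLM]; exact momCLM.hasFDerivAt
    exact HasFDerivAt.comp X hf.hasFDerivAt h2
  have e2 : momCLM (EuclideanSpace.single 2 1) = EuclideanSpace.single 0 1 := by
    rw [momCLM_apply]; ext i; fin_cases i <;> simp [mom]
  have e3 : momCLM (EuclideanSpace.single 3 1) = EuclideanSpace.single 1 1 := by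
    rw [momCLM_apply]; ext i; fin_cases i <;> simp [mom]
  constructor
  · rw [pderiv_eq_fderiv h1.differentiableAt, pderiv_eq_fderiv hf, h1.fderiv,
      ContinuousLinearMap.comp_apply, e2]
  · rw [pderiv_eq_fderiv h1.differentiableAt, pderiv_eq_fderiv hf, h1.fderiv,
      ContinuousLinearMap.comp_apply, e3]

/-- `wForm` of a bulk symbol and its momentum derivatives. -/
noncomputable def bulkForm (f : Momentum → Mat n) (p : Momentum × ℝ) : ℂ :=
  wForm (f p.1) (pderiv 0 f p.1) (pderiv 1 f p.1) p.2

/-- The integral of `bulkForm` over `x`. -/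
noncomputable def bulkDensity (f : Momentum → Mat n) (k : Momentum) : ℂ :=
  qForm (f k) (pderiv 0 f k) (pderiv 1 f k)

lemma integrable_bulkForm {f : Momentum → Mat n} (hf : ContDiff ℝ 1 f)
    (hH : ∀ k, (f k).IsHermitian) {c : ℝ} (hc : 0 < c) (hco : ∀ k, Coercive c (f k))
    {b : Momentum → ℝ} (hb : Continuous b) (hbs : HasCompactSupport b) :
    Integrable fun p : Momentum × ℝ => ((b p.1 : ℝ) : ℂ) * bulkForm f p := by
  have h0 := continuous_pderiv hf 0
  have h1 := continuous_pderiv hf 1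
  set N : Momentum → ℝ := fun k => ‖b k‖ * (2 * n * ‖pderiv 0 f k‖ * ‖pderiv 1 f k‖) with hN
  have hNc : Continuous N := hb.norm.mul ((continuous_const.mul h0.norm).mul h1.norm)
  have hNi : Integrable N := hNc.integrable_of_hasCompactSupport (by
    have := hbs.norm.mul_right (f' := fun k => 2 * n * ‖pderiv 0 f k‖ * ‖pderiv 1 f k‖)
    exact this)
  have hI := hNi.mul_prod ((integrable_inv_sq_add_sq hc.ne').const_mul c⁻¹)
  refine hI.mono' ?_ (Eventually.of_forall fun p => ?_)
  · refine StronglyMeasurable.aestronglyMeasurable (StronglyMeasurable.mul ?_ ?_)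
    · exact (Complex.continuous_ofReal.comp (hb.comp continuous_fst)).stronglyMeasurable
    · exact stronglyMeasurable_wForm (hf.continuous.comp continuous_fst)
        (h0.comp continuous_fst) (h1.comp continuous_fst) continuous_snd
  · rw [norm_mul, Complex.norm_real, hN, mul_assoc]
    exact mul_le_mul_of_nonneg_left
      (norm_wForm_le_of_coercive (hco p.1) (hH p.1) hc _ _ p.2) (norm_nonneg _)

lemma integral_bulkForm {f : Momentum → Mat n} (hf : ContDiff ℝ 1 f)
    (hH : ∀ k, (f k).IsHermitian) {c : ℝ} (hc : 0 < c) (hco : ∀ k, Coercive c (f k))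
    {b : Momentum → ℝ} (hb : Continuous b) (hbs : HasCompactSupport b) :
    Integrable (fun k => ((b k : ℝ) : ℂ) * bulkDensity f k) ∧
    ∫ p : Momentum × ℝ, ((b p.1 : ℝ) : ℂ) * bulkForm f p =
      ∫ k, ((b k : ℝ) : ℂ) * bulkDensity f k := by
  have hi := integrable_bulkForm hf hH hc hco hb hbs
  have e : ∀ k, ∫ x : ℝ, ((b k : ℝ) : ℂ) * bulkForm f (k, x) = ((b k : ℝ) : ℂ) * bulkDensity f k :=
    fun k => integral_const_mul _ _
  constructor
  · have := hi.integral_prod_left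
    simpa only [e] using this
  · rw [Measure.volume_eq_prod, integral_prod _ hi]
    simp only [e]

/-- The contribution of the two bulk regions is the difference of the bulk densities. -/
lemma integral_normal_term {s : Phase → Mat n} {σN σS : Momentum → Mat n} {L r : ℝ}
    (hN : ∀ X : Phase, L < X 1 → s X = σN (mom X)) (hS : ∀ X : Phase, X 1 < -L → s X = σS (mom X))
    (hNs : ContDiff ℝ 1 σN) (hSs : ContDiff ℝ 1 σS) (hNH : ∀ k, (σN k).IsHermitian)
    (hSH : ∀ k, (σS k).IsHermitian) {c : ℝ} (hc : 0 < c) (hNc : ∀ k, Coercive c (σN k))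
    (hSc : ∀ k, Coercive c (σS k)) {a : ℝ → ℝ} (ha : Continuous a)
    (ha0 : ∀ y, a y ≠ 0 → L < |y| ∧ |y| ≤ r) (haN : ∫ y in Set.Ioi 0, a y = -1)
    (haS : ∫ y in Set.Iic 0, a y = 1) {b : Momentum → ℝ} (hb : Continuous b)
    (hbs : HasCompactSupport b) :
    ∫ X, ((a (X 1) * b (mom X) : ℝ) : ℂ) * wDeriv s 2 3 X =
      ∫ k, ((b k : ℝ) : ℂ) * (bulkDensity σS k - bulkDensity σN k) := by
  have hac : HasCompactSupport a := HasCompactSupport.of_support_subset_isCompact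
    (isCompact_closedBall (0 : ℝ) r) fun y hy => by
      simpa using (ha0 y hy).2
  have hai : Integrable a := ha.integrable_of_hasCompactSupport hac
  -- The support of `a` avoids `|y| ≤ L`, so splitting by the sign of `y` separates the region with
  -- symbol `σN` from the one with symbol `σS`. On each piece the integrand factors into a function
  -- of `y` and one of `(k, x)`.
  set fN : ℝ → ℂ := fun y => (((Set.Ioi 0).indicator a y : ℝ) : ℂ) with hfN
  set fS : ℝ → ℂ := fun y => (((Set.Iic 0).indicator a y : ℝ) : ℂ) with hfS
  have ifN : Integrable fN := (hai.indicator measurableSet_Ioi).ofReal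
  have ifS : Integrable fS := (hai.indicator measurableSet_Iic).ofReal
  have eN : ∫ y, fN y = -1 := by
    refine (integral_ofReal (f := (Set.Ioi 0).indicator a)).trans ?_
    rw [integral_indicator measurableSet_Ioi, haN]; simp
  have eS : ∫ y, fS y = 1 := by
    refine (integral_ofReal (f := (Set.Iic 0).indicator a)).trans ?_
    rw [integral_indicator measurableSet_Iic, haS]; simp
  have key : ∀ X : Phase, ((a (X 1) * b (mom X) : ℝ) : ℂ) * wDeriv s 2 3 X =
      fN (X 1) * (((b (mom X) : ℝ) : ℂ) * bulkForm σN (mom X, X 0)) +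
        fS (X 1) * (((b (mom X) : ℝ) : ℂ) * bulkForm σS (mom X, X 0)) := fun X => by
    by_cases h0 : a (X 1) = 0
    · have h1 : fN (X 1) = 0 := by
        simp only [hfN, Set.indicator_apply, h0, ite_self, Complex.ofReal_zero]
      have h2 : fS (X 1) = 0 := by
        simp only [hfS, Set.indicator_apply, h0, ite_self, Complex.ofReal_zero]
      simp [h0, h1, h2]
    have h1c : Continuous fun X : Phase => X 1 := (contDiff_coord (k := 0) 1).continuous
    rcases lt_or_ge 0 (X 1) with hp | hp
    · have hL : L < X 1 := by simpa [abs_of_pos hp] using (ha0 _ h0).1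
      have hev : s =ᶠ[𝓝 X] fun Y => σN (mom Y) := by
        filter_upwards [(isOpen_lt continuous_const h1c).mem_nhds hL] with Y hY
        exact hN Y hY
      have hd := pderiv_comp_mom (hNs.differentiable one_ne_zero (mom X))
      have e1 : wDeriv s 2 3 X = bulkForm σN (mom X, X 0) := by
        rw [wDeriv, bulkForm, pderiv_congr hev, pderiv_congr hev, hd.1, hd.2, hN X hL]
      have h1 : fN (X 1) = a (X 1) := by
        simp only [hfN, Set.indicator_of_mem (Set.mem_Ioi.mpr hp)]
      have h2 : fS (X 1) = 0 := by
        simp only [hfS, Set.indicator_of_notMem (fun h : X 1 ∈ Set.Iic 0 => absurd h (not_le.mpr hp)),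
          Complex.ofReal_zero]
      rw [e1, h1, h2, Complex.ofReal_mul]
      ring
    · have hL : X 1 < -L := by
        have := (ha0 _ h0).1
        rw [abs_of_nonpos hp] at this
        linarith
      have hev : s =ᶠ[𝓝 X] fun Y => σS (mom Y) := by
        filter_upwards [(isOpen_lt h1c continuous_const).mem_nhds hL] with Y hY
        exact hS Y hY
      have hd := pderiv_comp_mom (hSs.differentiable one_ne_zero (mom X))
      have e1 : wDeriv s 2 3 X = bulkForm σS (mom X, X 0) := by
        rw [wDeriv, bulkForm, pderiv_congr hev, pderiv_congr hev, hd.1, hd.2, hS X hL]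
      have h1 : fN (X 1) = 0 := by
        simp only [hfN, Set.indicator_of_notMem (fun h : X 1 ∈ Set.Ioi 0 => absurd h (not_lt.mpr hp)),
          Complex.ofReal_zero]
      have h2 : fS (X 1) = a (X 1) := by
        simp only [hfS, Set.indicator_of_mem (Set.mem_Iic.mpr hp)]
      rw [e1, h1, h2, Complex.ofReal_mul]
      ring
  have hint : ∀ (f : Momentum → Mat n) (g : ℝ → ℂ), Integrable g → Integrable (fun p : Momentum × ℝ =>
      ((b p.1 : ℝ) : ℂ) * bulkForm f p) → Integrable fun X : Phase =>
      g (X 1) * (((b (mom X) : ℝ) : ℂ) * bulkForm f (mom X, X 0)) := fun f g hg hf => by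
    have h1 := hg.mul_prod hf
    have h2 := (measurePreserving_splitCoord.integrable_comp_emb
      splitCoord.measurableEmbedding).mpr h1
    refine h2.congr (Eventually.of_forall fun X => ?_)
    simp only [Function.comp_apply, splitCoord_apply]
  have iN := integrable_bulkForm hNs hNH hc hNc hb hbs
  have iS := integrable_bulkForm hSs hSH hc hSc hb hbs
  obtain ⟨jN, qN⟩ := integral_bulkForm hNs hNH hc hNc hb hbs
  obtain ⟨jS, qS⟩ := integral_bulkForm hSs hSH hc hSc hb hbs
  rw [integral_congr_ae (Eventually.of_forall key), integral_add (hint _ _ ifN iN) (hint _ _ ifS iS),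
    integral_split fN (fun p => ((b p.1 : ℝ) : ℂ) * bulkForm σN p),
    integral_split fS (fun p => ((b p.1 : ℝ) : ℂ) * bulkForm σS p), eN, eS, qN, qS]
  simp only [mul_sub]
  rw [integral_sub jS jN]
  ring

end Normal

/-! ### Frozen walls: uniform bounds under the scaling of momenta. -/

section Wall

variable {n : ℕ}

/-- The properties of an `x`-independent symbol of a domain wall on which the evaluation of the
invariant rests. -/
structure IsWall (m L c₀ c C K : ℝ) (s : Phase → Mat n) (σN σS : Momentum → Mat n) : Prop where
  order_pos : 0 < m
  width_pos : 0 < L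
  gap_pos : 0 < c₀
  ell_pos : 0 < c
  one_le : 1 ≤ K
  bound_nonneg : 0 ≤ C
  smooth : ContDiff ℝ 2 s
  hermitian : ∀ X, (s X).IsHermitian
  xInvariant : XInvariant s
  north : ∀ X : Phase, L < X 1 → s X = σN (mom X)
  south : ∀ X : Phase, X 1 < -L → s X = σS (mom X)
  smooth_north : ContDiff ℝ 2 σN
  smooth_south : ContDiff ℝ 2 σS
  gap_north : ∀ k, Coercive c₀ (σN k)
  gap_south : ∀ k, Coercive c₀ (σS k)
  elliptic : ∀ X, K ≤ ‖mom X‖ → Coercive (c * ‖mom X‖ ^ m) (s X)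
  bound_y : ∀ X, K ≤ ‖mom X‖ → ‖pderiv 1 s X‖ ≤ C * ‖mom X‖ ^ m
  bound_k : ∀ X, K ≤ ‖mom X‖ → ∀ j, (j = 2 ∨ j = 3) →
    ‖pderiv j s X‖ ≤ C * (‖mom X‖ ^ m / ‖mom X‖)

variable {m L c₀ c C K : ℝ} {s : Phase → Mat n} {σN σS : Momentum → Mat n}

/-- The point `(0, y, k)` of phase space. -/
noncomputable def wallPoint (y : ℝ) (k : Momentum) : Phase := !₂[0, y, k 0, k 1]

@[simp] lemma mom_wallPoint (y : ℝ) (k : Momentum) : mom (wallPoint y k) = k := by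
  ext i; fin_cases i <;> rfl

@[simp] lemma wallPoint_one (y : ℝ) (k : Momentum) : wallPoint y k 1 = y := rfl

lemma IsWall.hermitian_north (h : IsWall m L c₀ c C K s σN σS) (k : Momentum) :
    (σN k).IsHermitian := by
  have h1 := h.north (wallPoint (L + 1) k) (by simp)
  rw [mom_wallPoint] at h1
  rw [← h1]
  exact h.hermitian _

lemma IsWall.hermitian_south (h : IsWall m L c₀ c C K s σN σS) (k : Momentum) :
    (σS k).IsHermitian := by
  have h1 := h.south (wallPoint (-L - 1) k) (by simp)
  rw [mom_wallPoint] at h1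
  rw [← h1]
  exact h.hermitian _

lemma IsWall.coercive (h : IsWall m L c₀ c C K s σN σS) {X : Phase} (hX : L < |X 1| ∨ K ≤ ‖mom X‖) :
    Coercive (min c₀ c) (s X) := by
  rcases hX with hX | hX
  · rcases lt_abs.mp hX with h1 | h1
    · rw [h.north X h1]
      exact (h.gap_north _).mono (min_le_left _ _)
    · rw [h.south X (by linarith)]
      exact (h.gap_south _).mono (min_le_left _ _)
  · refine (h.elliptic X hX).mono ((min_le_right _ _).trans ?_)
    exact le_mul_of_one_le_right h.ell_pos.le
      (Real.one_le_rpow (h.one_le.trans hX) h.order_pos.le)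

/-- Here `P` stands for `ρᵐ`. Rescaling `x` by `P` extracts `P⁻³` from the resolvents, and the
derivatives supply `P²/ρ`, so the prefactor `Pρ` is exactly compensated. -/
lemma norm_scaled_wForm_le {A B D : Mat n} {c P ρ M : ℝ} (hc : 0 < c) (hP : 0 < P) (hρ : 0 < ρ)
    (hA : A.IsHermitian) (hco : Coercive (c * P) A) (hBD : ‖B‖ * ‖D‖ ≤ M * (P * (P / ρ))) (x : ℝ) :
    ‖((P * ρ : ℝ) : ℂ) * wForm A B D (P * x)‖ ≤
      2 * n * M * c⁻¹ * (1 + (c ^ 2)⁻¹) * (1 + x ^ 2)⁻¹ := by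
  have hM : 0 ≤ M := by
    have h1 : 0 ≤ M * (P * (P / ρ)) := (by positivity : (0 : ℝ) ≤ ‖B‖ * ‖D‖).trans hBD
    exact nonneg_of_mul_nonneg_left h1 (by positivity)
  have h1 := norm_wForm_le_of_coercive hco hA (mul_pos hc hP) B D (P * x)
  rw [norm_mul, Complex.norm_real, Real.norm_of_nonneg (mul_pos hP hρ).le]
  calc P * ρ * ‖wForm A B D (P * x)‖
      ≤ P * ρ * (2 * n * ‖B‖ * ‖D‖ * ((c * P)⁻¹ * ((c * P) ^ 2 + (P * x) ^ 2)⁻¹)) := by gcongr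
    _ = P * ρ * (2 * n * (‖B‖ * ‖D‖) * ((c * P)⁻¹ * ((c * P) ^ 2 + (P * x) ^ 2)⁻¹)) := by ring
    _ ≤ P * ρ * (2 * n * (M * (P * (P / ρ))) * ((c * P)⁻¹ * ((c * P) ^ 2 + (P * x) ^ 2)⁻¹)) := by
        gcongr
    _ = 2 * n * M * c⁻¹ * (c ^ 2 + x ^ 2)⁻¹ := by
        have h2 : (c * P) ^ 2 + (P * x) ^ 2 = P ^ 2 * (c ^ 2 + x ^ 2) := by ring
        have h3 : c ^ 2 + x ^ 2 ≠ 0 := by positivity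
        rw [h2]
        field_simp
    _ ≤ 2 * n * M * c⁻¹ * ((1 + (c ^ 2)⁻¹) * (1 + x ^ 2)⁻¹) := by
        gcongr
        exact inv_sq_add_sq_le hc x
    _ = _ := by ring

lemma IsWall.scaled_coercive (h : IsWall m L c₀ c C K s σN σS) {ρ : ℝ} (hρ : K ≤ ρ) {Y : Phase}
    (hY : 1 ≤ ‖mom Y‖) : K ≤ ‖mom (scaleMap m ρ Y)‖ ∧ Coercive (c * ρ ^ m) (s (scaleMap m ρ Y)) := by
  have hρ1 : 1 ≤ ρ := h.one_le.trans hρ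
  have hle : ρ ≤ ‖mom (scaleMap m ρ Y)‖ := by
    rw [mom_scaleMap, norm_smul, Real.norm_of_nonneg (by linarith)]
    nlinarith
  refine ⟨hρ.trans hle, (h.elliptic _ (hρ.trans hle)).mono ?_⟩
  have := h.ell_pos
  have := h.order_pos
  gcongr

lemma rpow_scaled_le {m ρ : ℝ} (hm : 0 < m) (hρ : 0 < ρ) {Y : Phase} (h1 : 1 ≤ ‖mom Y‖)
    (h2 : ‖mom Y‖ ≤ 2) : ‖mom (scaleMap m ρ Y)‖ ^ m ≤ 2 ^ m * ρ ^ m ∧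
      ‖mom (scaleMap m ρ Y)‖ ^ m / ‖mom (scaleMap m ρ Y)‖ ≤ 2 ^ m * (ρ ^ m / ρ) := by
  rw [mom_scaleMap, norm_smul, Real.norm_of_nonneg hρ.le]
  have h3 : (ρ * ‖mom Y‖) ^ m ≤ 2 ^ m * ρ ^ m := by
    rw [← Real.mul_rpow (by norm_num) hρ.le]
    have : ρ * ‖mom Y‖ ≤ 2 * ρ := by nlinarith
    gcongr
  refine ⟨h3, ?_⟩
  rw [← mul_div_assoc]
  have : ρ ≤ ρ * ‖mom Y‖ := by nlinarith
  gcongr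

/-- The bound `B` on the derivative across the wall is kept apart from `C`. It may be a fixed
constant, for domination, or arbitrarily small when this derivative is of lower order. -/
lemma IsWall.scaled_bound (h : IsWall m L c₀ c C K s σN σS) {i j : Fin 4}
    (hij : i = 1 ∧ (j = 2 ∨ j = 3) ∨ j = 1 ∧ (i = 2 ∨ i = 3)) {ρ : ℝ} (hρ : K ≤ ρ) {Y : Phase}
    (h1 : 1 ≤ ‖mom Y‖) (h2 : ‖mom Y‖ ≤ 2) {B : ℝ} (hB0 : 0 ≤ B)
    (hB : ‖pderiv 1 s (scaleMap m ρ Y)‖ ≤ B * ρ ^ m) :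
    ‖((ρ ^ (m + 1) : ℝ) : ℂ) * wDeriv s i j (scaleMap m ρ Y)‖ ≤
      2 * n * (B * (C * 2 ^ m)) * c⁻¹ * (1 + (c ^ 2)⁻¹) * (1 + Y 0 ^ 2)⁻¹ := by
  have hρ0 : 0 < ρ := zero_lt_one.trans_le (h.one_le.trans hρ)
  obtain ⟨h3, h4⟩ := h.scaled_coercive hρ h1
  have h5 := (rpow_scaled_le h.order_pos hρ0 h1 h2).2
  have hk : ∀ j, (j = 2 ∨ j = 3) → ‖pderiv j s (scaleMap m ρ Y)‖ ≤ C * 2 ^ m * (ρ ^ m / ρ) :=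
    fun j hj => (h.bound_k _ h3 j hj).trans (by
      rw [mul_assoc]
      exact mul_le_mul_of_nonneg_left h5 h.bound_nonneg)
  have hP : 0 < ρ ^ m := Real.rpow_pos_of_pos hρ0 m
  rw [wDeriv, scaleMap_zero, Real.rpow_add_one hρ0.ne']
  refine norm_scaled_wForm_le h.ell_pos hP hρ0 (h.hermitian _) h4 ?_ _
  have hC := h.bound_nonneg
  rcases hij with ⟨rfl, hj⟩ | ⟨rfl, hj⟩
  · calc _ ≤ (B * ρ ^ m) * (C * 2 ^ m * (ρ ^ m / ρ)) :=
          mul_le_mul hB (hk _ hj) (norm_nonneg _) (by positivity)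
      _ = _ := by ring
  · calc _ ≤ (C * 2 ^ m * (ρ ^ m / ρ)) * (B * ρ ^ m) :=
          mul_le_mul (hk _ hj) hB (norm_nonneg _) (by positivity)
      _ = _ := by ring

/-- Asymptotic evenness of the lateral densities. -/
def LateralParity (m : ℝ) (s : Phase → Mat n) (i j : Fin 4) : Prop :=
  ∀ Y : Phase, 1 ≤ ‖mom Y‖ → ‖mom Y‖ ≤ 2 → Tendsto (fun ρ : ℝ =>
    ((ρ ^ (m + 1) : ℝ) : ℂ) * wDeriv s i j (scaleMap m ρ Y) -
      ((ρ ^ (m + 1) : ℝ) : ℂ) * wDeriv s i j (scaleMap m ρ (reflect Y))) atTop (𝓝 0)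

lemma stronglyMeasurable_wDeriv (hs : ContDiff ℝ 1 s) (i j : Fin 4) :
    StronglyMeasurable (wDeriv s i j) :=
  stronglyMeasurable_wForm hs.continuous (continuous_pderiv hs i) (continuous_pderiv hs j)
    (contDiff_coord (k := 0) 0).continuous

/-- The cutoff `α(y) β(k / ρ)`. -/
noncomputable def wallCutoff (α : ℝ → ℝ) (β : Momentum → ℝ) (ρ : ℝ) (X : Phase) : ℝ :=
  α (X 1) * β (ρ⁻¹ • mom X)

lemma contDiff_wallCutoff {α : ℝ → ℝ} {β : Momentum → ℝ} (hα : ContDiff ℝ 1 α)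
    (hβ : ContDiff ℝ 1 β) (ρ : ℝ) : ContDiff ℝ 1 (wallCutoff α β ρ) :=
  (hα.comp (contDiff_coord 1)).mul (hβ.comp (contDiff_mom.const_smul ρ⁻¹))

lemma fderiv_wallCutoff {α : ℝ → ℝ} {β : Momentum → ℝ} (hα : ContDiff ℝ 1 α)
    (hβ : ContDiff ℝ 1 β) (ρ : ℝ) (X : Phase) : fderiv ℝ (wallCutoff α β ρ) X =
      α (X 1) • (fderiv ℝ β (ρ⁻¹ • mom X)).comp (ρ⁻¹ • momCLM) +
        β (ρ⁻¹ • mom X) • (deriv α (X 1) • EuclideanSpace.proj (𝕜 := ℝ) (1 : Fin 4)) := by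
  have h1 : HasFDerivAt (fun X : Phase => X 1) (EuclideanSpace.proj (𝕜 := ℝ) (1 : Fin 4)) X :=
    (EuclideanSpace.proj (𝕜 := ℝ) (1 : Fin 4)).hasFDerivAt
  have h2 := (hα.differentiable one_ne_zero (X 1)).hasDerivAt.comp_hasFDerivAt X h1
  have h3 : HasFDerivAt (fun X : Phase => ρ⁻¹ • mom X) (ρ⁻¹ • momCLM) X := by
    have : (fun X : Phase => ρ⁻¹ • mom X) = (ρ⁻¹ • momCLM : Phase →L[ℝ] Momentum) := by
      funext Y; rw [smul_apply, momCLM_apply]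
    rw [this]
    exact (ρ⁻¹ • momCLM).hasFDerivAt
  have h4 := (hβ.differentiable one_ne_zero (ρ⁻¹ • mom X)).hasFDerivAt.comp X h3
  exact (h2.mul h4).fderiv

lemma fderiv_wallCutoff_single {α : ℝ → ℝ} {β : Momentum → ℝ} (hα : ContDiff ℝ 1 α)
    (hβ : ContDiff ℝ 1 β) (ρ : ℝ) (X : Phase) :
    fderiv ℝ (wallCutoff α β ρ) X (EuclideanSpace.single 1 1) =
        deriv α (X 1) * β (ρ⁻¹ • mom X) ∧
      fderiv ℝ (wallCutoff α β ρ) X (EuclideanSpace.single 2 1) =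
        α (X 1) * (ρ⁻¹ * fderiv ℝ β (ρ⁻¹ • mom X) (EuclideanSpace.single 0 1)) ∧
      fderiv ℝ (wallCutoff α β ρ) X (EuclideanSpace.single 3 1) =
        α (X 1) * (ρ⁻¹ * fderiv ℝ β (ρ⁻¹ • mom X) (EuclideanSpace.single 1 1)) := by
  have e1 : momCLM (EuclideanSpace.single 1 1) = 0 := by
    rw [momCLM_apply]; ext i; fin_cases i <;> simp [mom]
  have e2 : momCLM (EuclideanSpace.single 2 1) = EuclideanSpace.single 0 1 := by
    rw [momCLM_apply]; ext i; fin_cases i <;> simp [mom]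
  have e3 : momCLM (EuclideanSpace.single 3 1) = EuclideanSpace.single 1 1 := by
    rw [momCLM_apply]; ext i; fin_cases i <;> simp [mom]
  rw [fderiv_wallCutoff hα hβ]
  simp only [add_apply, smul_apply, ContinuousLinearMap.comp_apply, e1, e2, e3, smul_eq_mul,
    map_zero, map_smul]
  refine ⟨?_, ?_, ?_⟩ <;> simp [mul_comm]

end Wall

/-! ### The invariant as a limit of smoothly cut off bulk densities. -/

section SmoothCutoff

variable {n : ℕ} {m L c₀ c C K : ℝ} {s : Phase → Mat n} {σN σS : Momentum → Mat n}

/-- The zeros of `s - ix` lie over the bounded part of the wall. -/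
def OverWall (L K : ℝ) (X : Phase) : Prop := X 0 = 0 ∧ |X 1| ≤ L ∧ ‖mom X‖ ≤ K

lemma IsWall.overWall (h : IsWall m L c₀ c C K s σN σS) {X : Phase}
    (hX : ¬IsUnit (domainWallSymbol s X)) : OverWall L K X := by
  have h0 : X 0 = 0 := by
    by_contra h0
    exact hX (isUnit_shift_of_ne_zero (h.hermitian X) h0)
  have hpos : 0 < min c₀ c := lt_min h.gap_pos h.ell_pos
  refine ⟨h0, ?_, ?_⟩ <;> by_contra! h1
  · exact hX (isUnit_shift (h.coercive (Or.inl h1)) (h.hermitian X) hpos _)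
  · exact hX (isUnit_shift (h.coercive (Or.inr h1.le)) (h.hermitian X) hpos _)

lemma integral_deriv_bump (α : ContDiffBump (0 : ℝ)) :
    ∫ y in Set.Ioi 0, deriv α y = -1 ∧ ∫ y in Set.Iic 0, deriv α y = 1 := by
  have hd : ∀ y, HasDerivAt α (deriv α y) y := fun y =>
    ((α.contDiff (n := 1)).differentiable one_ne_zero y).hasDerivAt
  have hi : Integrable (deriv α) :=
    ((α.contDiff (n := 1)).continuous_deriv le_rfl).integrable_of_hasCompactSupport
      α.hasCompactSupport.deriv
  have h0 : α 0 = 1 := α.one_of_mem_closedBall (by simpa using α.rIn_pos.le)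
  have hout : ∀ y : ℝ, α.rOut ≤ |y| → α y = 0 := fun y hy => by
    by_contra h
    have : y ∈ Function.support α := h
    rw [α.support_eq, mem_ball_zero_iff, Real.norm_eq_abs] at this
    linarith
  have htop : Tendsto α atTop (𝓝 0) := tendsto_const_nhds.congr' (by
    filter_upwards [eventually_ge_atTop α.rOut] with y hy
    exact (hout y (hy.trans (le_abs_self y))).symm)
  have hbot : Tendsto α atBot (𝓝 0) := tendsto_const_nhds.congr' (by
    filter_upwards [eventually_le_atBot (-α.rOut)] with y hy
    exact (hout y ((le_neg.mp hy).trans (neg_le_abs y))).symm)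
  constructor
  · rw [integral_Ioi_of_hasDerivAt_of_tendsto' (fun y _ => hd y) hi.integrableOn htop, h0, zero_sub]
  · rw [integral_Iic_of_hasDerivAt_of_tendsto' (fun y _ => hd y) hi.integrableOn hbot, h0, sub_zero]

lemma deriv_bump_ne_zero {E : Type*} [NormedAddCommGroup E] [NormedSpace ℝ E] [HasContDiffBump E]
    [FiniteDimensional ℝ E] (β : ContDiffBump (0 : E)) {k : E} (h : fderiv ℝ β k ≠ 0) :
    β.rIn ≤ ‖k‖ ∧ ‖k‖ ≤ β.rOut := by
  constructor <;> by_contra! h1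
  · apply h
    have h2 : (β : E → ℝ) =ᶠ[𝓝 k] fun _ => 1 := by
      filter_upwards [Metric.isOpen_ball.mem_nhds (mem_ball_zero_iff.mpr h1)] with t ht
      exact β.one_of_mem_closedBall (Metric.ball_subset_closedBall ht)
    rw [h2.fderiv_eq]
    exact fderiv_const_apply (1 : ℝ)
  · apply h
    have h2 : k ∉ tsupport β := by
      rw [β.tsupport_eq, mem_closedBall_zero_iff]
      exact not_le.mpr h1
    rw [(notMem_tsupport_iff_eventuallyEq.mp h2).fderiv_eq]
    exact fderiv_const_apply (0 : ℝ)

/-- A bump centred at the origin is even, so its gradient is odd. This is the oddness that the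
lateral term needs. -/
lemma fderiv_bump_neg (β : ContDiffBump (0 : Momentum)) (k : Momentum) :
    fderiv ℝ β (-k) = -fderiv ℝ β k := by
  have h1 : (fun k => β (-k)) = β := funext fun k => β.neg k
  have h2 : HasFDerivAt (fun k => β (-k)) ((fderiv ℝ β (-k)).comp (-ContinuousLinearMap.id ℝ Momentum)) k :=
    HasFDerivAt.comp (g := (β : Momentum → ℝ)) k ((β.contDiff (n := 1)).differentiable one_ne_zero (-k)).hasFDerivAt
      (hasFDerivAt_id k).neg
  rw [h1] at h2
  rw [h2.fderiv]
  ext v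
  simp

/-- Evaluation of the invariant by a smooth cutoff of the difference of the bulk densities. -/
theorem IsWall.tendsto_smooth_cutoff (h : IsWall m L c₀ c C K s σN σS)
    (h31 : LateralParity m s 3 1) (h12 : LateralParity m s 1 2) {F : ℂ}
    (hF : ∀ u : Phase → ℝ, ContDiff ℝ 1 u → HasCompactSupport u →
      (∀ X, OverWall L K X → u =ᶠ[𝓝 X] 1) → F = -∫ X, wedge u (domainWallSymbol s) X)
    (β : ContDiffBump (0 : Momentum)) (hβ1 : β.rIn = 1) (hβ2 : β.rOut ≤ 2) :
    Tendsto (fun ρ : ℝ => 3 * Complex.I *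
      ∫ k, ((β (ρ⁻¹ • k) : ℝ) : ℂ) * (bulkDensity σS k - bulkDensity σN k)) atTop (𝓝 F) := by
  have hL := h.width_pos
  -- The plateau reaches beyond the wall, so `α'` lives where the symbol already is a bulk symbol.
  let α : ContDiffBump (0 : ℝ) := ⟨L + 1, L + 2, by linarith, by linarith⟩
  have hαc : ContDiff ℝ 1 α := α.contDiff
  have hβc : ContDiff ℝ 1 β := β.contDiff
  have hs1 : ContDiff ℝ 1 s := h.smooth.of_le (by norm_num)
  have hpos : 0 < min c₀ c := lt_min h.gap_pos h.ell_pos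
  have hα' : ∀ y, deriv α y ≠ 0 → L < |y| ∧ |y| ≤ L + 2 := fun y hy => by
    have h1 : fderiv ℝ α y ≠ 0 := fun h0 => hy (by rw [← fderiv_apply_one_eq_deriv, h0]; rfl)
    have h2 := deriv_bump_ne_zero α h1
    simp only [Real.norm_eq_abs] at h2
    exact ⟨by linarith [h2.1, show α.rIn = L + 1 from rfl], h2.2⟩
  have hα0 : ∀ y, α y ≠ 0 → |y| ≤ L + 2 := fun y hy => by
    have : y ∈ Function.support α := hy
    rw [α.support_eq, mem_ball_zero_iff, Real.norm_eq_abs] at this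
    exact this.le
  have hβ0 : ∀ k, β k ≠ 0 → ‖k‖ ≤ 2 := fun k hk => by
    have : k ∈ Function.support β := hk
    rw [β.support_eq, mem_ball_zero_iff] at this
    exact this.le.trans hβ2
  obtain ⟨Cb, hCb⟩ : ∃ Cb, ∀ k, ‖fderiv ℝ β k‖ ≤ Cb :=
    (hβc.continuous_fderiv one_ne_zero).bounded_above_of_compact_support
      (β.hasCompactSupport.fderiv ℝ)
  have hlat : ∀ (i j : Fin 4) (l : Fin 2), LateralParity m s i j →
      (i = 1 ∧ (j = 2 ∨ j = 3) ∨ j = 1 ∧ (i = 2 ∨ i = 3)) →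
      Tendsto (fun ρ : ℝ => ∫ X, ((α (X 1) * (ρ⁻¹ *
        fderiv ℝ β (ρ⁻¹ • mom X) (EuclideanSpace.single l 1)) : ℝ) : ℂ) * wDeriv s i j X)
        atTop (𝓝 0) := fun i j l hp hij => by
    refine tendsto_integral_lateral (ρ₀ := K)
      (C := 2 * n * ((C * 2 ^ m) * (C * 2 ^ m)) * c⁻¹ * (1 + (c ^ 2)⁻¹)) (b := fun k => fderiv ℝ β k (EuclideanSpace.single l 1))
      (stronglyMeasurable_wDeriv hs1 i j) (fun ρ hρ Y h1 h2 => ?_) hp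
      hαc.continuous hα0 (Ca := 1) (fun y => ?_)
      ((hβc.continuous_fderiv one_ne_zero).clm_apply continuous_const) (fun k => ?_) (fun k hk => ?_)
      (Cb := Cb) (fun k => ?_)
    · have hρ0 : 0 < ρ := zero_lt_one.trans_le (h.one_le.trans hρ)
      have hC := h.bound_nonneg
      refine h.scaled_bound hij hρ h1 h2 (by positivity) ?_
      refine (h.bound_y _ (h.scaled_coercive hρ h1).1).trans ?_
      rw [mul_assoc]
      exact mul_le_mul_of_nonneg_left (rpow_scaled_le h.order_pos hρ0 h1 h2).1 hC
    · rw [abs_of_nonneg α.nonneg]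
      exact α.le_one
    · rw [fderiv_bump_neg, neg_apply]
    · have h1 : fderiv ℝ β k ≠ 0 := fun h0 => hk (by rw [h0]; rfl)
      have h2 := deriv_bump_ne_zero β h1
      rw [hβ1] at h2
      exact ⟨h2.1, h2.2.trans hβ2⟩
    · refine ((fderiv ℝ β k).le_opNorm _).trans ?_
      simpa using hCb k
  have e2 := hlat 3 1 0 h31 (Or.inr ⟨rfl, Or.inr rfl⟩)
  have e3 := hlat 1 2 1 h12 (Or.inl ⟨rfl, Or.inl rfl⟩)
  have key : ∀ ρ : ℝ, K + 1 ≤ ρ → F - 3 * Complex.I *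
      ((∫ X, ((α (X 1) * (ρ⁻¹ * fderiv ℝ β (ρ⁻¹ • mom X) (EuclideanSpace.single 0 1)) : ℝ) : ℂ) *
        wDeriv s 3 1 X) +
      ∫ X, ((α (X 1) * (ρ⁻¹ * fderiv ℝ β (ρ⁻¹ • mom X) (EuclideanSpace.single 1 1)) : ℝ) : ℂ) *
        wDeriv s 1 2 X) =
      3 * Complex.I * ∫ k, ((β (ρ⁻¹ • k) : ℝ) : ℂ) * (bulkDensity σS k - bulkDensity σN k) := by
    intro ρ hρ
    have hK1 := h.one_le
    have hρ0 : 0 < ρ := by linarith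
    set ψ := wallCutoff α β ρ with hψ
    have hψc : ContDiff ℝ 1 ψ := contDiff_wallCutoff hαc hβc ρ
    set r : ℝ := max (L + 2) (2 * ρ) with hr
    have hψs : ∀ X, ψ X ≠ 0 → |X 1| ≤ r ∧ |X 2| ≤ r ∧ |X 3| ≤ r := fun X hX => by
      have h1 := hα0 _ (left_ne_zero_of_mul hX)
      have h2 := hβ0 _ (right_ne_zero_of_mul hX)
      rw [norm_smul, norm_inv, Real.norm_of_nonneg hρ0.le, inv_mul_le_iff₀ hρ0] at h2
      exact ⟨h1.trans (le_max_left _ _),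
        (abs_apply_le_norm (mom X) 0).trans ((h2.trans (by linarith)).trans (le_max_right _ _)),
        (abs_apply_le_norm (mom X) 1).trans ((h2.trans (by linarith)).trans (le_max_right _ _))⟩
    -- On the support of `dψ` either `|y| > L`, where the bulk gap applies, or `|k| ≥ ρ ≥ K`, where
    -- ellipticity does.
    have hco : ∀ X, fderiv ℝ ψ X ≠ 0 → Coercive (min c₀ c) (s X) := fun X hX => by
      refine h.coercive ?_
      by_contra! h1
      apply hX
      have h2 : deriv α (X 1) = 0 := by
        by_contra h2
        linarith [(hα' _ h2).1]
      have h3 : fderiv ℝ β (ρ⁻¹ • mom X) = 0 := by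
        by_contra h3
        have h4 := (deriv_bump_ne_zero β h3).1
        rw [hβ1, norm_smul, norm_inv, Real.norm_of_nonneg hρ0.le, le_inv_mul_iff₀ hρ0] at h4
        linarith [h1.2]
      rw [hψ, fderiv_wallCutoff hαc hβc, h2, h3]
      simp
    have hmomx : XInvariant (mom : Phase → Momentum) := fun X t => by
      ext i; fin_cases i <;> simp [mom]
    have hψx : XInvariant ψ := fun X t => by
      simp only [hψ, wallCutoff, hmomx X t]
      simp
    have hBψ : ∀ X, OverWall L K X → ψ =ᶠ[𝓝 X] 1 := fun X hX => by
      have h1 : {Y : Phase | |Y 1| < L + 1} ∈ 𝓝 X :=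
        (isOpen_lt (contDiff_coord (k := 0) 1).continuous.abs continuous_const).mem_nhds
          (show |X 1| < L + 1 by linarith [hX.2.1])
      have h2 : {Y : Phase | ‖mom Y‖ < ρ} ∈ 𝓝 X :=
        (isOpen_lt continuous_mom.norm continuous_const).mem_nhds
          (show ‖mom X‖ < ρ by linarith [hX.2.2])
      filter_upwards [h1, h2] with Y hY1 hY2
      have e1 : α (Y 1) = 1 := α.one_of_mem_closedBall (by
        rw [mem_closedBall_zero_iff]
        exact le_of_lt hY1)
      have e2 : β (ρ⁻¹ • mom Y) = 1 := β.one_of_mem_closedBall (by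
        rw [mem_closedBall_zero_iff, hβ1, norm_smul, norm_inv, Real.norm_of_nonneg hρ0.le,
          inv_mul_le_iff₀ hρ0, mul_one]
        exact le_of_lt hY2)
      simp only [hψ, wallCutoff, e1, e2, mul_one, Pi.one_apply]
    -- The three terms of `omega` are the two lateral ones, with `β` differentiated, and the normal
    -- one, with `α` differentiated.
    have hFω := eq_integral_omega h.smooth h.hermitian h.xInvariant hψc hψx hψs hpos hco
      (fun X hX => hX.1) hBψ (fun X hX => h.overWall hX) hF
    obtain ⟨D, hD0, hD⟩ := hψx.fderiv.exists_bound (hψc.continuous_fderiv one_ne_zero) r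
    obtain ⟨B, hBnn, hB⟩ := h.xInvariant.exists_pderiv_bound h.smooth r
    have hint : ∀ l i j : Fin 4, Integrable fun X =>
        ((fderiv ℝ ψ X (EuclideanSpace.single l 1) : ℝ) : ℂ) * wDeriv s i j X := fun l i j => by
      refine integrable_of_slab
        (C := D * (2 * n * B ^ 2 * (min c₀ c)⁻¹ * (1 + ((min c₀ c) ^ 2)⁻¹))) (r := r) ?_ ?_ ?_
      · refine StronglyMeasurable.aestronglyMeasurable (StronglyMeasurable.mul ?_
          (stronglyMeasurable_wDeriv hs1 i j))
        exact (Complex.continuous_ofReal.comp ((hψc.continuous_fderiv one_ne_zero).clm_apply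
          continuous_const)).stronglyMeasurable
      · intro X
        by_cases hX : X ∈ tsupport ψ
        · obtain ⟨h1, h2, h3⟩ := norm_le_of_support hψs hX
          exact norm_omega_term_le h.hermitian hpos (hco X) (hB X h1 h2 h3) (hD X h1 h2 h3) l i j
        · simp only [fderiv_eq_zero_of_notMem hX, zero_apply, Complex.ofReal_zero, zero_mul,
            norm_zero]
          have : 0 ≤ min c₀ c := hpos.le
          positivity
      · intro X hX
        by_contra h1
        have h2 : X ∉ tsupport ψ := fun h2 => h1 (norm_le_of_support hψs h2)
        exact hX (by simp [fderiv_eq_zero_of_notMem h2])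
    have hsplit : ∫ X, omega s ψ X =
        (∫ X, ((fderiv ℝ ψ X (EuclideanSpace.single 2 1) : ℝ) : ℂ) * wDeriv s 3 1 X) +
        (∫ X, ((fderiv ℝ ψ X (EuclideanSpace.single 3 1) : ℝ) : ℂ) * wDeriv s 1 2 X) +
        ∫ X, ((fderiv ℝ ψ X (EuclideanSpace.single 1 1) : ℝ) : ℂ) * wDeriv s 2 3 X := by
      rw [← integral_add (hint 2 3 1) (hint 3 1 2)]
      exact integral_add ((hint 2 3 1).add (hint 3 1 2)) (hint 1 2 3)
    have hS := fun X => fderiv_wallCutoff_single hαc hβc ρ X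
    obtain ⟨hI1, hI2⟩ := integral_deriv_bump α
    have hcs : HasCompactSupport fun k : Momentum => β (ρ⁻¹ • k) :=
      β.hasCompactSupport.comp_smul (inv_ne_zero hρ0.ne')
    have hn := integral_normal_term h.north h.south (h.smooth_north.of_le (by norm_num))
      (h.smooth_south.of_le (by norm_num)) h.hermitian_north h.hermitian_south h.gap_pos
      h.gap_north h.gap_south (hαc.continuous_deriv le_rfl) hα' hI1 hI2
      (b := fun k => β (ρ⁻¹ • k)) (hβc.continuous.comp (continuous_const_smul ρ⁻¹)) hcs
    rw [hFω, hsplit, ← hn]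
    simp only [hψ, (hS _).1, (hS _).2.1, (hS _).2.2]
    ring
  have hl := (((e2.add e3).const_mul (3 * Complex.I)).const_sub F)
  rw [add_zero, mul_zero, sub_zero] at hl
  refine hl.congr' ?_
  filter_upwards [eventually_ge_atTop (K + 1)] with ρ hρ
  exact key ρ hρ

end SmoothCutoff

/-! ### From smooth cutoffs to balls, and from bulk densities to curvatures. -/

section SharpCutoff

lemma measureReal_ball_momentum {r : ℝ} (hr : 0 ≤ r) :
    volume.real (Metric.ball (0 : Momentum) r) = Real.pi * r ^ 2 := by
  rw [measureReal_def, EuclideanSpace.volume_ball_fin_two, ENNReal.toReal_mul, ENNReal.toReal_pow,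
    ENNReal.toReal_ofReal hr, mul_comm]
  congr 1
  exact ENNReal.toReal_ofReal Real.pi_pos.le

/-- For densities of size `O(|k|⁻²)`, convergence of smoothly cut off integrals for arbitrarily
steep cutoffs implies convergence of the integrals over balls. -/
lemma tendsto_integral_ball {D : Momentum → ℂ} {A : ℂ} {M K : ℝ}
    (hD : ∀ ρ, IntegrableOn D (Metric.ball 0 ρ)) (hM : ∀ k, K ≤ ‖k‖ → ‖D k‖ ≤ M / ‖k‖ ^ 2)
    (hβ : ∀ β : ContDiffBump (0 : Momentum), β.rIn = 1 → β.rOut ≤ 2 →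
      Tendsto (fun ρ : ℝ => ∫ k, ((β (ρ⁻¹ • k) : ℝ) : ℂ) * D k) atTop (𝓝 A)) :
    Tendsto (fun ρ : ℝ => ∫ k in Metric.ball (0 : Momentum) ρ, D k) atTop (𝓝 A) := by
  have hM0 : 0 ≤ M := by
    have h1 : ‖(EuclideanSpace.single 0 (max K 1) : Momentum)‖ = max K 1 := by
      rw [PiLp.norm_single, Real.norm_of_nonneg (zero_le_one.trans (le_max_right _ _))]
    have h2 := (norm_nonneg _).trans (hM (EuclideanSpace.single 0 (max K 1))
      (by rw [h1]; exact le_max_left _ _))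
    have h3 : 0 < max K 1 := zero_lt_one.trans_le (le_max_right _ _)
    rw [h1] at h2
    exact (div_nonneg_iff.mp h2).elim (fun h => h.1) fun h => absurd h.2 (by
      have : 0 < max K 1 ^ 2 := by positivity
      linarith)
  rw [Metric.tendsto_atTop]
  intro ε hε
  have hden : 0 < 3 * M * Real.pi + 1 := by positivity
  -- The shell `ρ ≤ |k| < ρ(1 + δ)` has area `πρ²(2δ + δ²)` and the density there is at most `M/ρ²`.
  -- For `δ ≤ 1` the error is at most `3Mπδ`, whatever `ρ` is.
  obtain ⟨δ, hδ0, hδ1, hδ⟩ : ∃ δ : ℝ, 0 < δ ∧ δ ≤ 1 ∧ 3 * M * Real.pi * δ < ε / 2 := by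
    refine ⟨min 1 (ε / 2 / (3 * M * Real.pi + 1)), lt_min one_pos (by positivity),
      min_le_left _ _, ?_⟩
    calc 3 * M * Real.pi * min 1 (ε / 2 / (3 * M * Real.pi + 1))
        ≤ 3 * M * Real.pi * (ε / 2 / (3 * M * Real.pi + 1)) := by
          gcongr
          exact min_le_right _ _
      _ < (3 * M * Real.pi + 1) * (ε / 2 / (3 * M * Real.pi + 1)) := by
          apply mul_lt_mul_of_pos_right _ (by positivity)
          linarith
      _ = ε / 2 := by field_simp
  let β : ContDiffBump (0 : Momentum) := ⟨1, 1 + δ, one_pos, by linarith⟩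
  have hlim := Metric.tendsto_atTop.mp (hβ β rfl (show 1 + δ ≤ 2 by linarith)) (ε / 2) (half_pos hε)
  obtain ⟨ρ₁, hρ₁⟩ := hlim
  refine ⟨max ρ₁ (max K 1), fun ρ hρ => ?_⟩
  have h1 := hρ₁ ρ ((le_max_left _ _).trans hρ)
  have hKρ : K ≤ ρ := ((le_max_left _ _).trans (le_max_right _ _)).trans hρ
  have hρ0 : 0 < ρ := zero_lt_one.trans_le (((le_max_right _ _).trans (le_max_right _ _)).trans hρ)
  set S : Set Momentum := Metric.ball 0 (ρ * (1 + δ)) \ Metric.ball 0 ρ with hS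
  have hSm : MeasurableSet S := measurableSet_ball.diff measurableSet_ball
  have hone : ∀ k, ‖k‖ < ρ → β (ρ⁻¹ • k) = 1 := fun k hk => β.one_of_mem_closedBall (by
    rw [mem_closedBall_zero_iff, norm_smul, norm_inv, Real.norm_of_nonneg hρ0.le,
      inv_mul_le_iff₀ hρ0]
    show ‖k‖ ≤ ρ * 1
    linarith)
  have hzero : ∀ k, ρ * (1 + δ) ≤ ‖k‖ → β (ρ⁻¹ • k) = 0 := fun k hk => by
    by_contra h
    have h2 : ρ⁻¹ • k ∈ Function.support β := h
    rw [β.support_eq, mem_ball_zero_iff, norm_smul, norm_inv, Real.norm_of_nonneg hρ0.le,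
      inv_mul_lt_iff₀ hρ0] at h2
    exact absurd h2 (not_lt.mpr hk)
  have hβi : Integrable fun k => ((β (ρ⁻¹ • k) : ℝ) : ℂ) * D k := by
    have hi := (hD (ρ * (1 + δ))).integrable_indicator measurableSet_ball
    have hc : Continuous fun k : Momentum => ((β (ρ⁻¹ • k) : ℝ) : ℂ) :=
      Complex.continuous_ofReal.comp ((β.contDiff (n := 0)).continuous.comp (continuous_const_smul _))
    have h2 := hi.bdd_mul (c := 1) hc.aestronglyMeasurable (Eventually.of_forall fun k => by
      rw [Complex.norm_real, Real.norm_of_nonneg β.nonneg]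
      exact β.le_one)
    refine h2.congr (Eventually.of_forall fun k => ?_)
    by_cases hk : ‖k‖ < ρ * (1 + δ)
    · simp only [Set.indicator_of_mem (mem_ball_zero_iff.mpr hk)]
    · simp [hzero k (not_lt.mp hk)]
  have hi := (hD ρ).integrable_indicator measurableSet_ball
  have hdiff : ‖(∫ k, ((β (ρ⁻¹ • k) : ℝ) : ℂ) * D k) - ∫ k in Metric.ball (0 : Momentum) ρ, D k‖ ≤
      3 * M * Real.pi * δ := by
    rw [← integral_indicator measurableSet_ball, ← integral_sub hβi hi]
    have hle : ∀ k, ‖((β (ρ⁻¹ • k) : ℝ) : ℂ) * D k - (Metric.ball (0 : Momentum) ρ).indicator D k‖ ≤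
        S.indicator (fun _ => M / ρ ^ 2) k := fun k => by
      by_cases h2 : ‖k‖ < ρ
      · rw [Set.indicator_of_mem (mem_ball_zero_iff.mpr h2), hone k h2, Complex.ofReal_one, one_mul,
          sub_self, norm_zero]
        exact Set.indicator_nonneg (fun _ _ => by positivity) k
      · rw [Set.indicator_of_notMem (fun h => h2 (mem_ball_zero_iff.mp h)), sub_zero]
        by_cases h3 : ‖k‖ < ρ * (1 + δ)
        · have hkS : k ∈ S :=
            ⟨mem_ball_zero_iff.mpr h3, fun h => h2 (mem_ball_zero_iff.mp h)⟩
          rw [Set.indicator_of_mem hkS, norm_mul, Complex.norm_real,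
            Real.norm_of_nonneg β.nonneg]
          have h4 := hM k (hKρ.trans (not_lt.mp h2))
          refine (mul_le_of_le_one_left (norm_nonneg _) β.le_one).trans (h4.trans ?_)
          gcongr
          exact not_lt.mp h2
        · rw [hzero k (not_lt.mp h3)]
          simp only [Complex.ofReal_zero, zero_mul, norm_zero]
          exact Set.indicator_nonneg (fun _ _ => by positivity) k
    have hfin : volume S ≠ ⊤ := (measure_mono Set.sdiff_subset).trans_lt measure_ball_lt_top |>.ne
    have hSi : Integrable (S.indicator fun _ => M / ρ ^ 2) :=
      (integrableOn_const hfin).integrable_indicator hSm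
    refine (norm_integral_le_of_norm_le hSi (Eventually.of_forall hle)).trans ?_
    have hsub : Metric.ball (0 : Momentum) ρ ⊆ Metric.ball 0 (ρ * (1 + δ)) :=
      Metric.ball_subset_ball (by nlinarith)
    rw [integral_indicator_const _ hSm, measureReal_sdiff hsub measurableSet_ball,
      measureReal_ball_momentum hρ0.le, measureReal_ball_momentum (by positivity), smul_eq_mul]
    have : (Real.pi * (ρ * (1 + δ)) ^ 2 - Real.pi * ρ ^ 2) * (M / ρ ^ 2) =
        M * Real.pi * (2 * δ + δ ^ 2) := by
      field_simp
      ring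
    rw [this]
    have h5 : 0 ≤ M * Real.pi := by positivity
    nlinarith [mul_nonneg h5 (mul_nonneg hδ0.le (sub_nonneg.mpr hδ1))]
  calc dist (∫ k in Metric.ball (0 : Momentum) ρ, D k) A
      ≤ dist (∫ k in Metric.ball (0 : Momentum) ρ, D k) (∫ k, ((β (ρ⁻¹ • k) : ℝ) : ℂ) * D k) +
        dist (∫ k, ((β (ρ⁻¹ • k) : ℝ) : ℂ) * D k) A := dist_triangle _ _ _
    _ < ε / 2 + ε / 2 := by
        refine add_lt_add_of_le_of_lt ?_ h1
        rw [dist_comm, dist_eq_norm]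
        exact hdiff.trans hδ.le
    _ = ε := add_halves ε

variable {n : ℕ} {m L c₀ c C K : ℝ} {s : Phase → Mat n} {σN σS : Momentum → Mat n}

lemma integrableOn_bulkDensity {f : Momentum → Mat n} (hf : ContDiff ℝ 1 f)
    (hH : ∀ k, (f k).IsHermitian) {c : ℝ} (hc : 0 < c) (hco : ∀ k, Coercive c (f k)) (ρ : ℝ) :
    IntegrableOn (bulkDensity f) (Metric.ball 0 ρ) := by
  let β : ContDiffBump (0 : Momentum) := ⟨max ρ 1, max ρ 1 + 1, by positivity, by linarith⟩
  have h1 := (integral_bulkForm hf hH hc hco (β.contDiff (n := 0)).continuous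
    β.hasCompactSupport).1
  refine h1.integrableOn.congr_fun (fun k hk => ?_) measurableSet_ball
  have : β k = 1 := β.one_of_mem_closedBall
    (Metric.ball_subset_closedBall (Metric.ball_subset_ball (le_max_left ρ 1) hk))
  simp only [this, Complex.ofReal_one, one_mul]

lemma norm_bulkDensity_le {f : Momentum → Mat n} {c C t P : ℝ} {k : Momentum} (hc : 0 < c)
    (hP : 0 < P) (ht : 0 < t) (hH : (f k).IsHermitian) (hco : Coercive (c * P) (f k))
    (h : ∀ i, ‖pderiv i f k‖ ≤ C * (P / t)) :
    ‖bulkDensity f k‖ ≤ 2 * n * C ^ 2 * Real.pi * (c ^ 2)⁻¹ / t ^ 2 := by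
  have h0 : 0 ≤ C * (P / t) := (norm_nonneg _).trans (h 0)
  refine (norm_qForm_le hco hH (mul_pos hc hP) _ _).trans ?_
  calc _ ≤ 2 * n * (C * (P / t)) * (C * (P / t)) * (Real.pi * ((c * P) ^ 2)⁻¹) := by
        gcongr
        · exact h 0
        · exact h 1
    _ = _ := by field_simp

/-- The ellipticity and derivative bounds of the bulk symbols are read off from `s` at a point
beyond the wall, where `s` coincides with them nearby. -/
lemma IsWall.bulk_bound (h : IsWall m L c₀ c C K s σN σS) {k : Momentum} (hk : K ≤ ‖k‖) :
    ‖bulkDensity σS k - bulkDensity σN k‖ ≤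
      (2 * (2 * n * C ^ 2 * Real.pi * (c ^ 2)⁻¹)) / ‖k‖ ^ 2 := by
  have hk0 : 0 < ‖k‖ := zero_lt_one.trans_le (h.one_le.trans hk)
  have hP := Real.rpow_pos_of_pos hk0 m
  have h1c : Continuous fun X : Phase => X 1 := (contDiff_coord (k := 0) 1).continuous
  have hmk : ∀ y, mom (wallPoint y k) = k := fun y => mom_wallPoint y k
  have bN : ‖bulkDensity σN k‖ ≤ 2 * n * C ^ 2 * Real.pi * (c ^ 2)⁻¹ / ‖k‖ ^ 2 := by
    have hL : L < wallPoint (L + 1) k 1 := by simp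
    have hev : s =ᶠ[𝓝 (wallPoint (L + 1) k)] fun Y => σN (mom Y) := by
      filter_upwards [(isOpen_lt continuous_const h1c).mem_nhds hL] with Y hY
      exact h.north Y hY
    have hd := pderiv_comp_mom (f := σN) (X := wallPoint (L + 1) k)
      (h.smooth_north.differentiable two_ne_zero _)
    have hK : K ≤ ‖mom (wallPoint (L + 1) k)‖ := by rwa [hmk]
    refine norm_bulkDensity_le h.ell_pos hP hk0 (h.hermitian_north k) ?_ fun i => ?_
    · have := h.elliptic _ hK
      rwa [h.north _ hL, hmk] at this
    · fin_cases i
      · have := h.bound_k _ hK 2 (Or.inl rfl)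
        rwa [pderiv_congr hev, hd.1, hmk] at this
      · have := h.bound_k _ hK 3 (Or.inr rfl)
        rwa [pderiv_congr hev, hd.2, hmk] at this
  have bS : ‖bulkDensity σS k‖ ≤ 2 * n * C ^ 2 * Real.pi * (c ^ 2)⁻¹ / ‖k‖ ^ 2 := by
    have hL : wallPoint (-L - 1) k 1 < -L := by simp
    have hev : s =ᶠ[𝓝 (wallPoint (-L - 1) k)] fun Y => σS (mom Y) := by
      filter_upwards [(isOpen_lt h1c continuous_const).mem_nhds hL] with Y hY
      exact h.south Y hY
    have hd := pderiv_comp_mom (f := σS) (X := wallPoint (-L - 1) k)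
      (h.smooth_south.differentiable two_ne_zero _)
    have hK : K ≤ ‖mom (wallPoint (-L - 1) k)‖ := by rwa [hmk]
    refine norm_bulkDensity_le h.ell_pos hP hk0 (h.hermitian_south k) ?_ fun i => ?_
    · have := h.elliptic _ hK
      rwa [h.south _ hL, hmk] at this
    · fin_cases i
      · have := h.bound_k _ hK 2 (Or.inl rfl)
        rwa [pderiv_congr hev, hd.1, hmk] at this
      · have := h.bound_k _ hK 3 (Or.inr rfl)
        rwa [pderiv_congr hev, hd.2, hmk] at this
  refine (norm_sub_le _ _).trans ((add_le_add bS bN).trans (le_of_eq ?_))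
  ring

/-- Evaluation of the invariant by the curvatures of the bulk projectors. -/
theorem IsWall.tendsto_curvature (h : IsWall m L c₀ c C K s σN σS)
    (h31 : LateralParity m s 3 1) (h12 : LateralParity m s 1 2) {F : ℂ}
    (hF : ∀ u : Phase → ℝ, ContDiff ℝ 1 u → HasCompactSupport u →
      (∀ X, OverWall L K X → u =ᶠ[𝓝 X] 1) →
      24 * (Real.pi : ℂ) ^ 2 * F = -∫ X, wedge u (domainWallSymbol s) X) :
    Tendsto (fun ρ : ℝ => Complex.I / (2 * (Real.pi : ℂ)) * ∫ k in Metric.ball (0 : Momentum) ρ,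
      (curvature (fun k' => negProj (σS k')) k - curvature (fun k' => negProj (σN k')) k))
      atTop (𝓝 F) := by
  have hcurv : ∀ k, bulkDensity σS k - bulkDensity σN k = 4 * Real.pi *
      (curvature (fun k' => negProj (σS k')) k - curvature (fun k' => negProj (σN k')) k) :=
    fun k => by
      rw [bulkDensity, bulkDensity, curvature_negProj h.hermitian_south
        ((h.gap_south k).isUnit h.gap_pos) (h.smooth_south.differentiable two_ne_zero k),
        curvature_negProj h.hermitian_north
        ((h.gap_north k).isUnit h.gap_pos) (h.smooth_north.differentiable two_ne_zero k), mul_sub]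
  have hπ : (Real.pi : ℂ) ≠ 0 := by exact_mod_cast Real.pi_ne_zero
  have h1 : Tendsto (fun ρ : ℝ => ∫ k in Metric.ball (0 : Momentum) ρ,
      (bulkDensity σS k - bulkDensity σN k)) atTop
      (𝓝 ((3 * Complex.I)⁻¹ * (24 * (Real.pi : ℂ) ^ 2 * F))) := by
    refine tendsto_integral_ball (fun ρ => ?_) (fun k hk => h.bulk_bound hk) fun β h1 h2 => ?_
    · exact (integrableOn_bulkDensity (h.smooth_south.of_le (by norm_num)) h.hermitian_south
        h.gap_pos h.gap_south ρ).sub (integrableOn_bulkDensity (h.smooth_north.of_le (by norm_num))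
        h.hermitian_north h.gap_pos h.gap_north ρ)
    · have := (h.tendsto_smooth_cutoff h31 h12 hF β h1 h2).const_mul (3 * Complex.I)⁻¹
      refine this.congr fun ρ => ?_
      rw [inv_mul_cancel_left₀ (by simp)]
  have h2 := h1.const_mul (Complex.I / (2 * (Real.pi : ℂ)) * (4 * (Real.pi : ℂ))⁻¹)
  -- The normalizations match: `i/(2π)` from the Chern number, `1/(4π)` from the curvature, `1/(3i)`
  -- from the wedge expansion and `24π²` from the invariant multiply to 1.
  have e : Complex.I / (2 * (Real.pi : ℂ)) * (4 * (Real.pi : ℂ))⁻¹ *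
      ((3 * Complex.I)⁻¹ * (24 * (Real.pi : ℂ) ^ 2 * F)) = F := by
    field_simp
    ring
  rw [e] at h2
  refine h2.congr fun ρ => ?_
  simp only [hcurv]
  rw [integral_const_mul]
  field_simp

end SharpCutoff

/-! ### Polynomial functions of bounded degree and their leading behaviour. -/

section PolynomialFunctions

/-- Functions on the line that are polynomials of degree at most `d`. -/
def IsPolyLE (d : ℕ) (g : ℝ → ℂ) : Prop :=
  ∃ p : Polynomial ℂ, p.natDegree ≤ d ∧ ∀ r : ℝ, g r = p.eval (r : ℂ)

/-- A family of polynomials of bounded degree may be differentiated pointwise in the parameter. -/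
lemma IsPolyLE.of_hasDerivAt {d : ℕ} {G : ℝ → ℝ → ℂ} {G' : ℝ → ℂ} {t₀ : ℝ}
    (hG : ∀ t, IsPolyLE d (G t)) (h : ∀ r, HasDerivAt (fun t => G t r) (G' r) t₀) :
    IsPolyLE d G' := by
  set v : ℕ → ℂ := fun i => (((i : ℝ)) : ℂ) with hv
  set S := Finset.range (d + 1) with hS
  have hinj : Set.InjOn v S := fun i _ j _ hij => by
    simpa [hv] using hij
  have hdeg : ∀ q : Polynomial ℂ, q.degree < S.card → q.natDegree ≤ d := fun q hq => by
    rw [hS, Finset.card_range] at hq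
    exact Polynomial.natDegree_le_iff_degree_le.mpr (Order.lt_succ_iff.mp (by exact_mod_cast hq))
  -- A polynomial of degree at most `d` is a fixed linear combination of its values at the nodes `0,
  -- …, d`. Differentiating this identity in `t` shows that `G'` is its own interpolant.
  refine ⟨Lagrange.interpolate S v fun i => G' i,
    hdeg _ (Lagrange.degree_interpolate_lt _ hinj), fun r => ?_⟩
  have hsum : ∀ t, G t r = ∑ i ∈ S, G t i * (Lagrange.basis S v i).eval (r : ℂ) := fun t => by
    obtain ⟨p, hp, hpe⟩ := hG t
    have hp' : p.degree < S.card := by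
      rw [hS, Finset.card_range]
      refine (Polynomial.natDegree_le_iff_degree_le.mp hp).trans_lt ?_
      exact_mod_cast Nat.lt_succ_self d
    have h1 := Lagrange.eq_interpolate hinj hp'
    rw [hpe, h1, Lagrange.interpolate_apply, Polynomial.eval_finsetSum]
    refine Finset.sum_congr rfl fun i _ => ?_
    rw [Polynomial.eval_mul, Polynomial.eval_C, hpe i]
  have h2 : HasDerivAt (fun t => G t r)
      (∑ i ∈ S, G' i * (Lagrange.basis S v i).eval (r : ℂ)) t₀ := by
    simp only [hsum]
    exact HasDerivAt.fun_sum fun i _ => (h i).mul_const _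
  rw [(h r).unique h2, Lagrange.interpolate_apply, Polynomial.eval_finsetSum]
  simp only [Polynomial.eval_mul, Polynomial.eval_C]

lemma tendsto_poly_leading {d : ℕ} {p : Polynomial ℂ} (hp : p.natDegree ≤ d) (ε : ℂ) :
    Tendsto (fun r : ℝ => ((r : ℂ) ^ d)⁻¹ * p.eval (ε * r)) atTop (𝓝 (p.coeff d * ε ^ d)) := by
  have h1 : ∀ i ∈ Finset.range (d + 1), Tendsto
      (fun r : ℝ => ((r : ℂ) ^ d)⁻¹ * (p.coeff i * (ε * r) ^ i)) atTop
      (𝓝 (if i = d then p.coeff i * ε ^ i else 0)) := fun i hi => by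
    have hid : i ≤ d := Nat.lt_succ_iff.mp (Finset.mem_range.mp hi)
    by_cases h : i = d
    · subst h
      rw [if_pos rfl]
      refine tendsto_const_nhds.congr' ?_
      filter_upwards [eventually_gt_atTop 0] with r hr
      have : (r : ℂ) ≠ 0 := by exact_mod_cast hr.ne'
      rw [mul_pow]
      field_simp
    · rw [if_neg h]
      have h2 : Tendsto (fun r : ℝ => (((r ^ (d - i))⁻¹ : ℝ) : ℂ) * (p.coeff i * ε ^ i)) atTop
          (𝓝 (((0 : ℝ) : ℂ) * (p.coeff i * ε ^ i))) := by
        refine Tendsto.mul_const _ ((Complex.continuous_ofReal.tendsto 0).comp ?_)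
        exact tendsto_inv_atTop_zero.comp (tendsto_pow_atTop (by omega))
      rw [Complex.ofReal_zero, zero_mul] at h2
      refine h2.congr' ?_
      filter_upwards [eventually_gt_atTop 0] with r hr
      have hr' : (r : ℂ) ≠ 0 := by exact_mod_cast hr.ne'
      have h3 : (r : ℂ) ^ d = (r : ℂ) ^ (d - i) * (r : ℂ) ^ i := by
        rw [← pow_add, Nat.sub_add_cancel hid]
      rw [h3, mul_pow]
      push_cast
      field_simp
  have h2 := tendsto_finsetSum _ h1
  rw [Finset.sum_ite_eq' , if_pos (Finset.self_mem_range_succ d)] at h2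
  refine h2.congr fun r => ?_
  rw [Polynomial.eval_eq_sum_range' (Nat.lt_succ_of_le hp), Finset.mul_sum]

/-- Only the coefficient of degree `d` survives the division by `rᵈ`, and it changes by `(-1)ᵈ`
under `r ↦ -r`. The coefficient may vanish. -/
lemma IsPolyLE.tendsto {d : ℕ} {g : ℝ → ℂ} (h : IsPolyLE d g) :
    ∃ a : ℂ, Tendsto (fun r : ℝ => ((r : ℂ) ^ d)⁻¹ * g r) atTop (𝓝 a) ∧
      Tendsto (fun r : ℝ => ((r : ℂ) ^ d)⁻¹ * g (-r)) atTop (𝓝 ((-1) ^ d * a)) := by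
  obtain ⟨p, hp, hpe⟩ := h
  refine ⟨p.coeff d, ?_, ?_⟩
  · simpa [hpe] using tendsto_poly_leading hp 1
  · rw [mul_comm]
    simpa [hpe] using tendsto_poly_leading hp (-1)

lemma tendsto_mat_of_isPolyLE {n d : ℕ} {A : ℝ → Mat n} (h : ∀ p q, IsPolyLE d fun r => A r p q) :
    ∃ B : Mat n, Tendsto (fun r : ℝ => ((r : ℂ) ^ d)⁻¹ • A r) atTop (𝓝 B) ∧
      Tendsto (fun r : ℝ => ((r : ℂ) ^ d)⁻¹ • A (-r)) atTop (𝓝 ((-1 : ℂ) ^ d • B)) := by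
  choose B hB hB' using fun p q => (h p q).tendsto
  exact ⟨Matrix.of B, tendsto_pi_nhds.mpr fun p => tendsto_pi_nhds.mpr fun q => hB p q,
    tendsto_pi_nhds.mpr fun p => tendsto_pi_nhds.mpr fun q => hB' p q⟩

lemma isPolyLE_line {d : ℕ} (P : MvPolynomial (Fin 2) ℂ) (hP : P.totalDegree ≤ d) (k : Momentum) :
    IsPolyLE d fun r => MvPolynomial.eval (fun l => (((r • k) l : ℝ) : ℂ)) P := by
  refine ⟨MvPolynomial.aeval (fun l => Polynomial.C ((k l : ℝ) : ℂ) * Polynomial.X) P,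
    (MvPolynomial.aeval_natDegree_le P hP _ fun l => 
      (Polynomial.natDegree_C_mul_le _ _).trans Polynomial.natDegree_X_le).trans
      (mul_one d).le, fun r => ?_⟩
  rw [← Polynomial.coe_evalRingHom, ← RingHom.coe_coe (MvPolynomial.aeval _), ← RingHom.comp_apply]
  have h : (Polynomial.evalRingHom (r : ℂ)).comp
      ((MvPolynomial.aeval fun l => Polynomial.C ((k l : ℝ) : ℂ) * Polynomial.X :
        MvPolynomial (Fin 2) ℂ →ₐ[ℂ] Polynomial ℂ) : MvPolynomial (Fin 2) ℂ →+* Polynomial ℂ) =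
      MvPolynomial.eval fun l => (((r • k) l : ℝ) : ℂ) := by
    refine MvPolynomial.ringHom_ext (fun a => by simp) fun l => ?_
    rw [RingHom.comp_apply, RingHom.coe_coe, MvPolynomial.aeval_X, MvPolynomial.eval_X,
      Polynomial.coe_evalRingHom, Polynomial.eval_mul, Polynomial.eval_C, Polynomial.eval_X,
      PiLp.smul_apply, smul_eq_mul, Complex.ofReal_mul, mul_comm]
  rw [h]

end PolynomialFunctions

/-! ### Asymptotic evenness of the lateral densities under (a) and (b). -/

section Parity

variable {n : ℕ} {m L c₀ c C K : ℝ} {s : Phase → Mat n} {σN σS : Momentum → Mat n}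

lemma LateralParity.swap {i j : Fin 4} (h : LateralParity m s i j) : LateralParity m s j i := by
  intro Y h1 h2
  have h3 := (h Y h1 h2).neg
  rw [neg_zero] at h3
  refine h3.congr fun ρ => ?_
  simp only [wDeriv]
  rw [wForm_swap (s (scaleMap m ρ Y)) (pderiv i s _), wForm_swap (s (scaleMap m ρ (reflect Y)))
    (pderiv i s _)]
  ring

/-- The lateral densities vanish asymptotically if the variation across the wall is of lower
order. -/
lemma IsWall.lateralParity_of_lowerOrder (h : IsWall m L c₀ c C K s σN σS)
    (hB : ∀ ε : ℝ, 0 < ε → ∃ ρ : ℝ, ∀ X, ρ ≤ ‖mom X‖ → ‖pderiv 1 s X‖ ≤ ε * ‖mom X‖ ^ m)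
    {j : Fin 4} (hj : j = 2 ∨ j = 3) : LateralParity m s 1 j := by
  have key : ∀ Y : Phase, 1 ≤ ‖mom Y‖ → ‖mom Y‖ ≤ 2 → Tendsto (fun ρ : ℝ =>
      ((ρ ^ (m + 1) : ℝ) : ℂ) * wDeriv s 1 j (scaleMap m ρ Y)) atTop (𝓝 0) := by
    intro Y h1 h2
    rw [Metric.tendsto_atTop]
    intro ε hε
    -- This is the constant of `IsWall.scaled_bound` without the factor `B`. The factor `2ᵐ` below
    -- accounts for momenta up to `2ρ`.
    set Q : ℝ := 2 * n * (C * 2 ^ m) * c⁻¹ * (1 + (c ^ 2)⁻¹) * (1 + Y 0 ^ 2)⁻¹ with hQ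
    have hC := h.bound_nonneg
    have hc := h.ell_pos
    have hQ0 : 0 ≤ Q := by positivity
    have h2m : (0 : ℝ) < 2 ^ m := Real.rpow_pos_of_pos two_pos m
    obtain ⟨ρ₀, hρ₀⟩ := hB (ε / (2 ^ m * (Q + 1))) (by positivity)
    refine ⟨max ρ₀ K, fun ρ hρ => ?_⟩
    have hρK : K ≤ ρ := (le_max_right _ _).trans hρ
    have hρ0 : 0 < ρ := zero_lt_one.trans_le (h.one_le.trans hρK)
    have hle : ρ ≤ ‖mom (scaleMap m ρ Y)‖ := by
      rw [mom_scaleMap, norm_smul, Real.norm_of_nonneg hρ0.le]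
      nlinarith
    have h3 := hρ₀ (scaleMap m ρ Y) (((le_max_left _ _).trans hρ).trans hle)
    have h4 : ‖pderiv 1 s (scaleMap m ρ Y)‖ ≤ ε / (Q + 1) * ρ ^ m := by
      refine h3.trans ((mul_le_mul_of_nonneg_left (rpow_scaled_le h.order_pos hρ0 h1 h2).1
        (by positivity)).trans (le_of_eq ?_))
      field_simp
    have h5 := h.scaled_bound (i := 1) (j := j) (Or.inl ⟨rfl, hj⟩) hρK h1 h2 (by positivity) h4
    rw [dist_zero_right]
    refine h5.trans_lt ?_
    calc _ = ε * (Q / (Q + 1)) := by rw [hQ]; ring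
      _ < ε * 1 := by
          apply mul_lt_mul_of_pos_left _ hε
          rw [div_lt_one (by positivity)]
          linarith
      _ = ε := mul_one ε
  intro Y h1 h2
  have h3 := (key Y h1 h2).sub (key (reflect Y) (by simpa using h1) (by simpa using h2))
  rwa [sub_zero] at h3

lemma scaleMap_eq (ρ : ℝ) (Y : Phase) :
    setX 0 (scaleMap m ρ Y) = wallPoint (Y 1) (ρ • mom Y) := by
  ext i
  fin_cases i <;> simp [wallPoint, scaleMap]

lemma hasDerivAt_wallPoint (hs : Differentiable ℝ s) (y : ℝ) (k : Momentum) (p q : Fin n) :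
    HasDerivAt (fun t => s (wallPoint t k) p q) (pderiv 1 s (wallPoint y k) p q) y := by
  have h1 : HasDerivAt (fun t => wallPoint t k) (EuclideanSpace.single 1 1) y := by
    have h2 : (fun t => wallPoint t k) = fun t : ℝ =>
        wallPoint 0 k + t • (EuclideanSpace.single 1 1 : Phase) := by
      funext t
      ext i
      fin_cases i <;> simp [wallPoint]
    rw [h2]
    simpa using ((hasDerivAt_id y).smul_const (EuclideanSpace.single 1 1 : Phase)).const_add
      (wallPoint 0 k)
  exact (differentiableAt_entry (hs _) p q).hasFDerivAt.comp_hasDerivAt y h1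

/-- Differentiating along a moving direction yields the momentum derivative times `r`, a polynomial
in `r` of degree at most `d` like the symbol itself, so all three matrices can be scaled by the same
power. -/
lemma hasDerivAt_wallPoint_momentum (hs : Differentiable ℝ s) (y : ℝ) (k : Momentum) (r : ℝ)
    (l : Fin 2) (p q : Fin n) :
    HasDerivAt (fun t : ℝ => s (wallPoint y (r • (k + t • EuclideanSpace.single l 1))) p q)
      (r * pderiv (Fin.natAdd 2 l) s (wallPoint y (r • k)) p q) 0 := by
  have h1 : HasDerivAt (fun t : ℝ => wallPoint y (r • (k + t • EuclideanSpace.single l 1)))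
      (r • (EuclideanSpace.single (Fin.natAdd 2 l) 1 : Phase)) 0 := by
    have h2 : (fun t : ℝ => wallPoint y (r • (k + t • EuclideanSpace.single l 1))) = fun t : ℝ =>
        wallPoint y (r • k) + t • (r • (EuclideanSpace.single (Fin.natAdd 2 l) 1 : Phase)) := by
      funext t
      ext i
      fin_cases l <;> fin_cases i <;> simp [wallPoint] <;> ring
    rw [h2]
    simpa using ((hasDerivAt_id (0 : ℝ)).smul_const
      (r • (EuclideanSpace.single (Fin.natAdd 2 l) 1 : Phase))).const_add (wallPoint y (r • k))
  have h3 : HasFDerivAt (fun Y => s Y p q)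
      (fderiv ℝ (fun Y => s Y p q) (wallPoint y (r • k)))
      (wallPoint y (r • (k + (0 : ℝ) • EuclideanSpace.single l 1))) := by
    rw [zero_smul, add_zero]
    exact (differentiableAt_entry (hs _) p q).hasFDerivAt
  have h4 := h3.comp_hasDerivAt (0 : ℝ) h1
  rw [map_smul, Complex.real_smul] at h4
  exact h4

/-- The lateral densities of a differential operator of odd order are asymptotically even. -/
lemma IsWall.lateralParity_of_polynomial {d : ℕ} (h : IsWall d L c₀ c C K s σN σS) (hd : Odd d)
    (hpoly : ∀ (y : ℝ) (k : Momentum) (p q : Fin n),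
      IsPolyLE d fun r => s (wallPoint y (r • k)) p q) (l : Fin 2) :
    LateralParity d s 1 (Fin.natAdd 2 l) := by
  have hsd : Differentiable ℝ s := h.smooth.differentiable two_ne_zero
  intro Y h1 h2
  set y := Y 1 with hy
  set k := mom Y with hk
  obtain ⟨A, hA, hA'⟩ := tendsto_mat_of_isPolyLE (hpoly y k)
  obtain ⟨B, hB, hB'⟩ := tendsto_mat_of_isPolyLE (A := fun r => pderiv 1 s (wallPoint y (r • k)))
    fun p q => IsPolyLE.of_hasDerivAt (G := fun t r => s (wallPoint t (r • k)) p q) (t₀ := y)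
      (fun t => hpoly t k p q) fun r => hasDerivAt_wallPoint hsd y (r • k) p q
  obtain ⟨D, hD, hD'⟩ := tendsto_mat_of_isPolyLE (d := d)
    (A := fun r => (r : ℂ) • pderiv (Fin.natAdd 2 l) s (wallPoint y (r • k)))
    fun p q => IsPolyLE.of_hasDerivAt
      (G := fun t r => s (wallPoint y (r • (k + t • EuclideanSpace.single l 1))) p q) (t₀ := 0)
      (fun t => hpoly y _ p q) fun r => hasDerivAt_wallPoint_momentum hsd y k r l p q
  have hsx := h.xInvariant
  have es : ∀ (Z : Phase) (ρ : ℝ), s (scaleMap d ρ Z) = s (wallPoint (Z 1) (ρ • mom Z)) :=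
    fun Z ρ => by rw [← hsx.setX 0, scaleMap_eq]
  have ep : ∀ (i : Fin 4) (Z : Phase) (ρ : ℝ),
      pderiv i s (scaleMap d ρ Z) = pderiv i s (wallPoint (Z 1) (ρ • mom Z)) := fun i Z ρ => by
    rw [← (hsx.pderiv hsd i).setX 0, scaleMap_eq]
  -- Homogeneity with `t = ρᵈ` absorbs the prefactor `ρ^(d + 1)`: after scaling, all three arguments
  -- are divided by `ρᵈ` and the momentum derivative keeps a factor `ρ`.
  have hW : ∀ (Z : Phase) (ρ : ℝ), 0 < ρ →
      ((ρ ^ ((d : ℝ) + 1) : ℝ) : ℂ) * wDeriv s 1 (Fin.natAdd 2 l) (scaleMap d ρ Z) =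
        wForm (((ρ : ℂ) ^ d)⁻¹ • s (wallPoint (Z 1) (ρ • mom Z)))
          (((ρ : ℂ) ^ d)⁻¹ • pderiv 1 s (wallPoint (Z 1) (ρ • mom Z)))
          (((ρ : ℂ) ^ d)⁻¹ • (ρ : ℂ) •
            pderiv (Fin.natAdd 2 l) s (wallPoint (Z 1) (ρ • mom Z))) (Z 0) := fun Z ρ hρ => by
    have hρ' : (ρ : ℂ) ≠ 0 := by exact_mod_cast hρ.ne'
    rw [wDeriv, es, ep, ep, scaleMap_zero]
    set A₁ := s (wallPoint (Z 1) (ρ • mom Z))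
    set B₁ := pderiv 1 s (wallPoint (Z 1) (ρ • mom Z))
    set D₁ := pderiv (Fin.natAdd 2 l) s (wallPoint (Z 1) (ρ • mom Z))
    have h3 := wForm_smul (t := ρ ^ d) (pow_pos hρ d).ne' (((ρ : ℂ) ^ d)⁻¹ • A₁)
      (((ρ : ℂ) ^ d)⁻¹ • B₁) (((ρ : ℂ) ^ d)⁻¹ • (ρ : ℂ) • D₁) (ρ ^ d / ρ) (Z 0)
    push_cast at h3
    rw [smul_inv_smul₀ (pow_ne_zero d hρ'), smul_inv_smul₀ (pow_ne_zero d hρ'), smul_smul, smul_smul]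
      at h3
    have h4 : (ρ : ℂ) ^ d / ρ * (((ρ : ℂ) ^ d)⁻¹) * ρ = 1 := by field_simp
    rw [mul_assoc, ← mul_assoc] at h3
    rw [h4, one_smul] at h3
    rw [Real.rpow_add_one hρ.ne', Real.rpow_natCast, h3]
    push_cast
    field_simp
  have hscaled : ∀ (Z : Phase), 1 ≤ ‖mom Z‖ → ∀ ρ : ℝ, K ≤ ρ →
      Coercive c (((ρ : ℂ) ^ d)⁻¹ • s (wallPoint (Z 1) (ρ • mom Z))) := fun Z hZ ρ hρ => by
    have hρ0 : 0 < ρ := zero_lt_one.trans_le (h.one_le.trans hρ)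
    have h3 := (h.scaled_coercive hρ hZ).2.smul (t := (ρ ^ d)⁻¹) (by positivity)
    rw [es, Real.rpow_natCast, mul_comm c, inv_mul_cancel_left₀ (pow_pos hρ0 d).ne'] at h3
    push_cast at h3
    exact h3
  have hAc : Coercive c A := Coercive.of_tendsto (l := atTop)
    ((eventually_ge_atTop K).mono fun ρ hρ => hscaled Y h1 ρ hρ) hA
  have hAh : A.IsHermitian := by
    have h3 := (Filter.Tendsto.star hA)
    refine tendsto_nhds_unique h3 (hA.congr fun ρ => ?_)
    rw [star_smul, Matrix.star_eq_conjTranspose, (h.hermitian _).eq]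
    congr 1
    simp
  have hlim : Tendsto (fun ρ : ℝ => ((ρ ^ ((d : ℝ) + 1) : ℝ) : ℂ) *
      wDeriv s 1 (Fin.natAdd 2 l) (scaleMap d ρ Y)) atTop (𝓝 (wForm A B D (Y 0))) := by
    refine Tendsto.congr' ?_ (tendsto_wForm hA hB hD tendsto_const_nhds
      (isUnit_shift hAc hAh h.ell_pos (Y 0)))
    filter_upwards [eventually_gt_atTop 0] with ρ hρ
    rw [hW Y ρ hρ]
  have hlim' : Tendsto (fun ρ : ℝ => ((ρ ^ ((d : ℝ) + 1) : ℝ) : ℂ) *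
      wDeriv s 1 (Fin.natAdd 2 l) (scaleMap d ρ (reflect Y))) atTop (𝓝 (wForm A B D (Y 0))) := by
    -- For odd `d` the limits at `-k` are `-A` and `-B`. In `hD'` the factor `r` changes sign as
    -- well, so the momentum derivative multiplied by `ρ` tends to `D`. By `wForm_neg` the limit at
    -- `(-x, -k)` agrees with the one at `(x, k)`.
    rw [hd.neg_one_pow, neg_smul, one_smul] at hA' hB' hD'
    have hD'' := hD'.neg
    rw [neg_neg] at hD''
    have hu : IsUnit (shift (-A) (-Y 0)) := by
      refine isUnit_shift (c := c) ?_ hAh.neg h.ell_pos _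
      intro v
      simpa using hAc v
    rw [← wForm_neg]
    refine Tendsto.congr' ?_ (tendsto_wForm hA' hB' hD'' tendsto_const_nhds hu)
    filter_upwards [eventually_gt_atTop 0] with ρ hρ
    rw [hW (reflect Y) ρ hρ]
    simp only [reflect_one, mom_reflect, reflect_zero, neg_smul, smul_neg, neg_neg,
      Complex.ofReal_neg, hy, hk]
  have := hlim.sub hlim'
  rwa [sub_self] at this

end Parity

/-! ### From the symbol classes to the frozen wall. -/

section Symbols

variable {n : ℕ} {m L E₁ E₂ : ℝ} {σ : Phase → Mat n} {σN σS : Momentum → Mat n}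

lemma IsSymbol.contDiff (h : IsSymbol m σ) : ContDiff ℝ 2 σ :=
  contDiff_of_entries fun p q => by exact_mod_cast contDiff_infty.mp (h.smooth p q) 2

lemma norm_le_bracket (k : Momentum) : ‖k‖ ≤ bracket k :=
  Real.le_sqrt_of_sq_le (by linarith)

lemma bracket_le {k : Momentum} (hk : 1 ≤ ‖k‖) : bracket k ≤ 2 * ‖k‖ :=
  Real.sqrt_le_iff.mpr ⟨by positivity, by nlinarith⟩

/-- The first derivatives of a symbol. -/
lemma IsSymbol.exists_pderiv_bound (h : IsSymbol m σ) (hm : 0 < m) : ∃ C : ℝ, 0 ≤ C ∧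
    ∀ X, 1 ≤ ‖mom X‖ → ‖pderiv 1 σ X‖ ≤ C * ‖mom X‖ ^ m ∧
      ∀ j, (j = 2 ∨ j = 3) → ‖pderiv j σ X‖ ≤ C * (‖mom X‖ ^ m / ‖mom X‖) := by
  choose C hC using fun i : Fin 4 => h.bound 1 fun _ => i
  have hC' : ∀ i X p q, ‖pderiv i σ X p q‖ ≤
      C i * bracket (mom X) ^ (m - if 2 ≤ i then 1 else 0) := fun i X p q => by
    have h1 := hC i X p q
    rw [iteratedFDeriv_one_apply] at h1
    have h2 : ((Finset.univ.filter fun _ : Fin 1 => 2 ≤ i).card : ℝ) = if 2 ≤ i then 1 else 0 := by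
      split_ifs with h3 <;> simp [h3]
    rw [h2] at h1
    exact h1
  set M := ∑ i, |C i| with hM
  have hCM : ∀ i, C i ≤ M := fun i => (le_abs_self _).trans
    (Finset.single_le_sum (f := fun i => |C i|) (fun i _ => abs_nonneg _) (Finset.mem_univ i))
  have hM0 : 0 ≤ M := Finset.sum_nonneg fun i _ => abs_nonneg _
  refine ⟨n * (n * (M * 2 ^ m)), by positivity, fun X hX => ?_⟩
  have hk0 : 0 < ‖mom X‖ := zero_lt_one.trans_le hX
  have hb : bracket (mom X) ^ m ≤ 2 ^ m * ‖mom X‖ ^ m := by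
    rw [← Real.mul_rpow (by norm_num) hk0.le]
    exact Real.rpow_le_rpow (bracket_pos _).le (bracket_le hX) hm.le
  have hb0 := bracket_pos (mom X)
  constructor
  · have h1 : ∀ p q, ‖pderiv 1 σ X p q‖ ≤ M * (2 ^ m * ‖mom X‖ ^ m) := fun p q => by
      have h2 := hC' 1 X p q
      rw [if_neg (by decide), sub_zero] at h2
      exact h2.trans (mul_le_mul (hCM 1) hb (by positivity) hM0)
    refine (norm_le_of_entries _ h1).trans (le_of_eq ?_)
    ring
  · intro j hj
    have h1 : ∀ p q, ‖pderiv j σ X p q‖ ≤ M * (2 ^ m * ‖mom X‖ ^ m / ‖mom X‖) := fun p q => by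
      have h2 := hC' j X p q
      rw [if_pos (by rcases hj with rfl | rfl <;> decide), Real.rpow_sub_one hb0.ne'] at h2
      refine h2.trans (mul_le_mul (hCM j) ?_ (by positivity) hM0)
      exact div_le_div₀ (by positivity) hb hk0 (norm_le_bracket _)
    refine (norm_le_of_entries _ h1).trans (le_of_eq ?_)
    ring

/-- Ellipticity for large momenta. -/
lemma IsEllipticSymbol.exists_coercive (h : IsEllipticSymbol m σ) (hm : 0 < m) :
    ∃ c K : ℝ, 0 < c ∧ 1 ≤ K ∧ ∀ X, K ≤ ‖mom X‖ → Coercive (c * ‖mom X‖ ^ m) (σ X) := by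
  obtain ⟨C, hC, h⟩ := h
  have h1 : ∀ᶠ r : ℝ in atTop, 2 / C ≤ r ^ m := (tendsto_rpow_atTop hm).eventually_ge_atTop _
  obtain ⟨K, hK⟩ := eventually_atTop.mp h1
  refine ⟨C / 2, max K 1, half_pos hC, le_max_right _ _, fun X hX v => ?_⟩
  refine le_trans (mul_le_mul_of_nonneg_right ?_ (norm_nonneg _)) (h X v)
  have h2 := hK _ ((le_max_left _ _).trans hX)
  have h3 : ‖mom X‖ ^ m ≤ bracket (mom X) ^ m :=
    Real.rpow_le_rpow (norm_nonneg _) (norm_le_bracket _) hm.le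
  rw [div_le_iff₀ hC] at h2
  nlinarith

lemma pderiv_comp_setX (hs : Differentiable ℝ σ) {i : Fin 4} (hi : i ≠ 0) (X : Phase) :
    pderiv i (fun X => σ (setX 0 X)) X = pderiv i σ (setX 0 X) := by
  have h1 : HasFDerivAt (fun X : Phase => setX 0 X) (ContinuousLinearMap.id ℝ Phase -
      (EuclideanSpace.proj (𝕜 := ℝ) (0 : Fin 4)).smulRight (EuclideanSpace.single 0 1 : Phase)) X := by
    have h2 : (fun X : Phase => setX 0 X) = (ContinuousLinearMap.id ℝ Phase -
      (EuclideanSpace.proj (𝕜 := ℝ) (0 : Fin 4)).smulRight (EuclideanSpace.single 0 1 : Phase) :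
      Phase →L[ℝ] Phase) := by
      funext Y
      simp [setX, sub_eq_add_neg]
    rw [h2]
    exact ContinuousLinearMap.hasFDerivAt _
  have h3 : HasFDerivAt (fun X => σ (setX 0 X)) _ X := (hs (setX 0 X)).hasFDerivAt.comp X h1
  rw [pderiv_eq_fderiv h3.differentiableAt, pderiv_eq_fderiv (hs _), h3.fderiv,
    ContinuousLinearMap.comp_apply]
  congr 1
  simp [hi.symm]

lemma contDiff_wallPoint {k : WithTop ℕ∞} (y : ℝ) : ContDiff ℝ k (wallPoint y) := by
  rw [contDiff_euclidean]
  intro i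
  have h : ∀ l : Fin 2, ContDiff ℝ k fun v : Momentum => v l := fun l =>
    (EuclideanSpace.proj (𝕜 := ℝ) l).contDiff
  fin_cases i
  · exact contDiff_const
  · exact contDiff_const
  · exact h 0
  · exact h 1

lemma IsHermitianElliptic.contDiff_bulk {f : Momentum → Mat n}
    (h : IsHermitianElliptic m fun X => f (mom X)) : ContDiff ℝ 2 f := by
  have h1 := h.symbol.contDiff.comp (contDiff_wallPoint 0)
  have h2 : (fun X => f (mom X)) ∘ wallPoint 0 = f := by
    funext k
    simp
  rwa [h2] at h1

lemma IsHermitianElliptic.hermitian_bulk {f : Momentum → Mat n}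
    (h : IsHermitianElliptic m fun X => f (mom X)) (k : Momentum) : (f k).IsHermitian := by
  simpa using h.hermitian (wallPoint 0 k)

/-- The interface symbol frozen at `x = 0`. -/
noncomputable def frozen (σ : Phase → Mat n) (X : Phase) : Mat n := σ (setX 0 X)

/-- All bounds on `σ` are uniform in `x` and hence survive freezing. For the same reason the points
that are not good for any choice of the frozen coordinate lie over the same bounded part of the wall
as the singularities of the frozen symbol. -/
lemma InterfaceHamiltonian.exists_isWall (h : InterfaceHamiltonian m σ σN σS L E₁ E₂)
    (h0 : (0 : ℝ) ∈ Set.Ioo E₁ E₂) : ∃ c₀ c C K : ℝ, IsWall m L c₀ c C K (frozen σ) σN σS ∧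
      ∀ X, ¬IsGood σ X → OverWall L K X := by
  obtain ⟨C, hC0, hC⟩ := h.interface.symbol.exists_pderiv_bound h.order_pos
  obtain ⟨c, K, hc, hK1, hK⟩ := h.interface.elliptic.exists_coercive h.order_pos
  have hσ2 := h.interface.symbol.contDiff
  have hgap : 0 < min (-E₁) E₂ := lt_min (by linarith [h0.1]) h0.2
  have gN : ∀ k, Coercive (min (-E₁) E₂) (σN k) := fun k =>
    coercive_of_gap (h.bulk_north.hermitian_bulk k) h0 fun E hE => h.gap_north E hE k
  have gS : ∀ k, Coercive (min (-E₁) E₂) (σS k) := fun k =>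
    coercive_of_gap (h.bulk_south.hermitian_bulk k) h0 fun E hE => h.gap_south E hE k
  refine ⟨min (-E₁) E₂, c, C, K, ?_, fun X hX => ?_⟩
  · exact
    { order_pos := h.order_pos
      width_pos := h.width_pos
      gap_pos := hgap
      ell_pos := hc
      one_le := hK1
      bound_nonneg := hC0
      smooth := hσ2.comp (contDiff_setX contDiff_const)
      hermitian := fun X => h.interface.hermitian _
      xInvariant := xInvariant_comp_setX σ 0
      north := fun X hX => by rw [frozen, h.eq_north _ (by simpa using hX), mom_setX]
      south := fun X hX => by rw [frozen, h.eq_south _ (by simpa using hX), mom_setX]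
      smooth_north := h.bulk_north.contDiff_bulk
      smooth_south := h.bulk_south.contDiff_bulk
      gap_north := gN
      gap_south := gS
      elliptic := fun X hX => by simpa [frozen] using hK (setX 0 X) (by simpa using hX)
      bound_y := fun X hX => by
        have h1 := (hC (setX 0 X) (by simpa using hK1.trans hX)).1
        rw [mom_setX] at h1
        exact (congrArg norm (pderiv_comp_setX (i := 1) (hσ2.differentiable two_ne_zero)
          (by decide) X)).trans_le h1
      bound_k := fun X hX j hj => by
        have h1 := (hC (setX 0 X) (by simpa using hK1.trans hX)).2 j hj
        rw [mom_setX] at h1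
        exact (congrArg norm (pderiv_comp_setX (i := j) (hσ2.differentiable two_ne_zero)
          (by rcases hj with rfl | rfl <;> decide) X)).trans_le h1 }
  · simp only [IsGood, not_or, not_not, not_forall] at hX
    obtain ⟨hX0, x, hx⟩ := hX
    refine ⟨hX0, ?_, ?_⟩ <;> by_contra! h1
    · apply hx
      rcases lt_abs.mp h1 with h2 | h2
      · rw [h.eq_north _ (by simpa using h2)]
        exact (gN _).isUnit hgap
      · rw [h.eq_south _ (by simpa using (lt_neg.mp h2))]
        exact (gS _).isUnit hgap
    · refine hx ((hK (setX x X) (by simpa using h1.le)).isUnit ?_)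
      have : 0 < ‖mom (setX x X)‖ := by
        rw [mom_setX]
        linarith
      positivity

lemma OverWall.norm_le {K : ℝ} {X : Phase} (h : OverWall L K X) : ‖X‖ ≤ 2 * max L K := by
  have h1 : setX 0 X = X := by
    rw [← h.1, setX_self]
  rw [← h1]
  exact norm_setX_zero_le (h.2.1.trans (le_max_left _ _))
    (((abs_apply_le_norm (mom X) 0).trans h.2.2).trans (le_max_right _ _))
    (((abs_apply_le_norm (mom X) 1).trans h.2.2).trans (le_max_right _ _))

lemma InterfaceHamiltonian.exists_invertibleOutside (h : InterfaceHamiltonian m σ σN σS L E₁ E₂)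
    (h0 : (0 : ℝ) ∈ Set.Ioo E₁ E₂) :
    ∃ R : ℝ, 0 < R ∧ InvertibleOutside (domainWallSymbol σ) R := by
  obtain ⟨c₀, c, C, K, hw, hg⟩ := h.exists_isWall h0
  have hL := h.width_pos
  refine ⟨2 * max L K + 1, by positivity, fun X hX => ?_⟩
  have h1 : IsGood σ X := by
    by_contra h1
    linarith [(hg X h1).norm_le]
  have := isUnit_domainWallSymbol_of_isGood h.interface.hermitian h1 (X 0)
  rwa [setX_self] at this

lemma InterfaceHamiltonian.lateralParity {c₀ c C K : ℝ}
    (h : InterfaceHamiltonian m σ σN σS L E₁ E₂)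
    (hab : LowerOrderWall m σ ∨ ∃ d : ℕ, Odd d ∧ m = (d : ℝ) ∧ IsDifferentialSymbol d σ)
    (hw : IsWall m L c₀ c C K (frozen σ) σN σS) (l : Fin 2) :
    LateralParity m (frozen σ) 1 (Fin.natAdd 2 l) := by
  have hσ1 := h.interface.symbol.contDiff.differentiable two_ne_zero
  rcases hab with ha | ⟨d, hd, rfl, hb⟩
  · refine hw.lateralParity_of_lowerOrder (fun ε hε => ?_) (by fin_cases l <;> decide)
    have h2m : (0 : ℝ) < 2 ^ m := Real.rpow_pos_of_pos two_pos m
    -- The factor `n²` is lost in passing from entries to the norm, and `2ᵐ` in passing from `⟨k⟩`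
    -- to `|k|`. The added 1 covers `n = 0`.
    obtain ⟨ρ, hρ⟩ := ha (ε / (2 ^ m * (n * n + 1))) (by positivity)
    refine ⟨max ρ 1, fun X hX => ?_⟩
    have hk0 : 0 < ‖mom X‖ := zero_lt_one.trans_le ((le_max_right _ _).trans hX)
    have hb : bracket (mom X) ^ m ≤ 2 ^ m * ‖mom X‖ ^ m := by
      rw [← Real.mul_rpow (by norm_num) hk0.le]
      exact Real.rpow_le_rpow (bracket_pos _).le (bracket_le ((le_max_right _ _).trans hX))
        h.order_pos.le
    have h1 : pderiv 1 (frozen σ) X = pderiv 1 σ (setX 0 X) :=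
      pderiv_comp_setX hσ1 (by decide) X
    have h2 := norm_le_of_entries (pderiv 1 σ (setX 0 X)) fun p q =>
      hρ (setX 0 X) p q (by simpa using (le_max_left _ _).trans hX)
    rw [h1]
    refine h2.trans ?_
    rw [mom_setX]
    calc (n : ℝ) * (n * (ε / (2 ^ m * (n * n + 1)) * bracket (mom X) ^ m))
        ≤ n * (n * (ε / (2 ^ m * (n * n + 1)) * (2 ^ m * ‖mom X‖ ^ m))) := by gcongr
      _ = ε * ‖mom X‖ ^ m * (n * n / (n * n + 1)) := by field_simp
      _ ≤ ε * ‖mom X‖ ^ m * 1 := by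
          gcongr
          rw [div_le_one (by positivity)]
          linarith
      _ = _ := mul_one _
  · refine hw.lateralParity_of_polynomial hd (fun y k p q => ?_) l
    obtain ⟨P, hP, hPe⟩ := hb 0 y p q
    have h1 := isPolyLE_line P hP k
    obtain ⟨g, hg, hge⟩ := h1
    refine ⟨g, hg, fun r => ?_⟩
    have : setX 0 (wallPoint y (r • k)) = wallPoint y (r • k) := by
      have h2 : wallPoint y (r • k) 0 = 0 := rfl
      rw [← h2, setX_self]
    change σ (setX 0 (wallPoint y (r • k))) p q = _
    rw [this]
    exact (hPe (r • k)).trans (hge r)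

/-- The invariant of an interface Hamiltonian in terms of the curvatures of the bulk projectors. -/
theorem InterfaceHamiltonian.tendsto_curvature (h : InterfaceHamiltonian m σ σN σS L E₁ E₂)
    (h0 : (0 : ℝ) ∈ Set.Ioo E₁ E₂)
    (hab : LowerOrderWall m σ ∨ ∃ d : ℕ, Odd d ∧ m = (d : ℝ) ∧ IsDifferentialSymbol d σ) {R : ℝ}
    (hR : 0 < R) (hinv : InvertibleOutside (domainWallSymbol σ) R) :
    Tendsto (fun ρ : ℝ => Complex.I / (2 * (Real.pi : ℂ)) * ∫ k in Metric.ball (0 : Momentum) ρ,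
      (curvature (fun k' => negProj (σS k')) k - curvature (fun k' => negProj (σN k')) k))
      atTop (𝓝 (fedosovHormander (domainWallSymbol σ) R)) := by
  obtain ⟨c₀, c, C, K, hw, hg⟩ := h.exists_isWall h0
  have h1 := h.lateralParity hab hw
  -- The pair `(3, 1)` is obtained from `(1, 3)` by antisymmetry of the form.
  refine hw.tendsto_curvature (h1 1).swap (h1 0) fun u hu huc hu1 => ?_
  exact fedosovHormander_eq_freeze h.interface.symbol.contDiff h.interface.hermitian
    (fun X hX => ((hg X hX).norm_le.trans_lt (lt_add_one _))) hR hinv hu huc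
    fun X hX => hu1 X (hg X hX)

end Symbols

/-! ### The bulk-difference projector on the sphere. -/

section SphereProjector

variable {n : ℕ} {m : ℝ} {PN PS Pinf : Momentum → Mat n}

lemma norm_fderiv_momentum_le {f : Momentum → Mat n} {k : Momentum}
    (hf : DifferentiableAt ℝ f k) {M : ℝ} (hM : ∀ i, ‖pderiv i f k‖ ≤ M) :
    ‖fderiv ℝ f k‖ ≤ 2 * M := by
  have hM0 : 0 ≤ M := (norm_nonneg _).trans (hM 0)
  refine ContinuousLinearMap.opNorm_le_bound _ (by positivity) fun v => ?_
  have hv : v = v 0 • (EuclideanSpace.single 0 1 : Momentum) +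
      v 1 • (EuclideanSpace.single 1 1 : Momentum) := by
    ext i; fin_cases i <;> simp
  have h : ∀ i, ‖v i • fderiv ℝ f k (EuclideanSpace.single i 1)‖ ≤ ‖v‖ * M := fun i => by
    rw [norm_smul, ← pderiv_eq_fderiv hf]
    exact mul_le_mul (abs_apply_le_norm v i) (hM i) (norm_nonneg _) (norm_nonneg _)
  conv_lhs => rw [hv]
  rw [map_add, map_smul, map_smul]
  refine (norm_add_le _ _).trans ((add_le_add (h 0) (h 1)).trans (le_of_eq ?_))
  ring

/-- Uniform Lipschitz continuity of the directions at large momenta. -/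
def AngularLipschitz (P : Momentum → Mat n) : Prop :=
  ∃ C r₀ : ℝ, ∀ r, r₀ ≤ r → ∀ θ θ' : Momentum, ‖θ‖ = 1 → ‖θ'‖ = 1 → ‖θ - θ'‖ ≤ 1 / 2 →
    ‖P (r • θ) - P (r • θ')‖ ≤ C * ‖θ - θ'‖

/-- On the sphere of radius `r` the symbol varies by `O(r^(m-1)) · r‖θ - θ'‖`, while its gap grows
like `rᵐ`. The quotient, which bounds the variation of the projector, does not depend on `r`.
Directions at distance at most `1/2` keep the segment outside radius `r/2`, where the symbol bounds
hold. -/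
lemma IsHermitianElliptic.angularLipschitz {f : Momentum → Mat n}
    (h : IsHermitianElliptic m fun X => f (mom X)) (hm : 0 < m) :
    AngularLipschitz fun k => negProj (f k) := by
  have hfd : Differentiable ℝ f := h.contDiff_bulk.differentiable two_ne_zero
  obtain ⟨C, hC0, hC⟩ := h.symbol.exists_pderiv_bound hm
  obtain ⟨c, K, hc, hK1, hK⟩ := h.elliptic.exists_coercive hm
  have hCk : ∀ k : Momentum, 1 ≤ ‖k‖ → ∀ i, ‖pderiv i f k‖ ≤ C * (‖k‖ ^ m / ‖k‖) := fun k hk i => by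
    have h1 := (hC (wallPoint 0 k) (by simpa using hk)).2
    have h2 := pderiv_comp_mom (X := wallPoint 0 k) (hfd _)
    rw [mom_wallPoint] at h1 h2
    fin_cases i
    · have h3 := h1 2 (Or.inl rfl)
      rwa [h2.1] at h3
    · have h3 := h1 3 (Or.inr rfl)
      rwa [h2.2] at h3
  refine ⟨n * (n * (2 * C / c)), 2 * K, fun r hr θ θ' hθ hθ' hd => ?_⟩
  have hr0 : 0 < r := by linarith
  have hseg : ∀ k ∈ segment ℝ (r • θ') (r • θ), r / 2 ≤ ‖k‖ ∧ ‖k‖ ≤ r := fun k hk => by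
    have e1 : ‖r • θ'‖ = r := by rw [norm_smul, hθ', mul_one, Real.norm_of_nonneg hr0.le]
    have e2 : ‖r • θ‖ = r := by rw [norm_smul, hθ, mul_one, Real.norm_of_nonneg hr0.le]
    constructor
    · have h1 := norm_sub_le_of_mem_segment hk
      rw [← smul_sub, norm_smul, Real.norm_of_nonneg hr0.le] at h1
      have h2 := norm_sub_norm_le (r • θ') k
      rw [norm_sub_rev, e1] at h2
      nlinarith
    · have h1 : segment ℝ (r • θ') (r • θ) ⊆ Metric.closedBall 0 r :=
        (convex_closedBall (0 : Momentum) r).segment_subset (by simp [e1]) (by simp [e2])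
      simpa using h1 hk
  have hP : 0 < r ^ m := Real.rpow_pos_of_pos hr0 m
  have hbound : ∀ k ∈ segment ℝ (r • θ') (r • θ), ‖fderiv ℝ f k‖ ≤ 4 * C * (r ^ m / r) :=
    fun k hk => by
      obtain ⟨h1, h2⟩ := hseg k hk
      have hk0 : 0 < ‖k‖ := by linarith
      have h3 : ‖k‖ ^ m / ‖k‖ ≤ r ^ m / (r / 2) := by gcongr
      refine (norm_fderiv_momentum_le (hfd k) fun i => (hCk k (by linarith) i).trans
        (mul_le_mul_of_nonneg_left h3 hC0)).trans (le_of_eq ?_)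
      field_simp
      ring
  have hdiff := (convex_segment (r • θ') (r • θ)).norm_image_sub_le_of_norm_fderiv_le
    (fun k _ => hfd k) hbound (left_mem_segment ℝ _ _) (right_mem_segment ℝ _ _)
  rw [← smul_sub, norm_smul, Real.norm_of_nonneg hr0.le] at hdiff
  have hco : ∀ θ : Momentum, ‖θ‖ = 1 → Coercive (c * r ^ m) (f (r • θ)) := fun θ hθ => by
    have e : ‖r • θ‖ = r := by rw [norm_smul, hθ, mul_one, Real.norm_of_nonneg hr0.le]
    have h1 := hK (wallPoint 0 (r • θ)) (by rw [mom_wallPoint, e]; linarith)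
    rwa [mom_wallPoint, e] at h1
  refine (norm_negProj_sub_le (h.hermitian_bulk _) (h.hermitian_bulk _) (mul_pos hc hP)
    (hco θ' hθ') (hco θ hθ)).trans ?_
  have h4 : ‖f (r • θ) - f (r • θ')‖ / (2 * (c * r ^ m)) ≤ 2 * C / c * ‖θ - θ'‖ := by
    rw [div_le_iff₀ (by positivity)]
    refine hdiff.trans (le_of_eq ?_)
    field_simp
    ring
  rw [mul_assoc, mul_assoc]
  gcongr

/-- Equicontinuity in the direction upgrades the limit along a single ray to a limit along points
whose radius diverges and whose direction converges. -/
lemma AngularLipschitz.tendsto {ι : Type*} {l : Filter ι} {P : Momentum → Mat n}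
    (h : AngularLipschitz P) {θ₀ : Momentum} (hθ₀ : ‖θ₀‖ = 1) {Q : Mat n}
    (hQ : Tendsto (fun r : ℝ => P (r • θ₀)) atTop (𝓝 Q)) {r : ι → ℝ} (hr : Tendsto r l atTop)
    {u : ι → Momentum} (hu : ∀ᶠ i in l, ‖u i‖ = 1) (hu₀ : Tendsto u l (𝓝 θ₀)) :
    Tendsto (fun i => P (r i • u i)) l (𝓝 Q) := by
  obtain ⟨C, r₀, hC⟩ := h
  have h1 : Tendsto (fun i => ‖u i - θ₀‖) l (𝓝 0) := tendsto_iff_norm_sub_tendsto_zero.mp hu₀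
  have h2 : Tendsto (fun i => P (r i • u i) - P (r i • θ₀)) l (𝓝 0) := by
    refine squeeze_zero_norm' ?_ (by simpa using h1.const_mul C)
    filter_upwards [hu, hr.eventually_ge_atTop r₀,
      h1.eventually_le_const (show (0 : ℝ) < 1 / 2 by norm_num)] with i hi1 hi2 hi3
    exact hC _ hi2 _ _ hi1 hθ₀ hi3
  simpa using h2.add (hQ.comp hr)

lemma sphere_norm (φ : Sphere2) : ‖(!₂[φ.1 0, φ.1 1] : Momentum)‖ ^ 2 + φ.1 2 ^ 2 = 1 := by
  have h := φ.2
  rw [mem_sphere_zero_iff_norm, EuclideanSpace.norm_eq, Real.sqrt_eq_one] at h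
  rw [EuclideanSpace.norm_eq, Real.sq_sqrt (by positivity)]
  simp only [Fin.sum_univ_three, Fin.sum_univ_two, Real.norm_eq_abs, sq_abs] at h ⊢
  exact h

lemma continuous_sphere_coord (i : Fin 3) : Continuous fun φ : Sphere2 => φ.1 i :=
  (EuclideanSpace.proj (𝕜 := ℝ) i).continuous.comp continuous_subtype_val

lemma continuous_sphere_plane : Continuous fun φ : Sphere2 => (!₂[φ.1 0, φ.1 1] : Momentum) := by
  refine (PiLp.continuous_toLp 2 _).comp (continuous_pi fun i => ?_)
  fin_cases i
  · exact continuous_sphere_coord 0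
  · exact continuous_sphere_coord 1

lemma sphereToPlane_eq (φ : Sphere2) : sphereToPlane φ =
    |φ.1 2|⁻¹ • (!₂[φ.1 0, φ.1 1] : Momentum) := by
  ext i
  fin_cases i <;> simp [sphereToPlane, div_eq_inv_mul]

lemma continuousAt_sphereToPlane {φ : Sphere2} (h : φ.1 2 ≠ 0) : ContinuousAt sphereToPlane φ := by
  rw [show sphereToPlane = _ from funext sphereToPlane_eq]
  exact ((continuous_sphere_coord 2).abs.continuousAt.inv₀ (abs_ne_zero.mpr h)).smul
    continuous_sphere_plane.continuousAt

/-- The bulk-difference projector is continuous. -/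
lemma continuous_bulkDifferenceProj (hN : Continuous PN) (hS : Continuous PS)
    (hNl : AngularLipschitz PN) (hSl : AngularLipschitz PS) (h : GluesAtInfinity PN PS Pinf) :
    Continuous (bulkDifferenceProj PN PS Pinf) := by
  rw [continuous_iff_continuousAt]
  intro φ
  have h2c := continuous_sphere_coord 2
  rcases lt_trichotomy (φ.1 2) 0 with h0 | h0 | h0
  · have hev : bulkDifferenceProj PN PS Pinf =ᶠ[𝓝 φ] fun φ => PS (sphereToPlane φ) := by
      filter_upwards [(isOpen_lt h2c continuous_const).mem_nhds h0] with ψ hψ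
      have hψ' : ψ.1 2 < 0 := hψ
      rw [bulkDifferenceProj, if_neg (not_lt.mpr hψ'.le), if_pos hψ']
    exact (hS.continuousAt.comp (continuousAt_sphereToPlane h0.ne)).congr hev.symm
  · set θ₀ : Momentum := !₂[φ.1 0, φ.1 1] with hθ₀
    have hn : ‖θ₀‖ = 1 := by
      have := sphere_norm φ
      rw [h0, ← hθ₀] at this
      exact (pow_eq_one_iff_of_nonneg (norm_nonneg _) two_ne_zero).mp (by linarith)
    set w : Sphere2 → Momentum := fun ψ => !₂[ψ.1 0, ψ.1 1] with hw
    have hwt : Tendsto w (𝓝 φ) (𝓝 θ₀) := continuous_sphere_plane.tendsto φ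
    have hwn : Tendsto (fun ψ => ‖w ψ‖) (𝓝 φ) (𝓝 1) := hn ▸ hwt.norm
    have hval : bulkDifferenceProj PN PS Pinf φ = Pinf θ₀ := by
      rw [bulkDifferenceProj, h0, if_neg (lt_irrefl _), if_neg (lt_irrefl _)]
    have hopen : ∀ {S : Set Sphere2} {P : Momentum → Mat n}, (∀ ψ ∈ S, ψ.1 2 ≠ 0) →
        AngularLipschitz P → Tendsto (fun r : ℝ => P (r • θ₀)) atTop (𝓝 (Pinf θ₀)) →
        ∀ {l : Filter Sphere2}, l ≤ 𝓝 φ → (∀ᶠ ψ in l, ψ ∈ S) →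
        Tendsto (fun ψ => P (sphereToPlane ψ)) l (𝓝 (Pinf θ₀)) := by
      intro S P hSne hP hlim l hl hlS
      have hwl := hwn.mono_left hl
      have hpos : ∀ᶠ ψ in l, 0 < ‖w ψ‖ := hwl.eventually (lt_mem_nhds one_pos)
      have h3 : Tendsto (fun ψ : Sphere2 => |ψ.1 2|) l (𝓝[>] 0) := by
        refine tendsto_nhdsWithin_iff.mpr ⟨?_, ?_⟩
        · have := (h2c.abs.tendsto φ).mono_left hl
          simpa [h0] using this
        · filter_upwards [hlS] with ψ hψ
          exact abs_pos.mpr (hSne ψ hψ)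
      -- Near the equator the point of the momentum plane has radius `‖w‖/|ψ₂| → ∞` and direction
      -- `w/‖w‖ → θ₀`.
      have h4 : Tendsto (fun ψ => ‖w ψ‖ * |ψ.1 2|⁻¹) l atTop :=
        hwl.pos_mul_atTop one_pos h3.inv_tendsto_nhdsGT_zero
      have h5 : Tendsto (fun ψ => ‖w ψ‖⁻¹ • w ψ) l (𝓝 θ₀) := by
        have := (hwl.inv₀ one_ne_zero).smul (hwt.mono_left hl)
        simpa using this
      have h6 : ∀ᶠ ψ in l, ‖‖w ψ‖⁻¹ • w ψ‖ = 1 := by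
        filter_upwards [hpos] with ψ hψ
        rw [norm_smul, norm_inv, norm_norm, inv_mul_cancel₀ hψ.ne']
      refine (hP.tendsto hn hlim h4 h6 h5).congr' ?_
      filter_upwards [hpos] with ψ hψ
      rw [smul_smul, sphereToPlane_eq, mul_comm ‖w ψ‖, mul_assoc, mul_inv_cancel₀ hψ.ne', mul_one]
    rw [ContinuousAt, hval]
    unfold bulkDifferenceProj
    -- The equator is approached from the north, from the south and along itself. The last case uses
    -- the continuity of the limit in the direction.
    refine Tendsto.if ?_ (Tendsto.if ?_ ?_)
    · exact hopen (S := {ψ | 0 < ψ.1 2}) (fun ψ hψ => ne_of_gt hψ) hNl (h.north θ₀ hn)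
        inf_le_left (mem_inf_of_right (mem_principal_self _))
    · exact hopen (S := {ψ | ψ.1 2 < 0}) (fun ψ hψ => ne_of_lt hψ) hSl (h.south θ₀ hn)
        (inf_le_left.trans inf_le_left) (mem_inf_of_right (mem_principal_self _))
    · have hc := h.continuous_limit θ₀ (by simpa using hn)
      refine hc.tendsto.comp (tendsto_nhdsWithin_iff.mpr
        ⟨hwt.mono_left (inf_le_left.trans inf_le_left), ?_⟩)
      have hA : ∀ᶠ ψ : Sphere2 in 𝓝 φ ⊓ 𝓟 {x : Sphere2 | ¬0 < x.1 2} ⊓ 𝓟 {x : Sphere2 | ¬x.1 2 < 0},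
          ¬0 < ψ.1 2 :=
        mem_inf_of_left (mem_inf_of_right (mem_principal_self _))
      have hB : ∀ᶠ ψ : Sphere2 in 𝓝 φ ⊓ 𝓟 {x : Sphere2 | ¬0 < x.1 2} ⊓ 𝓟 {x : Sphere2 | ¬x.1 2 < 0},
          ¬ψ.1 2 < 0 := mem_inf_of_right (mem_principal_self _)
      filter_upwards [hA, hB] with ψ h3 h4
      have h5 := sphere_norm ψ
      rw [le_antisymm (not_lt.mp h3) (not_lt.mp h4)] at h5
      rw [mem_sphere_zero_iff_norm]
      exact (pow_eq_one_iff_of_nonneg (norm_nonneg _) two_ne_zero).mp (by linarith)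
  · have hev : bulkDifferenceProj PN PS Pinf =ᶠ[𝓝 φ] fun φ => PN (sphereToPlane φ) := by
      filter_upwards [(isOpen_lt continuous_const h2c).mem_nhds h0] with ψ hψ
      have hψ' : 0 < ψ.1 2 := hψ
      rw [bulkDifferenceProj, if_pos hψ']
    exact (hN.continuousAt.comp (continuousAt_sphereToPlane h0.ne')).congr hev.symm

lemma IsStarProjection.of_tendsto {ι : Type*} {l : Filter ι} [l.NeBot] {A : ι → Mat n} {B : Mat n}
    (h : ∀ i, IsStarProjection (A i)) (hA : Tendsto A l (𝓝 B)) : IsStarProjection B where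
  isIdempotentElem := tendsto_nhds_unique (hA.mul hA) (hA.congr fun i => ((h i).1 : _ = _).symm)
  isSelfAdjoint := tendsto_nhds_unique (Filter.Tendsto.star hA)
    (hA.congr fun i => ((h i).2 : _ = _).symm)

/-- On the equator this holds because the orthogonal projections form a closed set. -/
lemma isStarProjection_bulkDifferenceProj (hN : ∀ k, IsStarProjection (PN k))
    (hS : ∀ k, IsStarProjection (PS k)) (h : GluesAtInfinity PN PS Pinf) (φ : Sphere2) :
    IsStarProjection (bulkDifferenceProj PN PS Pinf φ) := by
  unfold bulkDifferenceProj
  split_ifs with h1 h2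
  · exact hN _
  · exact hS _
  · refine IsStarProjection.of_tendsto (fun r => hN _) (h.north _ ?_)
    have h3 := sphere_norm φ
    rw [le_antisymm (not_lt.mp h1) (not_lt.mp h2)] at h3
    exact (pow_eq_one_iff_of_nonneg (norm_nonneg _) two_ne_zero).mp (by linarith)

lemma bulkDifferenceProj_north (k : Momentum) :
    bulkDifferenceProj PN PS Pinf (planeToSphere 1 k) = PN k := by
  have hb := bracket_pos k
  have h1 : (planeToSphere 1 k).1 2 = 1 / bracket k := by simp [planeToSphere]
  rw [bulkDifferenceProj, h1, if_pos (by positivity)]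
  congr 1
  ext i
  fin_cases i <;> simp [sphereToPlane, planeToSphere, abs_of_pos hb, hb.ne']

lemma bulkDifferenceProj_south (k : Momentum) :
    bulkDifferenceProj PN PS Pinf (planeToSphere (-1) k) = PS k := by
  have hb := bracket_pos k
  have h1 : (planeToSphere (-1) k).1 2 = -(1 / bracket k) := by simp [planeToSphere, neg_div]
  have h2 : 0 < 1 / bracket k := by positivity
  rw [bulkDifferenceProj, h1, if_neg (by linarith), if_pos (by linarith)]
  congr 1
  ext i
  fin_cases i <;> simp [sphereToPlane, planeToSphere, abs_of_pos hb, hb.ne', abs_div]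

lemma chernDensity_bulkDifferenceProj (k : Momentum) :
    chernDensity (bulkDifferenceProj PN PS Pinf) k = curvature PS k - curvature PN k := by
  simp only [chernDensity, bulkDifferenceProj_north, bulkDifferenceProj_south]

lemma HasChernNumber.eq_of_integrable {P : Sphere2 → Mat n} {c : ℂ} (h : HasChernNumber P c)
    (hi : Integrable (chernDensity P)) :
    c = Complex.I / (2 * (Real.pi : ℂ)) * ∫ k, chernDensity P k :=
  tendsto_nhds_unique h (((aecover_ball (x := (0 : Momentum))
    tendsto_id).integral_tendsto_of_countably_generated hi).const_mul _)

end SphereProjector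

/-! ### The projector and curvature of the massive Dirac symbol. -/

section DiracAlgebra

/-- The first Pauli matrix. -/
def pauliX : Mat 2 := !![0, 1; 1, 0]

/-- The second Pauli matrix. -/
def pauliY : Mat 2 := !![0, -Complex.I; Complex.I, 0]

/-- The third Pauli matrix. -/
def pauliZ : Mat 2 := !![1, 0; 0, -1]

lemma diracBulk_eq (μ : ℝ) (k : Momentum) : diracBulk μ k =
    ((k 0 : ℝ) : ℂ) • pauliX + ((k 1 : ℝ) : ℂ) • pauliY + (μ : ℂ) • pauliZ := rfl

lemma diracBulk_entries (μ : ℝ) (k : Momentum) : diracBulk μ k =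
    !![(μ : ℂ), ((k 0 : ℝ) : ℂ) - Complex.I * ((k 1 : ℝ) : ℂ);
      ((k 0 : ℝ) : ℂ) + Complex.I * ((k 1 : ℝ) : ℂ), -(μ : ℂ)] := by
  rw [diracBulk]
  ext i j
  fin_cases i <;> fin_cases j <;> simp <;> ring

lemma diracBulk_isHermitian (μ : ℝ) (k : Momentum) : (diracBulk μ k).IsHermitian := by
  rw [diracBulk_entries, Matrix.IsHermitian]
  ext i j
  fin_cases i <;> fin_cases j <;> simp [Matrix.conjTranspose_apply] <;> ring

lemma norm_sq_momentum (k : Momentum) : ‖k‖ ^ 2 = k 0 ^ 2 + k 1 ^ 2 := by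
  rw [EuclideanSpace.norm_eq, Real.sq_sqrt (by positivity)]
  simp

lemma diracBulk_mul_self (μ : ℝ) (k : Momentum) :
    diracBulk μ k * diracBulk μ k = ((‖k‖ ^ 2 + μ ^ 2 : ℝ) : ℂ) • (1 : Mat 2) := by
  rw [norm_sq_momentum, diracBulk_entries]
  ext i j
  fin_cases i <;> fin_cases j <;> simp [Matrix.mul_apply, Fin.sum_univ_two] <;> ring_nf <;>
    (simp only [Complex.I_sq]; ring)

/-- The symbol is Hermitian with scalar square, hence a multiple of an isometry. -/
lemma norm_diracBulk_apply (μ : ℝ) (k : Momentum) (v : EuclideanSpace ℂ (Fin 2)) :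
    ‖Matrix.toEuclideanLin (diracBulk μ k) v‖ = Real.sqrt (‖k‖ ^ 2 + μ ^ 2) * ‖v‖ := by
  have hs := Matrix.isSymmetric_toEuclideanLin_iff.mpr (diracBulk_isHermitian μ k)
  have h1 := hs v (Matrix.toEuclideanLin (diracBulk μ k) v)
  rw [← toEuclideanLin_mul, diracBulk_mul_self, map_smul, LinearMap.smul_apply] at h1
  have h2 : Matrix.toEuclideanLin (1 : Mat 2) v = v := by
    simp [Matrix.toEuclideanLin]
  rw [h2, inner_smul_right, inner_self_eq_norm_sq_to_K, inner_self_eq_norm_sq_to_K] at h1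
  have h3 : ‖Matrix.toEuclideanLin (diracBulk μ k) v‖ ^ 2 = (‖k‖ ^ 2 + μ ^ 2) * ‖v‖ ^ 2 := by
    have : ((‖Matrix.toEuclideanLin (diracBulk μ k) v‖ ^ 2 : ℝ) : ℂ) =
        (((‖k‖ ^ 2 + μ ^ 2) * ‖v‖ ^ 2 : ℝ) : ℂ) := by
      push_cast
      push_cast at h1
      exact h1
    exact_mod_cast this
  rw [← Real.sqrt_sq (norm_nonneg (Matrix.toEuclideanLin (diracBulk μ k) v)), h3,
    Real.sqrt_mul (by positivity), Real.sqrt_sq (norm_nonneg _)]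

/-- The inverse of the modulus of the Dirac symbol. -/
noncomputable def invModulus (μ : ℝ) (k : Momentum) : ℝ := (Real.sqrt (‖k‖ ^ 2 + μ ^ 2))⁻¹

/-- As the square of the symbol is `d²` with `d = √(|k|² + μ²)`, all eigenvalues are `±d`, and there
the indicator of the negative half line coincides with the affine function `(1 - t/d)/2`. -/
lemma negProj_diracBulk {μ : ℝ} (hμ : μ ≠ 0) (k : Momentum) : negProj (diracBulk μ k) =
    (2⁻¹ : ℂ) • (1 - (invModulus μ k : ℂ) • diracBulk μ k) := by
  obtain ⟨U, V, hUV, hVU, -, hA, hP⟩ := exists_diagonalization (diracBulk_isHermitian μ k)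
  set l := (diracBulk_isHermitian μ k).eigenvalues with hl
  set d := Real.sqrt (‖k‖ ^ 2 + μ ^ 2) with hd
  have hd0 : 0 < d := Real.sqrt_pos.mpr (by positivity)
  have hdd : ‖k‖ ^ 2 + μ ^ 2 = d ^ 2 := (Real.sq_sqrt (by positivity)).symm
  have hAc : V * diracBulk μ k * U = Matrix.diagonal fun j => (l j : ℂ) := by
    conv_lhs => rw [hA]
    exact conj_cancel hVU _
  have hl2 : ∀ j, l j = d ∨ l j = -d := fun j => by
    have h1 := conj_mul hUV (diracBulk μ k) (diracBulk μ k)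
    rw [hAc, diracBulk_mul_self, Matrix.mul_smul, mul_one, Matrix.smul_mul, hVU,
      Matrix.diagonal_mul_diagonal, hdd] at h1
    have h2 := congrFun (congrFun h1 j) j
    simp only [Matrix.smul_apply, Matrix.one_apply_eq, Matrix.diagonal_apply_eq, smul_eq_mul,
      mul_one] at h2
    have h3 : d ^ 2 = l j * l j := by exact_mod_cast h2
    exact sq_eq_sq_iff_eq_or_eq_neg.mp (by rw [h3, sq])
  have hneg : (fun j => (negInd (l j) : ℂ)) =
      fun j => (2⁻¹ : ℂ) * (1 - (invModulus μ k : ℂ) * (l j : ℂ)) := by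
    funext j
    have hdC : (d : ℂ) ≠ 0 := by exact_mod_cast hd0.ne'
    rw [invModulus, ← hd]
    rcases hl2 j with h | h <;> rw [h, negInd]
    · rw [if_neg (not_lt.mpr hd0.le)]
      push_cast
      rw [inv_mul_cancel₀ hdC]
      simp
    · rw [if_pos (by linarith)]
      push_cast
      rw [mul_neg, inv_mul_cancel₀ hdC]
      norm_num
  have hdiag : Matrix.diagonal (fun j => (2⁻¹ : ℂ) * (1 - (invModulus μ k : ℂ) * (l j : ℂ))) =
      (2⁻¹ : ℂ) • ((1 : Mat 2) - (invModulus μ k : ℂ) • Matrix.diagonal fun j => (l j : ℂ)) := by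
    ext i j
    by_cases h : i = j
    · subst h; simp
    · simp [h]
  rw [hP, hneg, hdiag, Matrix.mul_smul, Matrix.smul_mul, mul_sub, sub_mul, mul_one, hUV,
    Matrix.mul_smul, Matrix.smul_mul, ← hA]

lemma hasFDerivAt_invModulus {μ : ℝ} (hμ : μ ≠ 0) (k : Momentum) :
    HasFDerivAt (invModulus μ) ((-(invModulus μ k) ^ 3) • innerSL ℝ k) k := by
  have hpos : 0 < ‖k‖ ^ 2 + μ ^ 2 := by positivity
  have h1 : HasFDerivAt (fun k : Momentum => ‖k‖ ^ 2 + μ ^ 2) (2 • innerSL ℝ k) k :=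
    (hasStrictFDerivAt_norm_sq k).hasFDerivAt.add_const _
  have h2 := h1.sqrt hpos.ne'
  have h3 := (hasDerivAt_inv (Real.sqrt_pos.mpr hpos).ne').comp_hasFDerivAt k h2
  refine h3.congr_fderiv ?_
  ext v
  simp only [smul_apply, invModulus, smul_eq_mul]
  have := (Real.sqrt_pos.mpr hpos).ne'
  field_simp
  simp

lemma pderiv_negProj_diracBulk {μ : ℝ} (hμ : μ ≠ 0) (k : Momentum) :
    pderiv 0 (fun k' => negProj (diracBulk μ k')) k = (-2⁻¹ : ℂ) • ((invModulus μ k : ℂ) • pauliX -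
      ((k 0 * invModulus μ k ^ 3 : ℝ) : ℂ) • diracBulk μ k) ∧
    pderiv 1 (fun k' => negProj (diracBulk μ k')) k = (-2⁻¹ : ℂ) • ((invModulus μ k : ℂ) • pauliY -
      ((k 1 * invModulus μ k ^ 3 : ℝ) : ℂ) • diracBulk μ k) := by
  have e : (fun k' => negProj (diracBulk μ k')) = fun k' =>
      (2⁻¹ : ℂ) • ((1 : Mat 2) - (invModulus μ k' : ℂ) • diracBulk μ k') :=
    funext fun k' => negProj_diracBulk hμ k'
  rw [e]
  have hc : ∀ i : Fin 2, HasFDerivAt (fun k' : Momentum => ((k' i : ℝ) : ℂ))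
      (Complex.ofRealCLM.comp (EuclideanSpace.proj (𝕜 := ℝ) i)) k := fun i =>
    (Complex.ofRealCLM.comp (EuclideanSpace.proj (𝕜 := ℝ) i)).hasFDerivAt
  have hH : HasFDerivAt (diracBulk μ)
      ((Complex.ofRealCLM.comp (EuclideanSpace.proj (𝕜 := ℝ) 0)).smulRight pauliX +
        (Complex.ofRealCLM.comp (EuclideanSpace.proj (𝕜 := ℝ) 1)).smulRight pauliY) k :=
    (((hc 0).smul_const pauliX).add ((hc 1).smul_const pauliY)).add_const _
  have hi : HasFDerivAt (fun k' => (invModulus μ k' : ℂ))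
      (Complex.ofRealCLM.comp ((-(invModulus μ k) ^ 3) • innerSL ℝ k)) k :=
    Complex.ofRealCLM.hasFDerivAt.comp k (hasFDerivAt_invModulus hμ k)
  have hP : HasFDerivAt (fun k' => (2⁻¹ : ℂ) • ((1 : Mat 2) - (invModulus μ k' : ℂ) • diracBulk μ k'))
      _ k := ((hi.smul hH).const_sub (1 : Mat 2)).const_smul (2⁻¹ : ℂ)
  constructor <;> rw [pderiv_eq_fderiv hP.differentiableAt, hP.fderiv]
  · simp [EuclideanSpace.inner_single_right]
    module
  · simp [EuclideanSpace.inner_single_right]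
    module

lemma curvature_negProj_diracBulk {μ : ℝ} (hμ : μ ≠ 0) (k : Momentum) :
    curvature (fun k' => negProj (diracBulk μ k')) k =
      -(Complex.I / 2) * ((μ * invModulus μ k ^ 3 : ℝ) : ℂ) := by
  obtain ⟨h0, h1⟩ := pderiv_negProj_diracBulk hμ k
  rw [curvature, h0, h1, negProj_diracBulk hμ, diracBulk_entries, pauliX, pauliY,
    Matrix.trace_fin_two]
  simp [Matrix.mul_apply, Fin.sum_univ_two, Matrix.one_apply]
  ring

end DiracAlgebra

/-! ### The Chern number and the gluing condition for Dirac operators. -/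

section DiracChern

/-- In polar coordinates the integrand becomes `μ r (r² + μ²)^(-3/2)`, with primitive `-μ (r² +
μ²)^(-1/2)`. -/
lemma integral_ball_curvature_dirac {μ : ℝ} (hμ : μ ≠ 0) {ρ : ℝ} (hρ : 0 ≤ ρ) :
    ∫ k in Metric.ball (0 : Momentum) ρ, μ * invModulus μ k ^ 3 =
      2 * Real.pi * (μ * (|μ|⁻¹ - (Real.sqrt (ρ ^ 2 + μ ^ 2))⁻¹)) := by
  set g : ℝ → ℝ := fun r => μ * (Real.sqrt (r ^ 2 + μ ^ 2))⁻¹ ^ 3 with hg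
  have h1 : ∫ k in Metric.ball (0 : Momentum) ρ, μ * invModulus μ k ^ 3 =
      ∫ k : Momentum, (Set.Iio ρ).indicator g ‖k‖ := by
    rw [← integral_indicator measurableSet_ball]
    refine integral_congr_ae (Eventually.of_forall fun k => ?_)
    by_cases h : ‖k‖ < ρ
    · simp only [Set.indicator_of_mem (mem_ball_zero_iff.mpr h),
        Set.indicator_of_mem (Set.mem_Iio.mpr h)]
      rfl
    · have h2 : k ∉ Metric.ball (0 : Momentum) ρ := fun h' => h (mem_ball_zero_iff.mp h')
      simp only [Set.indicator_of_notMem h2,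
        Set.indicator_of_notMem (fun h' : ‖k‖ ∈ Set.Iio ρ => h h')]
  have h2 : ∀ r : ℝ, r ^ (Module.finrank ℝ Momentum - 1) • (Set.Iio ρ).indicator g r =
      (Set.Iio ρ).indicator (fun r => r * g r) r := fun r => by
    rw [finrank_euclideanSpace_fin, pow_one, smul_eq_mul]
    by_cases h : r ∈ Set.Iio ρ
    · rw [Set.indicator_of_mem h, Set.indicator_of_mem h]
    · rw [Set.indicator_of_notMem h, Set.indicator_of_notMem h, mul_zero]
  rw [h1, integral_fun_norm_addHaar, measureReal_ball_momentum zero_le_one]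
  simp only [h2]
  rw [setIntegral_indicator measurableSet_Iio, finrank_euclideanSpace_fin]
  have h3 : Set.Ioi (0 : ℝ) ∩ Set.Iio ρ = Set.Ioo 0 ρ := rfl
  rw [h3, ← integral_Ioc_eq_integral_Ioo, ← intervalIntegral.integral_of_le hρ]
  have hpos : ∀ r : ℝ, 0 < r ^ 2 + μ ^ 2 := fun r => by positivity
  have hd : ∀ r ∈ Set.uIcc 0 ρ, HasDerivAt (fun r : ℝ => -(μ * (Real.sqrt (r ^ 2 + μ ^ 2))⁻¹))
      (r * g r) r := fun r _ => by
    have e1 : HasDerivAt (fun r : ℝ => r ^ 2 + μ ^ 2) (2 * r) r := by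
      simpa using (hasDerivAt_pow 2 r).add_const (μ ^ 2)
    have hs := (Real.sqrt_pos.mpr (hpos r)).ne'
    have e2 := (((e1.sqrt (hpos r).ne').inv hs).const_mul μ).neg
    refine e2.congr_deriv ?_
    simp only [hg]
    field_simp
  have hgc : Continuous fun r => r * g r := by
    refine continuous_id.mul (continuous_const.mul (Continuous.pow (Continuous.inv₀ ?_ ?_) 3))
    · fun_prop
    · exact fun r => (Real.sqrt_pos.mpr (hpos r)).ne'
  rw [intervalIntegral.integral_eq_sub_of_hasDerivAt hd (hgc.intervalIntegrable _ _)]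
  have h4 : Real.sqrt ((0 : ℝ) ^ 2 + μ ^ 2) = |μ| := by
    rw [zero_pow two_ne_zero, zero_add, Real.sqrt_sq_eq_abs]
  rw [h4]
  simp only [smul_eq_mul, nsmul_eq_mul]
  push_cast
  ring

lemma mul_inv_abs_eq_sign {μ : ℝ} (hμ : μ ≠ 0) : μ * |μ|⁻¹ = Real.sign μ := by
  rcases lt_or_gt_of_ne hμ with h | h
  · rw [abs_of_neg h, Real.sign_of_neg h, inv_neg, mul_neg, mul_inv_cancel₀ hμ]
  · rw [abs_of_pos h, Real.sign_of_pos h, mul_inv_cancel₀ hμ]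

lemma tendsto_integral_curvature_dirac {μ : ℝ} (hμ : μ ≠ 0) :
    Tendsto (fun ρ : ℝ => ∫ k in Metric.ball (0 : Momentum) ρ, μ * invModulus μ k ^ 3) atTop
      (𝓝 (2 * Real.pi * Real.sign μ)) := by
  have h1 : Tendsto (fun ρ : ℝ => (Real.sqrt (ρ ^ 2 + μ ^ 2))⁻¹) atTop (𝓝 0) := by
    refine tendsto_inv_atTop_zero.comp (Real.tendsto_sqrt_atTop.comp ?_)
    exact tendsto_atTop_add_const_right _ _ (tendsto_pow_atTop two_ne_zero)
  have h2 := ((h1.const_sub |μ|⁻¹).const_mul μ).const_mul (2 * Real.pi)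
  rw [sub_zero, mul_inv_abs_eq_sign hμ] at h2
  refine h2.congr' ?_
  filter_upwards [eventually_ge_atTop 0] with ρ hρ
  rw [integral_ball_curvature_dirac hμ hρ]

lemma continuous_invModulus {μ : ℝ} (hμ : μ ≠ 0) : Continuous (invModulus μ) :=
  continuous_iff_continuousAt.mpr fun k => (hasFDerivAt_invModulus hμ k).continuousAt

/-- Each mass contributes half the sign of the mass to the limit. The values on the equator play no
role since the density is read off in the momentum planes. -/
lemma hasChernNumber_dirac {μp μm : ℝ} (hp : μp ≠ 0) (hm : μm ≠ 0) (Pinf : Momentum → Mat 2) :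
    HasChernNumber (bulkDifferenceProj (fun k => negProj (diracBulk μp k))
      (fun k => negProj (diracBulk μm k)) Pinf)
      ((1 / 2 * (Real.sign μm - Real.sign μp) : ℝ) : ℂ) := by
  have hint : ∀ {μ : ℝ}, μ ≠ 0 → ∀ ρ, IntegrableOn (fun k => μ * invModulus μ k ^ 3)
      (Metric.ball (0 : Momentum) ρ) := fun {μ} hμ ρ => by
    have : Continuous fun k : Momentum => μ * invModulus μ k ^ 3 :=
      continuous_const.mul ((continuous_invModulus hμ).pow 3)
    exact (this.continuousOn.integrableOn_compact (isCompact_closedBall 0 ρ)).mono_set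
      Metric.ball_subset_closedBall
  have h1 := ((tendsto_integral_curvature_dirac hm).sub
    (tendsto_integral_curvature_dirac hp)).const_mul (1 / (4 * Real.pi))
  have e : 1 / (4 * Real.pi) * (2 * Real.pi * Real.sign μm - 2 * Real.pi * Real.sign μp) =
      1 / 2 * (Real.sign μm - Real.sign μp) := by
    have := Real.pi_ne_zero
    field_simp
    ring
  rw [e] at h1
  refine ((Complex.continuous_ofReal.tendsto _).comp h1).congr fun ρ => ?_
  simp only [Function.comp_apply, chernDensity_bulkDifferenceProj, curvature_negProj_diracBulk hp,
    curvature_negProj_diracBulk hm]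
  rw [← integral_sub (hint hm ρ) (hint hp ρ)]
  have e2 : ∀ k : Momentum, -(Complex.I / 2) * ((μm * invModulus μm k ^ 3 : ℝ) : ℂ) -
      -(Complex.I / 2) * ((μp * invModulus μp k ^ 3 : ℝ) : ℂ) = -(Complex.I / 2) *
        ((μm * invModulus μm k ^ 3 - μp * invModulus μp k ^ 3 : ℝ) : ℂ) := fun k => by
    push_cast
    ring
  simp only [e2]
  rw [integral_const_mul, integral_complex_ofReal]
  have hπ : (Real.pi : ℂ) ≠ 0 := by exact_mod_cast Real.pi_ne_zero
  push_cast
  field_simp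
  rw [Complex.I_sq]
  ring

lemma tendsto_invModulus (μ : ℝ) {θ : Momentum} (hθ : ‖θ‖ = 1) :
    Tendsto (fun r : ℝ => invModulus μ (r • θ)) atTop (𝓝 0) ∧
      Tendsto (fun r : ℝ => r * invModulus μ (r • θ)) atTop (𝓝 1) := by
  have e : ∀ r : ℝ, invModulus μ (r • θ) = (Real.sqrt (r ^ 2 + μ ^ 2))⁻¹ := fun r => by
    rw [invModulus, norm_smul, hθ, mul_one, Real.norm_eq_abs, sq_abs]
  have h0 : Tendsto (fun r : ℝ => (Real.sqrt (r ^ 2 + μ ^ 2))⁻¹) atTop (𝓝 0) := by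
    refine tendsto_inv_atTop_zero.comp (Real.tendsto_sqrt_atTop.comp ?_)
    exact tendsto_atTop_add_const_right _ _ (tendsto_pow_atTop two_ne_zero)
  simp only [e]
  refine ⟨h0, ?_⟩
  have h1 : Tendsto (fun r : ℝ => Real.sqrt (1 - (μ * (Real.sqrt (r ^ 2 + μ ^ 2))⁻¹) ^ 2)) atTop
      (𝓝 (Real.sqrt (1 - (μ * 0) ^ 2))) :=
    (Real.continuous_sqrt.tendsto _).comp (((h0.const_mul μ).pow 2).const_sub 1)
  simp only [mul_zero, ne_eq, OfNat.ofNat_ne_zero, not_false_eq_true, zero_pow, sub_zero,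
    Real.sqrt_one] at h1
  refine h1.congr' ?_
  filter_upwards [eventually_gt_atTop 0] with r hr
  have hpos : 0 < r ^ 2 + μ ^ 2 := by positivity
  have hs := Real.sqrt_pos.mpr hpos
  rw [Real.sqrt_eq_iff_mul_self_eq_of_pos (by positivity)]
  have h2 := Real.sq_sqrt hpos.le
  field_simp
  rw [h2]
  ring

lemma diracBulk_smul (μ : ℝ) (c : ℂ) (r : ℝ) (θ : Momentum) : c • diracBulk μ (r • θ) =
    (c * r) • diracBulk 0 θ + (c * μ) • pauliZ := by
  simp only [diracBulk_eq, PiLp.smul_apply, smul_eq_mul, Complex.ofReal_mul, Complex.ofReal_zero,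
    zero_smul, add_zero, smul_add, smul_smul, mul_assoc]

/-- The mass is bounded while the symbol grows linearly, so at infinity both projectors approach
that of the massless symbol in the direction `θ`. -/
lemma gluesAtInfinity_dirac {μp μm : ℝ} (hp : μp ≠ 0) (hm : μm ≠ 0) :
    GluesAtInfinity (fun k => negProj (diracBulk μp k)) (fun k => negProj (diracBulk μm k))
      fun θ => (2⁻¹ : ℂ) • (1 - diracBulk 0 θ) := by
  have key : ∀ {μ : ℝ}, μ ≠ 0 → ∀ θ : Momentum, ‖θ‖ = 1 → Tendsto
      (fun r : ℝ => negProj (diracBulk μ (r • θ))) atTop (𝓝 ((2⁻¹ : ℂ) • (1 - diracBulk 0 θ))) := by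
    intro μ hμ θ hθ
    obtain ⟨h0, h1⟩ := tendsto_invModulus μ hθ
    have h0' : Tendsto (fun r : ℝ => ((invModulus μ (r • θ) : ℝ) : ℂ) * μ) atTop (𝓝 0) := by
      have := ((Complex.continuous_ofReal.tendsto _).comp h0).mul_const (μ : ℂ)
      simpa using this
    have h1' : Tendsto (fun r : ℝ => ((invModulus μ (r • θ) : ℝ) : ℂ) * r) atTop (𝓝 1) := by
      have := (Complex.continuous_ofReal.tendsto _).comp h1
      simpa [Function.comp_def, mul_comm] using this
    have h2 := (((h1'.smul_const (diracBulk 0 θ)).add (h0'.smul_const pauliZ)).const_sub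
      (1 : Mat 2)).const_smul (2⁻¹ : ℂ)
    rw [one_smul, zero_smul, add_zero] at h2
    refine h2.congr fun r => ?_
    rw [negProj_diracBulk hμ, diracBulk_smul]
  refine ⟨Continuous.continuousOn ?_, key hp, key hm⟩
  have hc : ∀ i : Fin 2, Continuous fun k : Momentum => ((k i : ℝ) : ℂ) := fun i =>
    Complex.continuous_ofReal.comp (EuclideanSpace.proj (𝕜 := ℝ) i).continuous
  simp only [diracBulk_eq]
  exact (continuous_const.sub ((((hc 0).smul (continuous_const (y := pauliX))).add
    ((hc 1).smul (continuous_const (y := pauliY)))).add continuous_const)).const_smul (2⁻¹ : ℂ)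

end DiracChern

/-! ### Symbol estimates for Dirac operators. -/

section DiracSymbol

lemma exists_iteratedFDeriv_bound {g : ℝ → ℂ} (hg : ContDiff ℝ (⊤ : ℕ∞) g) {L : ℝ} {cp cm : ℂ}
    (hp : ∀ y, L ≤ y → g y = cp) (hm : ∀ y, y ≤ -L → g y = cm) (N : ℕ) :
    ∃ B : ℝ, 0 ≤ B ∧ ∀ y, ‖iteratedFDeriv ℝ N g y‖ ≤ B := by
  have hc : Continuous fun y => iteratedFDeriv ℝ N g y :=
    hg.continuous_iteratedFDeriv (by exact_mod_cast (le_top : (N : ℕ∞) ≤ ⊤))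
  obtain ⟨B, hB⟩ := (isCompact_Icc (a := -L) (b := L)).exists_bound_of_continuousOn hc.continuousOn
  have hconst : ∀ (c : ℂ) (y : ℝ), ‖iteratedFDeriv ℝ N (fun _ : ℝ => c) y‖ ≤ ‖c‖ := fun c y => by
    rcases eq_or_ne N 0 with rfl | hN
    · rw [norm_iteratedFDeriv_zero]
    · rw [iteratedFDeriv_const_of_ne hN]
      simp
  refine ⟨max B 0 + ‖cp‖ + ‖cm‖, by positivity, fun y => ?_⟩
  have h0 := norm_nonneg cp
  have h1 := norm_nonneg cm
  have h2 := le_max_right B 0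
  rcases lt_or_ge L y with h | h
  · have hev : g =ᶠ[𝓝 y] fun _ => cp := by
      filter_upwards [lt_mem_nhds h] with z hz
      exact hp z hz.le
    rw [(hev.iteratedFDeriv ℝ N).self_of_nhds]
    linarith [hconst cp y]
  rcases lt_or_ge y (-L) with h' | h'
  · have hev : g =ᶠ[𝓝 y] fun _ => cm := by
      filter_upwards [gt_mem_nhds h'] with z hz
      exact hm z hz.le
    rw [(hev.iteratedFDeriv ℝ N).self_of_nhds]
    linarith [hconst cm y]
  · linarith [hB y ⟨h', h⟩, le_max_left B 0]

lemma one_le_bracket (k : Momentum) : 1 ≤ bracket k :=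
  Real.one_le_sqrt.mpr (by nlinarith [sq_nonneg ‖k‖])

/-- Symbol bounds for the sum of a linear function of the momentum and a function of `y`. -/
lemma linear_symbol_bound (ℓ : Phase →L[ℝ] ℂ) (h0 : ℓ (EuclideanSpace.single 0 1) = 0)
    (h1 : ℓ (EuclideanSpace.single 1 1) = 0) (N : ℕ) (s : Fin N → Fin 4) :
    ∃ C : ℝ, 0 ≤ C ∧ ∀ X, ‖iteratedFDeriv ℝ N ℓ X fun l => EuclideanSpace.single (s l) 1‖ ≤
      C * bracket (mom X) ^ ((1 : ℝ) - ((Finset.univ.filter fun l => 2 ≤ s l).card : ℝ)) := by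
  rcases N with _ | _ | N
  · refine ⟨‖ℓ (EuclideanSpace.single 2 1)‖ + ‖ℓ (EuclideanSpace.single 3 1)‖, by positivity,
      fun X => ?_⟩
    have hX : X = X 0 • (EuclideanSpace.single 0 1 : Phase) + X 1 • (EuclideanSpace.single 1 1 : Phase)
        + X 2 • (EuclideanSpace.single 2 1 : Phase) + X 3 • (EuclideanSpace.single 3 1 : Phase) := by
      ext i; fin_cases i <;> simp
    rw [iteratedFDeriv_zero_apply]
    have h2 : ℓ X = X 2 • ℓ (EuclideanSpace.single 2 1) + X 3 • ℓ (EuclideanSpace.single 3 1) := by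
      conv_lhs => rw [hX]
      simp only [map_add, map_smul, h0, h1, smul_zero, zero_add]
    have hb : ∀ i, |mom X i| ≤ bracket (mom X) := fun i =>
      (abs_apply_le_norm _ i).trans (norm_le_bracket _)
    rw [h2, Finset.univ_eq_empty, Finset.filter_empty, Finset.card_empty, Nat.cast_zero, sub_zero, Real.rpow_one]
    refine (norm_add_le _ _).trans ?_
    rw [norm_smul, norm_smul, add_mul, mul_comm ‖ℓ _‖, mul_comm ‖ℓ _‖]
    exact add_le_add (mul_le_mul_of_nonneg_right (hb 0) (norm_nonneg _))
      (mul_le_mul_of_nonneg_right (hb 1) (norm_nonneg _))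
  · refine ⟨‖ℓ (EuclideanSpace.single (s 0) 1)‖, norm_nonneg _, fun X => ?_⟩
    rw [iteratedFDeriv_one_apply, ℓ.fderiv]
    refine le_mul_of_one_le_right (norm_nonneg _) (Real.one_le_rpow (one_le_bracket _) ?_)
    have := Finset.card_le_univ (Finset.univ.filter fun l => 2 ≤ s l)
    rw [Fintype.card_fin] at this
    have : ((Finset.univ.filter fun l => 2 ≤ s l).card : ℝ) ≤ 1 := by exact_mod_cast this
    linarith
  · refine ⟨0, le_rfl, fun X => ?_⟩
    rw [iteratedFDeriv_succ_apply_right]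
    have : (fun y => fderiv ℝ ℓ y) = fun _ => ℓ := funext fun y => ℓ.fderiv
    rw [this, iteratedFDeriv_const_of_ne (Nat.succ_ne_zero N)]
    simp

/-- A function of `y` alone has vanishing derivatives as soon as one other coordinate is involved.
Pure `y`-derivatives cost no power of `⟨k⟩`, and they are bounded because `g` is constant at both
ends. -/
lemma transverse_symbol_bound {g : ℝ → ℂ} (hg : ContDiff ℝ (⊤ : ℕ∞) g) {L : ℝ} {cp cm : ℂ}
    (hp : ∀ y, L ≤ y → g y = cp) (hm : ∀ y, y ≤ -L → g y = cm) (N : ℕ) (s : Fin N → Fin 4) :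
    ∃ C : ℝ, 0 ≤ C ∧ ∀ X,
      ‖iteratedFDeriv ℝ N (fun X : Phase => g (X 1)) X fun l => EuclideanSpace.single (s l) 1‖ ≤
      C * bracket (mom X) ^ ((1 : ℝ) - ((Finset.univ.filter fun l => 2 ≤ s l).card : ℝ)) := by
  obtain ⟨B, hB0, hB⟩ := exists_iteratedFDeriv_bound hg hp hm N
  refine ⟨B, hB0, fun X => ?_⟩
  have h1 := (EuclideanSpace.proj (𝕜 := ℝ) (1 : Fin 4)).iteratedFDeriv_comp_right hg X (i := N)
    (by exact_mod_cast (le_top : (N : ℕ∞) ≤ ⊤))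
  have h2 : (fun X : Phase => g (X 1)) = g ∘ EuclideanSpace.proj (𝕜 := ℝ) (1 : Fin 4) := rfl
  rw [h2, h1, ContinuousMultilinearMap.compContinuousLinearMap_apply]
  by_cases h3 : ∀ l, s l = 1
  · have h4 : (Finset.univ.filter fun l => 2 ≤ s l) = ∅ :=
      Finset.filter_eq_empty_iff.mpr fun l _ => by rw [h3 l]; decide
    rw [h4, Finset.card_empty, Nat.cast_zero, sub_zero, Real.rpow_one]
    refine (ContinuousMultilinearMap.le_opNorm _ _).trans ?_
    refine mul_le_mul (hB _) ?_ (Finset.prod_nonneg fun l _ => norm_nonneg _) hB0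
    refine (le_of_eq (Finset.prod_eq_one fun l _ => ?_)).trans (one_le_bracket _)
    simp [h3 l]
  · push Not at h3
    obtain ⟨l, hl⟩ := h3
    rw [ContinuousMultilinearMap.map_coord_zero _ l (by simp [Ne.symm hl]), norm_zero]
    exact mul_nonneg hB0 (Real.rpow_nonneg (bracket_pos _).le _)

end DiracSymbol

/-! ### The Dirac operator as an interface Hamiltonian of order one. -/

section DiracInterface

lemma isHermitianElliptic_diracSymbol {μ : ℝ → ℝ} (hμ : ContDiff ℝ (⊤ : ℕ∞) μ) {L μp μm : ℝ}
    (hp : ∀ y, L ≤ y → μ y = μp) (hm : ∀ y, y ≤ -L → μ y = μm) :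
    IsHermitianElliptic 1 (diracSymbol μ) where
  symbol := by
    set ℓ : Fin 2 → Fin 2 → Phase →L[ℝ] ℂ := fun p q =>
      pauliX p q • Complex.ofRealCLM.comp (EuclideanSpace.proj (𝕜 := ℝ) (2 : Fin 4)) +
        pauliY p q • Complex.ofRealCLM.comp (EuclideanSpace.proj (𝕜 := ℝ) (3 : Fin 4)) with hℓ
    set g : Fin 2 → Fin 2 → ℝ → ℂ := fun p q y => pauliZ p q * (μ y : ℂ) with hg
    have hgc : ∀ p q, ContDiff ℝ (⊤ : ℕ∞) (g p q) := fun p q =>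
      contDiff_const.mul (Complex.ofRealCLM.contDiff.comp hμ)
    have he : ∀ p q, (fun X => diracSymbol μ X p q) =
        (ℓ p q : Phase → ℂ) + fun X : Phase => g p q (X 1) := fun p q => by
      funext X
      simp only [diracSymbol, diracBulk_eq, Matrix.add_apply, Matrix.smul_apply, hℓ, hg,
        Pi.add_apply, add_apply, smul_apply, ContinuousLinearMap.comp_apply,
        PiLp.proj_apply, Complex.ofRealCLM_apply, mom_zero, mom_one, smul_eq_mul]
      ring
    have hgX : ∀ p q, ContDiff ℝ (⊤ : ℕ∞) fun X : Phase => g p q (X 1) := fun p q =>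
      (hgc p q).comp (contDiff_coord 1)
    refine ⟨fun p q => ?_, fun N s => ?_⟩
    · rw [he]
      exact (ℓ p q).contDiff.add (hgX p q)
    · have h0 : ∀ p q, ℓ p q (EuclideanSpace.single 0 1) = 0 := fun p q => by simp [hℓ]
      have h1 : ∀ p q, ℓ p q (EuclideanSpace.single 1 1) = 0 := fun p q => by simp [hℓ]
      choose C hC0 hC using fun p q => linear_symbol_bound (ℓ p q) (h0 p q) (h1 p q) N s
      choose D hD0 hD using fun p q => transverse_symbol_bound (hgc p q) (L := L)
        (cp := pauliZ p q * μp) (cm := pauliZ p q * μm)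
        (fun y hy => by simp only [hg, hp y hy]) (fun y hy => by simp only [hg, hm y hy]) N s
      refine ⟨∑ p, ∑ q, (C p q + D p q), fun X p q => ?_⟩
      have hN : ((N : ℕ∞) : WithTop ℕ∞) ≤ ((⊤ : ℕ∞) : WithTop ℕ∞) := by exact_mod_cast le_top
      have h2 : C p q + D p q ≤ ∑ p, ∑ q, (C p q + D p q) :=
        (Finset.single_le_sum (f := fun q => C p q + D p q)
          (fun q _ => add_nonneg (hC0 p q) (hD0 p q)) (Finset.mem_univ q)).trans
        (Finset.single_le_sum (f := fun p => ∑ q, (C p q + D p q))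
          (fun p _ => Finset.sum_nonneg fun q _ => add_nonneg (hC0 p q) (hD0 p q))
          (Finset.mem_univ p))
      rw [he, iteratedFDeriv_add_apply ((ℓ p q).contDiff.contDiffAt)
        ((hgX p q).of_le hN).contDiffAt, add_apply]
      refine (norm_add_le _ _).trans ((add_le_add (hC p q X) (hD p q X)).trans ?_)
      rw [← add_mul]
      exact mul_le_mul_of_nonneg_right h2 (Real.rpow_nonneg (bracket_pos _).le _)
  hermitian X := diracBulk_isHermitian _ _
  elliptic := by
    -- The constant 1 works because `⟨k⟩ - 1 ≤ |k| ≤ √(|k|² + μ²)`.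
    refine ⟨1, one_pos, fun X v => ?_⟩
    rw [diracSymbol, norm_diracBulk_apply, one_mul, Real.rpow_one]
    refine mul_le_mul_of_nonneg_right ?_ (norm_nonneg _)
    have h1 : ‖mom X‖ ≤ Real.sqrt (‖mom X‖ ^ 2 + μ (X 1) ^ 2) :=
      Real.le_sqrt_of_sq_le (by nlinarith [sq_nonneg (μ (X 1))])
    have h2 : bracket (mom X) ≤ 1 + ‖mom X‖ :=
      Real.sqrt_le_iff.mpr ⟨by positivity, by nlinarith [norm_nonneg (mom X)]⟩
    linarith

/-- The product `(E - H)(E + H)` is the scalar `E² - |k|² - μ²`, which is negative inside the mass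
gap. -/
lemma isUnit_sub_diracBulk {μ E : ℝ} (h : |E| < |μ|) (k : Momentum) :
    IsUnit ((E : ℂ) • (1 : Mat 2) - diracBulk μ k) := by
  have h1 : E ^ 2 < μ ^ 2 := sq_lt_sq.mpr h
  have hne : ((E ^ 2 - (‖k‖ ^ 2 + μ ^ 2) : ℝ) : ℂ) ≠ 0 := by
    have : E ^ 2 - (‖k‖ ^ 2 + μ ^ 2) < 0 := by nlinarith [sq_nonneg ‖k‖]
    exact_mod_cast this.ne
  have h2 : ((E : ℂ) • (1 : Mat 2) - diracBulk μ k) * ((E : ℂ) • (1 : Mat 2) + diracBulk μ k) =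
      ((E ^ 2 - (‖k‖ ^ 2 + μ ^ 2) : ℝ) : ℂ) • 1 := by
    rw [sub_mul, mul_add, mul_add, diracBulk_mul_self]
    simp only [Matrix.smul_mul, Matrix.mul_smul, one_mul, mul_one]
    push_cast
    module
  refine IsUnit.of_mul_eq_one (((E ^ 2 - (‖k‖ ^ 2 + μ ^ 2) : ℝ) : ℂ)⁻¹ •
    ((E : ℂ) • (1 : Mat 2) + diracBulk μ k)) ?_
  rw [Matrix.mul_smul, h2, smul_smul, inv_mul_cancel₀ hne, one_smul]

lemma isDifferentialSymbol_dirac (μ : ℝ → ℝ) : IsDifferentialSymbol 1 (diracSymbol μ) := by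
  intro x y p q
  refine ⟨MvPolynomial.C (pauliX p q) * MvPolynomial.X 0 +
    MvPolynomial.C (pauliY p q) * MvPolynomial.X 1 + MvPolynomial.C (pauliZ p q * (μ y : ℂ)), ?_,
    fun k => ?_⟩
  · have h : ∀ (c : ℂ) (i : Fin 2),
        (MvPolynomial.C c * MvPolynomial.X i : MvPolynomial (Fin 2) ℂ).totalDegree ≤ 1 :=
      fun c i => (MvPolynomial.totalDegree_mul _ _).trans (by simp)
    refine (MvPolynomial.totalDegree_add _ _).trans (max_le
      ((MvPolynomial.totalDegree_add _ _).trans (max_le (h _ _) (h _ _))) ?_)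
    rw [MvPolynomial.totalDegree_C]
    exact zero_le_one
  · simp only [diracSymbol, diracBulk_eq, Matrix.add_apply, Matrix.smul_apply, mom_zero, mom_one,
      smul_eq_mul, map_add, map_mul, MvPolynomial.eval_C, MvPolynomial.eval_X]
    simp
    ring

lemma interfaceHamiltonian_dirac {μ : ℝ → ℝ} {μp μm L : ℝ} (hμ : ContDiff ℝ (⊤ : ℕ∞) μ)
    (hL : 0 < L) (hp0 : μp ≠ 0) (hm0 : μm ≠ 0) (hp : ∀ y, L ≤ y → μ y = μp)
    (hm : ∀ y, y ≤ -L → μ y = μm) :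
    InterfaceHamiltonian 1 (diracSymbol μ) (diracBulk μp) (diracBulk μm) L
      (-(min |μp| |μm| / 2)) (min |μp| |μm| / 2) := by
  have hδ : 0 < min |μp| |μm| := lt_min (abs_pos.mpr hp0) (abs_pos.mpr hm0)
  have hE : ∀ E ∈ Set.Icc (-(min |μp| |μm| / 2)) (min |μp| |μm| / 2), |E| < min |μp| |μm| :=
    fun E hE => (abs_le.mpr hE).trans_lt (half_lt_self hδ)
  exact
  { order_pos := one_pos
    interface := isHermitianElliptic_diracSymbol hμ hp hm
    bulk_north := isHermitianElliptic_diracSymbol (μ := fun _ => μp) contDiff_const (L := 0)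
      (fun _ _ => rfl) fun _ _ => rfl
    bulk_south := isHermitianElliptic_diracSymbol (μ := fun _ => μm) contDiff_const (L := 0)
      (fun _ _ => rfl) fun _ _ => rfl
    width_pos := hL
    eq_north := fun X hX => by rw [diracSymbol, hp _ hX.le]
    eq_south := fun X hX => by rw [diracSymbol, hm _ hX.le]
    gap_nonempty := by linarith
    gap_north := fun E h k => isUnit_sub_diracBulk ((hE E h).trans_le (min_le_left _ _)) k
    gap_south := fun E h k => isUnit_sub_diracBulk ((hE E h).trans_le (min_le_right _ _)) k }

end DiracInterface

/-! ### Assembly of the main theorem. -/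

section Conclusion

variable {n : ℕ} {m L E₁ E₂ : ℝ} {σ : Phase → Mat n} {σN σS Pinf : Momentum → Mat n}

lemma InterfaceHamiltonian.continuous_negProj (h : InterfaceHamiltonian m σ σN σS L E₁ E₂)
    (h0 : (0 : ℝ) ∈ Set.Ioo E₁ E₂) :
    Continuous (fun k => negProj (σN k)) ∧ Continuous fun k => negProj (σS k) := by
  obtain ⟨c₀, c, C, K, hw, -⟩ := h.exists_isWall h0
  exact ⟨continuous_iff_continuousAt.mpr fun k => continuousAt_negProj hw.hermitian_north
      ((hw.gap_north k).isUnit hw.gap_pos) hw.smooth_north.continuous.continuousAt,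
    continuous_iff_continuousAt.mpr fun k => continuousAt_negProj hw.hermitian_south
      ((hw.gap_south k).isUnit hw.gap_pos) hw.smooth_south.continuous.continuousAt⟩

lemma InterfaceHamiltonian.hasChernNumber (h : InterfaceHamiltonian m σ σN σS L E₁ E₂)
    (h0 : (0 : ℝ) ∈ Set.Ioo E₁ E₂)
    (hab : LowerOrderWall m σ ∨ ∃ d : ℕ, Odd d ∧ m = (d : ℝ) ∧ IsDifferentialSymbol d σ) {R : ℝ}
    (hR : 0 < R) (hinv : InvertibleOutside (domainWallSymbol σ) R) :
    HasChernNumber (bulkDifferenceProj (fun k => negProj (σN k)) (fun k => negProj (σS k)) Pinf)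
      (fedosovHormander (domainWallSymbol σ) R) :=
  (h.tendsto_curvature h0 hab hR hinv).congr fun ρ => by
    simp only [chernDensity_bulkDifferenceProj]

end Conclusion

end BulkDifference

theorem mainTheorem11 :
    (∀ (n : ℕ) (m L E₁ E₂ : ℝ) (σ : BulkDifference.Phase → BulkDifference.Mat n)
      (σN σS Pinf : BulkDifference.Momentum → BulkDifference.Mat n),
      BulkDifference.InterfaceHamiltonian m σ σN σS L E₁ E₂ →
      (0 : ℝ) ∈ Set.Ioo E₁ E₂ →
      (BulkDifference.LowerOrderWall m σ ∨
        ∃ d : ℕ, Odd d ∧ m = (d : ℝ) ∧ BulkDifference.IsDifferentialSymbol d σ) →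
      BulkDifference.GluesAtInfinity (fun k => BulkDifference.negProj (σN k))
        (fun k => BulkDifference.negProj (σS k)) Pinf →
      ∀ P : BulkDifference.Sphere2 → BulkDifference.Mat n,
      P = BulkDifference.bulkDifferenceProj (fun k => BulkDifference.negProj (σN k))
        (fun k => BulkDifference.negProj (σS k)) Pinf →
        Continuous P ∧ (∀ φ, IsStarProjection (P φ)) ∧
        (∃ R : ℝ, 0 < R ∧
          BulkDifference.InvertibleOutside (BulkDifference.domainWallSymbol σ) R) ∧
        ∀ R : ℝ, 0 < R →
          BulkDifference.InvertibleOutside (BulkDifference.domainWallSymbol σ) R →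
          BulkDifference.HasChernNumber P
              (BulkDifference.fedosovHormander (BulkDifference.domainWallSymbol σ) R) ∧
            (MeasureTheory.Integrable (BulkDifference.chernDensity P) →
              BulkDifference.fedosovHormander (BulkDifference.domainWallSymbol σ) R =
                Complex.I / (2 * (Real.pi : ℂ)) * ∫ k, BulkDifference.chernDensity P k)) ∧
    (∀ (μ : ℝ → ℝ) (μp μm L : ℝ), ContDiff ℝ (⊤ : ℕ∞) μ → 0 < L → μp ≠ 0 → μm ≠ 0 →
      (∀ y, L ≤ y → μ y = μp) → (∀ y, y ≤ -L → μ y = μm) →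
      ∃ Pinf : BulkDifference.Momentum → BulkDifference.Mat 2,
        BulkDifference.GluesAtInfinity
          (fun k => BulkDifference.negProj (BulkDifference.diracBulk μp k))
          (fun k => BulkDifference.negProj (BulkDifference.diracBulk μm k)) Pinf ∧
        BulkDifference.HasChernNumber
          (BulkDifference.bulkDifferenceProj
            (fun k => BulkDifference.negProj (BulkDifference.diracBulk μp k))
            (fun k => BulkDifference.negProj (BulkDifference.diracBulk μm k)) Pinf)
          ((1 / 2 * (Real.sign μm - Real.sign μp) : ℝ) : ℂ) ∧
        ∀ R : ℝ, 0 < R →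
          BulkDifference.InvertibleOutside
            (BulkDifference.domainWallSymbol (BulkDifference.diracSymbol μ)) R →
          BulkDifference.fedosovHormander
              (BulkDifference.domainWallSymbol (BulkDifference.diracSymbol μ)) R =
            ((1 / 2 * (Real.sign μm - Real.sign μp) : ℝ) : ℂ)) := by
  refine ⟨fun n m L E₁ E₂ σ σN σS Pinf h h0 hab hglue P hP => ?_,
    fun μ μp μm L hμ hL hp0 hm0 hp hm => ?_⟩
  · subst hP
    obtain ⟨hcN, hcS⟩ := h.continuous_negProj h0
    refine ⟨BulkDifference.continuous_bulkDifferenceProj hcN hcS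
        (h.bulk_north.angularLipschitz h.order_pos) (h.bulk_south.angularLipschitz h.order_pos)
        hglue,
      BulkDifference.isStarProjection_bulkDifferenceProj
        (fun k => BulkDifference.isStarProjection_negProj _)
        (fun k => BulkDifference.isStarProjection_negProj _) hglue,
      h.exists_invertibleOutside h0, fun R hR hinv => ?_⟩
    have hc := h.hasChernNumber (Pinf := Pinf) h0 hab hR hinv
    exact ⟨hc, fun hi => hc.eq_of_integrable hi⟩
  · have h := BulkDifference.interfaceHamiltonian_dirac hμ hL hp0 hm0 hp hm
    have hδ : 0 < min |μp| |μm| := lt_min (abs_pos.mpr hp0) (abs_pos.mpr hm0)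
    have hc := BulkDifference.hasChernNumber_dirac hp0 hm0 fun θ =>
      (2⁻¹ : ℂ) • (1 - BulkDifference.diracBulk 0 θ)
    refine ⟨_, BulkDifference.gluesAtInfinity_dirac hp0 hm0, hc, fun R hR hinv => ?_⟩
    -- The general theorem, applicable because the operator is differential of odd order 1, and the
    -- explicit computation give limits of the same family of integrals.
    refine tendsto_nhds_unique (h.hasChernNumber ⟨by linarith, by linarith⟩
      (Or.inr ⟨1, odd_one, Nat.cast_one.symm, BulkDifference.isDifferentialSymbol_dirac μ⟩)
      hR hinv) hc
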